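/- **Notation.** For $K\in\mathbb R$ let $\sin_K r=\sinh(\sqrt{-K}r)/\sqrt{-K}$, $r$, $\sin(\sqrt K r)/\sqrt K$ and $\cot_K r=\sqrt{-K}\coth(\sqrt{-K}r)$, $1/r$, $\sqrt K\cot(\sqrt K r)$ for $K<0$, $K=0$, $K>0$ respectively. Let $\Phi:(-\infty,\pi^2)\to\mathbb R$ be the decreasing bijection $\Phi(x)=\sqrt{-x}\coth\sqrt{-x}$, $1$, $\sqrt x\cot\sqrt x$ for $x<0$, $x=0$, $x>0$. Let $0<\alpha\le 1$, $0<R\le \pi^2/16$, let $I\subset\mathbb R$ be a nonempty bounded open interval, and let $\rho:I\to(0,R]$ be $C^2$ with $|\dot\rho|<1$. Put $$\kappa=\frac1{\rho^2}\Phi^{-1}\!\left(\frac{\rho\ddot\rho}{1-\dot\rho^2}\right),\qquad m=\inf_I\rho,\qquad t_0=\operatorname{argmin}\rho,\qquad K_0=\kappa(t_0),$$ where $t_0$ is a point of the closure of $I$; if $t_0$ is an endpoint of $I$, the conditions $\rho(t_0)=m$ and $\kappa(t_0)=K_0$ are understood as limits along $I$, the limit defining $K_0$ being assumed to exist. Put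 $$\phi_0(t)=\int_{t_0}^t\frac{\sqrt{1-\dot\rho^2}}{\sin_{K_0}\rho}\,ds,\qquad f_0=\frac{\ddot\rho}{1-\dot\rho^2}-\cot_{K_0}\rho,\qquad \gamma_0=\rho e^{i\phi_0},$$ $$\frac{\Delta f_0}{\Delta\rho}(s,t)=\frac{f_0(s)-f_0(t)}{\rho(s)-\rho(t)},\qquad \xi(s,t)=\frac{\rho(s)^{1+\alpha}|\phi_0'(s)|^\alpha|s-t|^\alpha}{|\rho(s)-\rho(t)|}\qquad(\rho(s)\ne\rho(t)).$$ **Finitely-detected estimates with constant $A>0$.** 1. $A^{-1}\le \rho\ddot\rho/(1-\dot\rho^2)\le A$ and $|\kappa|\le 1$ on $I$. 2. $|\phi_0|\le 3\pi/4$ on $I$, and for every subinterval $J\subseteq I$ and all $t_1,t_2\in J$, $\phi_0'(t_1)/\phi_0'(t_2)\le A\left(\sup_{s_1,s_2\in J}\rho(s_1)/\rho(s_2)\right)^A$. 3. If $J\subseteq I$ is an interval and $r>0$ satisfies $r/2\le\rho\le 2r$ on $J$, then for all $t,t_1,\dots,t_4\in J$ with $\rho(t_1)\ne\rho(t_2)$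 and $\rho(t_3)\neq\rho(t_4)$: $|f_0(t)|\le A r^{1+\alpha}$, $\left|\frac{\Delta f_0}{\Delta\rho}(t_1,t_2)\right|\le A\left(r^\alpha+\xi(t_1,t_2)\right)$, and $\left|\frac{\Delta f_0}{\Delta\rho}(t_1,t_2)-\frac{\Delta f_0}{\Delta\rho}(t_3,t_4)\right|\le A\left(\operatorname{diam}\{t_1,t_2,t_3,t_4\}^\alpha+\xi(t_1,t_2)+\xi(t_3,t_4)\right)$. 4. If $J,J'\subseteq I$ are intervals and $r,r'>0$ satisfy $r/2\le\rho\le2r$ on $J$ and $r'/2\le\rho\le2r'$ on $J'$, then for all $t_1,t_2\in J$, $t_3,t_4\in J'$ with $\rho(t_1)\ne\rho(t_2)$ and $\rho(t_3)\ne\rho(t_4)$: $$\left|\tfrac{\Delta f_0}{\Delta\rho}(t_1,t_2)+2f_0(t_1)\cot_{K_0}\rho(t_1)-\tfrac{\Delta f_0}{\Delta\rho}(t_3,t_4)-2f_0(t_3)\cot_{K_0}\rho(t_3)\right|\le A\left(\operatorname{diam}\{t_1,t_2,t_3,t_4\}^\alpha+\xi(t_1,t_2)+\xi(t_3,t_4)\right).$$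 **Proposition.** For every $A>0$ there is a constant $C>0$, depending only on $A$, such that for all $\alpha,R,I,\rho,t_0,K_0$ as above satisfying the finitely-detected estimates with constant $A$, the curve $\gamma_0$ lies in the open disc $D=B_R(0)\subset\mathbb C$, and there is a continuous function $f:D\to\mathbb R$, such that $r\mapsto f(re^{i\theta})$ is $C^1$ on $(0,R)$ for each $\theta$, with $$f\circ\gamma_0=f_0\ \text{ on } I,\qquad f\equiv0\ \text{ on } B_{m/2}(0),\qquad |f|\le C r\ \text{ on } D,$$ and, with respect to the Euclidean metric on $D$, the $\alpha$-Hölder seminorm of $f^2+2f\cot_{K_0}r+\partial_rf$ on $D$ is at most $C$ (this function is read as $0$ at the origin, near which $f$ vanishes). -/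

import Mathlib

open Set Filter Topology

noncomputable section

namespace RadialExt

/-- The generalized cotangent `cot_K r`: the solution of the Riccati equation
`h' + h ^ 2 + K = 0`, `h = 1 / r + O(r)`, for constant curvature `K`. -/
def cotK (K r : ℝ) : ℝ :=
  if K < 0 then √(-K) * (Real.cosh (√(-K) * r) / Real.sinh (√(-K) * r))
  else if K = 0 then 1 / r
  else √K * (Real.cos (√K * r) / Real.sin (√K * r))

/-- The generalized sine `sin_K r`. -/
def sinK (K r : ℝ) : ℝ :=
  if K < 0 then Real.sinh (√(-K) * r) / √(-K)
  else if K = 0 then r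
  else Real.sin (√K * r) / √K

/-- The function `Φ`, used on `(-∞, π ^ 2)`, where it is a strictly decreasing bijection
onto `ℝ`. -/
def Phi (x : ℝ) : ℝ :=
  if x < 0 then √(-x) * (Real.cosh √(-x) / Real.sinh √(-x))
  else if x = 0 then 1
  else √x * (Real.cos √x / Real.sin √x)

/-- The inverse `Φ⁻¹ : ℝ → (-∞, π ^ 2)`. -/
def PhiInv : ℝ → ℝ :=
  Function.invFunOn Phi (Iio (Real.pi ^ 2))

/-- `κ = ρ ^ (-2) Φ⁻¹ (ρ ρ'' / (1 - ρ' ^ 2))`. -/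
def kappa (ρ : ℝ → ℝ) (t : ℝ) : ℝ :=
  1 / ρ t ^ 2 * PhiInv (ρ t * deriv (deriv ρ) t / (1 - deriv ρ t ^ 2))

/-- `φ₀ (t) = ∫_{t₀}^t √(1 - ρ' ^ 2) / sin_{K₀} ρ`. -/
def phi0 (ρ : ℝ → ℝ) (t₀ K₀ t : ℝ) : ℝ :=
  ∫ s in t₀..t, √(1 - deriv ρ s ^ 2) / sinK K₀ (ρ s)

/-- `f₀ = ρ'' / (1 - ρ' ^ 2) - cot_{K₀} ρ`. -/
def f0 (ρ : ℝ → ℝ) (K₀ t : ℝ) : ℝ :=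
  deriv (deriv ρ) t / (1 - deriv ρ t ^ 2) - cotK K₀ (ρ t)

/-- The curve `γ₀ = ρ e ^ (i φ₀)`. -/
def gamma0 (ρ : ℝ → ℝ) (t₀ K₀ t : ℝ) : ℂ :=
  (ρ t : ℂ) * Complex.exp ((phi0 ρ t₀ K₀ t : ℂ) * Complex.I)

/-- The divided difference `Δf₀ / Δρ`; meaningful if `ρ s ≠ ρ t`. -/
def slope0 (ρ : ℝ → ℝ) (K₀ s t : ℝ) : ℝ :=
  (f0 ρ K₀ s - f0 ρ K₀ t) / (ρ s - ρ t)

/-- `ξ (s, t) = ρ(s) ^ (1 + α) |φ₀'(s)| ^ α |s - t| ^ α / |ρ(s) - ρ(t)|`;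
meaningful if `ρ s ≠ ρ t`. -/
def xi (α : ℝ) (ρ : ℝ → ℝ) (t₀ K₀ s t : ℝ) : ℝ :=
  ρ s ^ (1 + α) * |deriv (phi0 ρ t₀ K₀) s| ^ α * |s - t| ^ α / |ρ s - ρ t|

/-- `t₀` is the point of the closure of `I` where `ρ` attains its minimum. If `t₀ ∈ I` and `ρ`
is continuous this says that `ρ t₀` is the minimum of `ρ` on `I`; if `t₀` is an endpoint of the
open interval `I`, the value of `ρ` at `t₀` is understood as a limit. -/
def IsArgmin (I : Set ℝ) (ρ : ℝ → ℝ) (t₀ : ℝ) : Prop :=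
  t₀ ∈ closure I ∧ Tendsto ρ (𝓝[I] t₀) (𝓝 (sInf (ρ '' I)))

/-- `K₀ = κ (t₀)`. If `t₀` is an endpoint of the open interval `I`, this is again understood as
a limit. -/
def IsBaseCurvature (I : Set ℝ) (ρ : ℝ → ℝ) (t₀ K₀ : ℝ) : Prop :=
  Tendsto (kappa ρ) (𝓝[I] t₀) (𝓝 K₀)

/-- The finitely detected estimates, with all implied constants at most `A`. -/
structure FinitelyDetected (A α : ℝ) (I : Set ℝ) (ρ : ℝ → ℝ) (t₀ K₀ : ℝ) : Prop where
  /-- `ρ ρ'' / (1 - ρ' ^ 2) ∼ 1` -/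
  convexity : ∀ t ∈ I,
    A⁻¹ ≤ ρ t * deriv (deriv ρ) t / (1 - deriv ρ t ^ 2) ∧
      ρ t * deriv (deriv ρ) t / (1 - deriv ρ t ^ 2) ≤ A
  /-- `|κ| ≤ 1` -/
  curvature : ∀ t ∈ I, |kappa ρ t| ≤ 1
  /-- `max_J φ₀'(t₁) / φ₀'(t₂) ≤ A (max_J ρ(s₁) / ρ(s₂)) ^ A` for every subinterval `J` -/
  angle_variation : ∀ J ⊆ I, J.OrdConnected →
    ∀ M : ℝ, (∀ s₁ ∈ J, ∀ s₂ ∈ J, ρ s₁ / ρ s₂ ≤ M) →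
      ∀ t₁ ∈ J, ∀ t₂ ∈ J,
        deriv (phi0 ρ t₀ K₀) t₁ / deriv (phi0 ρ t₀ K₀) t₂ ≤ A * M ^ A
  /-- `|φ₀| ≤ 3 π / 4` -/
  angle_bound : ∀ t ∈ I, |phi0 ρ t₀ K₀ t| ≤ 3 * Real.pi / 4
  /-- `|f₀| ≲ r ^ (1 + α)` on an interval where `ρ ∼ r` -/
  f0_bound : ∀ J ⊆ I, J.OrdConnected →
    ∀ r > 0, (∀ t ∈ J, r / 2 ≤ ρ t ∧ ρ t ≤ 2 * r) →
      ∀ t ∈ J, |f0 ρ K₀ t| ≤ A * r ^ (1 + α)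
  /-- `|Δf₀ / Δρ| ≲ r ^ α + ξ` on an interval where `ρ ∼ r` -/
  slope_bound : ∀ J ⊆ I, J.OrdConnected →
    ∀ r > 0, (∀ t ∈ J, r / 2 ≤ ρ t ∧ ρ t ≤ 2 * r) →
      ∀ t₁ ∈ J, ∀ t₂ ∈ J, ρ t₁ ≠ ρ t₂ →
        |slope0 ρ K₀ t₁ t₂| ≤ A * (r ^ α + xi α ρ t₀ K₀ t₁ t₂)
  /-- comparison of two values of `Δf₀ / Δρ` on an interval where `ρ ∼ r` -/
  slope_compare : ∀ J ⊆ I, J.OrdConnected →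
    ∀ r > 0, (∀ t ∈ J, r / 2 ≤ ρ t ∧ ρ t ≤ 2 * r) →
      ∀ t₁ ∈ J, ∀ t₂ ∈ J, ∀ t₃ ∈ J, ∀ t₄ ∈ J, ρ t₁ ≠ ρ t₂ → ρ t₃ ≠ ρ t₄ →
        |slope0 ρ K₀ t₁ t₂ - slope0 ρ K₀ t₃ t₄| ≤
          A * (Metric.diam {t₁, t₂, t₃, t₄} ^ α
            + xi α ρ t₀ K₀ t₁ t₂ + xi α ρ t₀ K₀ t₃ t₄)
  /-- comparison of `Δf₀ / Δρ + 2 f₀ cot_{K₀} ρ` on two intervals, where `ρ ∼ r` and `ρ ∼ r'` -/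
  slope_compare_two_scales : ∀ J ⊆ I, J.OrdConnected → ∀ J' ⊆ I, J'.OrdConnected →
    ∀ r > 0, (∀ t ∈ J, r / 2 ≤ ρ t ∧ ρ t ≤ 2 * r) →
    ∀ r' > 0, (∀ t ∈ J', r' / 2 ≤ ρ t ∧ ρ t ≤ 2 * r') →
      ∀ t₁ ∈ J, ∀ t₂ ∈ J, ∀ t₃ ∈ J', ∀ t₄ ∈ J', ρ t₁ ≠ ρ t₂ → ρ t₃ ≠ ρ t₄ →
        |slope0 ρ K₀ t₁ t₂ + 2 * f0 ρ K₀ t₁ * cotK K₀ (ρ t₁)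
            - slope0 ρ K₀ t₃ t₄ - 2 * f0 ρ K₀ t₃ * cotK K₀ (ρ t₃)| ≤
          A * (Metric.diam {t₁, t₂, t₃, t₄} ^ α
            + xi α ρ t₀ K₀ t₁ t₂ + xi α ρ t₀ K₀ t₃ t₄)

/-- The radial derivative `∂_r f` at `z = r e ^ (i θ)`. -/
def radialDeriv (f : ℂ → ℝ) (z : ℂ) : ℝ :=
  deriv (fun s : ℝ => f ((s : ℂ) * Complex.exp ((z.arg : ℂ) * Complex.I))) ‖z‖

/-- `f ^ 2 + 2 f cot_{K₀} r + ∂_r f`. For a function that vanishes near the origin, this is `0`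
there, the origin included. -/
def riccatiDefect (K₀ : ℝ) (f : ℂ → ℝ) (z : ℂ) : ℝ :=
  f z ^ 2 + 2 * f z * cotK K₀ ‖z‖ + radialDeriv f z

end RadialExt

end

open RadialExt

/-!
The problem is linear in disguise. If `p : ℂ → ℝ` is `α`-Hölder continuous and vanishes near the
origin, and `f (r e ^ (i θ)) = ∫_0^r p (s e ^ (i θ)) ds` is its primitive along rays, then
`∂_r f = p`, and `f / r`, the mean of `p` along the ray, is again `α`-Hölder. Since
`r cot_K r` is bounded and Lipschitz on `(0, 1]`, the whole expression `f ^ 2 + 2 f cot_K r + ∂_r f`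
is `α`-Hölder (`riccatiDefect_holder`). So it suffices to find a Hölder function `p`, with norm
bounded in terms of `A`, whose integral along the ray from `0` to each point of the curve is the
value of `f₀` there. By McShane's extension it suffices to define `p` on the rays that meet the
curve (`IsRayFamily.exists_extension`); the angle between two points is at most `3 π / 2`, which
makes the distance between two rays comparable to the angle.

By convexity, `ρ'` is strictly increasing, so `ρ` decreases up to `t₀` and increases after it, and
its infimum `m` is positive (`exists_pos_le_of_convexity`). The two halves are mirror images of each
other, and each half is treated on its own. The finitely detected estimates are used in a form,
`CurveData`, that no longer mentions the base curvature.

On the half where `ρ` increases, `p` is the sum of a function of the radius and a part that depends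
on the angle.

* As long as `ρ' ≤ 1 / 2`, the angle moves at speed comparable to `1 / ρ`, and the bound
  `|f₀| ≲ ρ ^ (1 + α)` and the bound for divided differences suffice to put all of `f₀` into the
  angular part: for a point of the curve with value `g`, take `g` times a bump function of integral
  one in the dyadic annulus inside the point (`kernel`).
* Where `ρ' > 1 / 2`, the curve may be almost radial, so that a function of the angle cannot vary
  fast along it. There the divided differences `Δf₀ / Δρ` are, up to the error `ξ`, the values of
  one Hölder function of the radius. It is obtained from McShane's construction in a form that
  respects the error intervals (`exists_between_of_compatible`, `CurveData.exists_slope_function`).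
  Its primitive may drift away from `f₀`. The drift is removed at a sequence of nodes; consecutive
  nodes have a distance comparable to `τ = ρ (ρ φ') ^ α`, the scale below which divided differences
  carry no information (`exists_nodes`, `exists_correction`). What remains of
  `f₀` has size `O (ρ ^ α τ)` and modulus of continuity `O (τ |s - t| ^ α)`, which is exactly what
  is needed of a function of the angle (`CurveData.exists_radial_part`,
  `CurveData.angular_part`).

The two halves are glued by cutoff functions of the angle (`CurveData.exists_rayFamily_of_min`).
The radial part is zero on a half unless `ρ'` exceeds `1 / 2` there; by then the curve has turned
by an angle bounded below, which leaves room for the cutoff.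
-/

namespace RadialExt

/-! ### Powers with exponent in `(0, 1]` -/

theorem rpow_add_le_add_rpow {α x y : ℝ} (hα : 0 < α) (hα1 : α ≤ 1) (hx : 0 ≤ x) (hy : 0 ≤ y) :
    (x + y) ^ α ≤ x ^ α + y ^ α := by
  have h := NNReal.rpow_add_le_add_rpow ⟨x, hx⟩ ⟨y, hy⟩ hα.le hα1
  exact_mod_cast h

theorem const_mul_rpow_le {α c x : ℝ} (hα1 : α ≤ 1) (hc : 1 ≤ c) (hx : 0 ≤ x) :
    (c * x) ^ α ≤ c * x ^ α := by
  rw [Real.mul_rpow (by linarith) hx]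
  have : c ^ α ≤ c ^ (1 : ℝ) := Real.rpow_le_rpow_of_exponent_le hc hα1
  rw [Real.rpow_one] at this
  exact mul_le_mul_of_nonneg_right this (Real.rpow_nonneg hx _)

/-- Interpolation between the exponents `α` and `1`. -/
theorem mul_rpow_le_mul_rpow {α x y : ℝ} (hα1 : α ≤ 1) (hx : 0 ≤ x) (hxy : x ≤ y) :
    x * y ^ α ≤ y * x ^ α := by
  rcases hx.eq_or_lt with rfl | hx0
  · have : 0 ≤ y * (0 : ℝ) ^ α := mul_nonneg hxy (Real.rpow_nonneg le_rfl _)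
    simpa using this
  have hy : 0 < y := hx0.trans_le hxy
  have h1 : (x / y) ^ (1 : ℝ) ≤ (x / y) ^ α :=
    Real.rpow_le_rpow_of_exponent_ge (by positivity) ((div_le_one hy).2 hxy) hα1
  rw [Real.rpow_one, Real.div_rpow hx hy.le, div_le_div_iff₀ hy (Real.rpow_pos_of_pos hy _)] at h1
  linarith

theorem self_le_rpow {α x : ℝ} (hα1 : α ≤ 1) (hx : 0 ≤ x) (hx1 : x ≤ 1) : x ≤ x ^ α := by
  have := mul_rpow_le_mul_rpow hα1 hx hx1
  simpa using this

theorem abs_rpow_le_add {α : ℝ} (hα : 0 < α) (hα1 : α ≤ 1) (z z' : ℝ) :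
    |z| ^ α ≤ |z'| ^ α + |z - z'| ^ α := by
  refine le_trans (Real.rpow_le_rpow (abs_nonneg _) ?_ hα.le)
    (rpow_add_le_add_rpow hα hα1 (abs_nonneg z') (abs_nonneg (z - z')))
  have := abs_add_le z' (z - z')
  simpa using this

/-! ### An extension lemma of McShane type -/

/-- A family of values `y i`, each prescribed up to the tolerance `e i + d i x` at every point `x`,
can be matched by one function, as soon as the prescriptions are pairwise compatible. The function
inherits the modulus of continuity of the tolerances. -/
theorem exists_between_of_compatible {ι X : Type*} [Nonempty ι] (y e : ι → ℝ) (d : ι → X → ℝ)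
    (h : ∀ i j x, y i - e i - d i x ≤ y j + e j + d j x) (D : X → X → ℝ)
    (hd : ∀ i x x', d i x ≤ d i x' + D x x') :
    ∃ v : X → ℝ, (∀ x x', v x' ≤ v x + D x x') ∧ ∀ i x, |v x - y i| ≤ e i + d i x := by
  have hb : ∀ x, BddAbove (range fun i => y i - e i - d i x) := fun x => by
    obtain ⟨j⟩ := ‹Nonempty ι›
    exact ⟨y j + e j + d j x, by rintro _ ⟨i, rfl⟩; exact h i j x⟩
  refine ⟨fun x => ⨆ i, (y i - e i - d i x), fun x x' => ?_, fun i x => ?_⟩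
  · refine ciSup_le fun i => ?_
    have h1 := le_ciSup (hb x) i
    have h2 := hd i x x'
    beta_reduce at h1
    linarith
  · have h1 := le_ciSup (hb x) i
    have h2 : (⨆ i, (y i - e i - d i x)) ≤ y i + e i + d i x := ciSup_le fun j => h j i x
    beta_reduce at h1
    rw [abs_le]
    constructor <;> linarith

/-! ### Hölder functions with prescribed means on consecutive intervals -/

/-- The parabola that vanishes at `a` and `b` and has mean `c` on `[a, b]`. -/
noncomputable def parabola (a b c s : ℝ) : ℝ := 6 * c * ((s - a) * (b - s)) / (b - a) ^ 2

theorem parabola_left (a b c : ℝ) : parabola a b c a = 0 := by simp [parabola]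

theorem parabola_right (a b c : ℝ) : parabola a b c b = 0 := by simp [parabola]

theorem abs_parabola_le {a b c s : ℝ} (hab : a < b) (hs : s ∈ Icc a b) :
    |parabola a b c s| ≤ 2 * |c| := by
  have h0 : 0 < (b - a) ^ 2 := by have := sub_pos.2 hab; positivity
  unfold parabola
  rw [abs_div, abs_of_pos h0, div_le_iff₀ h0, abs_mul, abs_mul,
    abs_of_nonneg (mul_nonneg (sub_nonneg.2 hs.1) (sub_nonneg.2 hs.2)),
    abs_of_pos (by norm_num : (0 : ℝ) < 6)]
  have : (s - a) * (b - s) ≤ (b - a) ^ 2 / 4 := by nlinarith [sq_nonneg (s - a - (b - s))]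
  nlinarith [abs_nonneg c, mul_le_mul_of_nonneg_left this (abs_nonneg c)]

theorem abs_parabola_sub_le {α a b c K s s' : ℝ} (hα1 : α ≤ 1) (hab : a < b)
    (hc : |c| ≤ K * (b - a) ^ α) (hs : s ∈ Icc a b) (hs' : s' ∈ Icc a b) :
    |parabola a b c s - parabola a b c s'| ≤ 6 * K * |s - s'| ^ α := by
  have h0 : 0 < b - a := sub_pos.2 hab
  have e : parabola a b c s - parabola a b c s' =
      6 * c * ((s - s') * (a + b - s - s')) / (b - a) ^ 2 := by
    unfold parabola; rw [← sub_div]; ring_nf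
  have hpow : 0 < (b - a) ^ α := Real.rpow_pos_of_pos h0 _
  have hK : 0 ≤ K := by
    by_contra hK
    have := mul_neg_of_neg_of_pos (not_le.1 hK) hpow
    linarith [abs_nonneg c]
  have h1 : |a + b - s - s'| ≤ b - a := by
    rw [abs_le]; constructor <;> linarith [hs.1, hs.2, hs'.1, hs'.2]
  have h2 : |s - s'| ≤ b - a := by
    rw [abs_le]; constructor <;> linarith [hs.1, hs.2, hs'.1, hs'.2]
  have h3 := mul_rpow_le_mul_rpow hα1 (abs_nonneg (s - s')) h2
  rw [e, abs_div, abs_of_pos (by positivity : 0 < (b - a) ^ 2), div_le_iff₀ (by positivity),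
    abs_mul, abs_mul, abs_mul, abs_of_pos (by norm_num : (0 : ℝ) < 6)]
  calc 6 * |c| * (|s - s'| * |a + b - s - s'|)
      ≤ 6 * (K * (b - a) ^ α) * (|s - s'| * (b - a)) := by gcongr
    _ = 6 * K * (b - a) * (|s - s'| * (b - a) ^ α) := by ring
    _ ≤ 6 * K * (b - a) * ((b - a) * |s - s'| ^ α) := by gcongr
    _ = _ := by ring

theorem integral_parabola {a b : ℝ} (c : ℝ) (hab : a < b) :
    ∫ s in a..b, parabola a b c s = c * (b - a) := by
  have h0 : b - a ≠ 0 := (sub_pos.2 hab).ne'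
  have key : ∀ s ∈ uIcc a b, HasDerivAt
      (fun s => 6 * c / (b - a) ^ 2 * (-(s ^ 3) / 3 + (a + b) * s ^ 2 / 2 - a * b * s))
      (parabola a b c s) s := fun s _ => by
    have h1 := (((hasDerivAt_pow 3 s).neg.div_const 3).add
      (((hasDerivAt_pow 2 s).const_mul (a + b)).div_const 2)).sub
      ((hasDerivAt_id s).const_mul (a * b))
    refine ((h1.const_mul (6 * c / (b - a) ^ 2)).congr_deriv ?_)
    unfold parabola
    norm_num
    ring
  rw [intervalIntegral.integral_eq_sub_of_hasDerivAt key]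
  · field_simp
    ring
  · refine Continuous.intervalIntegrable ?_ _ _
    unfold parabola
    fun_prop

/-- A Hölder continuous function with prescribed means `c k` on the consecutive intervals
`[x k, x (k + 1)]`. It vanishes at every node, so that Hölder estimates on the single
intervals suffice. -/
theorem exists_holder_of_means {α K : ℝ} (hα : 0 < α) (hα1 : α ≤ 1) {x c : ℕ → ℝ}
    (hx : StrictMono x) (hc : ∀ k, |c k| ≤ K * (x (k + 1) - x k) ^ α) :
    ∃ u : ℝ → ℝ, (∀ s s', |u s - u s'| ≤ 12 * K * |s - s'| ^ α) ∧
      (∀ s, u s ≠ 0 → ∃ k, s ∈ Ioo (x k) (x (k + 1)) ∧ c k ≠ 0 ∧ |u s| ≤ 2 * |c k|) ∧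
      ∀ k, ∫ s in x k..x (k + 1), u s = c k * (x (k + 1) - x k) := by
  classical
  have hlt : ∀ k, x k < x (k + 1) := fun k => hx k.lt_succ_self
  have hK : 0 ≤ K := by
    by_contra hK
    have := mul_neg_of_neg_of_pos (not_le.1 hK)
      (Real.rpow_pos_of_pos (sub_pos.2 (hlt 0)) α)
    linarith [abs_nonneg (c 0), hc 0]
  let u : ℝ → ℝ := fun s => if h : ∃ k, s ∈ Ioo (x k) (x (k + 1)) then
    parabola (x h.choose) (x (h.choose + 1)) (c h.choose) s else 0
  have huniq : ∀ {s k l}, s ∈ Ioo (x k) (x (k + 1)) → s ∈ Icc (x l) (x (l + 1)) → k = l := by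
    intro s k l h1 h2
    have a1 : k < l + 1 := hx.lt_iff_lt.1 (h1.1.trans_le h2.2)
    have a2 : l < k + 1 := hx.lt_iff_lt.1 (h2.1.trans_lt h1.2)
    omega
  have hu : ∀ k, ∀ s ∈ Icc (x k) (x (k + 1)), u s = parabola (x k) (x (k + 1)) (c k) s := by
    intro k s hs
    by_cases h : ∃ k, s ∈ Ioo (x k) (x (k + 1))
    · have : h.choose = k := huniq h.choose_spec hs
      simp only [u, dif_pos h, this]
    · simp only [u, dif_neg h]
      push Not at h
      rcases hs.1.eq_or_lt with h1 | h1
      · rw [← h1, parabola_left]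
      · rcases hs.2.eq_or_lt with h2 | h2
        · rw [h2, parabola_right]
        · exact absurd ⟨h1, h2⟩ (h k)
  have hsupp : ∀ s, u s ≠ 0 → ∃ k, s ∈ Ioo (x k) (x (k + 1)) := by
    intro s hs
    by_contra h
    exact hs (by simp only [u, dif_neg h])
  have hloc : ∀ k, ∀ s ∈ Icc (x k) (x (k + 1)), ∀ s' ∈ Icc (x k) (x (k + 1)),
      |u s - u s'| ≤ 6 * K * |s - s'| ^ α := fun k s hs s' hs' => by
    rw [hu k s hs, hu k s' hs']
    exact abs_parabola_sub_le hα1 (hlt k) (hc k) hs hs'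
  have hL : ∀ k, u (x k) = 0 := fun k => by
    rw [hu k _ (left_mem_Icc.2 (hlt k).le), parabola_left]
  have hmain : ∀ s s', s < s' → |u s - u s'| ≤ 12 * K * |s - s'| ^ α := by
    intro s s' hss
    by_cases hsame : ∃ k, s ∈ Icc (x k) (x (k + 1)) ∧ s' ∈ Icc (x k) (x (k + 1))
    · obtain ⟨k, h1, h2⟩ := hsame
      have h3 : 0 ≤ |s - s'| ^ α := Real.rpow_nonneg (abs_nonneg _) _
      nlinarith [hloc k s h1 s' h2, mul_nonneg hK h3]
    have h1 : |u s| ≤ 6 * K * |s - s'| ^ α := by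
      by_cases h0 : u s = 0
      · rw [h0, abs_zero]; positivity
      obtain ⟨k, hk⟩ := hsupp s h0
      have hs' : x (k + 1) < s' := by
        by_contra hcon
        exact hsame ⟨k, ⟨hk.1.le, hk.2.le⟩, ⟨(hk.1.trans hss).le, not_lt.1 hcon⟩⟩
      have h2 := hloc k s ⟨hk.1.le, hk.2.le⟩ (x (k + 1)) (right_mem_Icc.2 (hlt k).le)
      rw [hL, sub_zero] at h2
      refine h2.trans (mul_le_mul_of_nonneg_left (Real.rpow_le_rpow (abs_nonneg _) ?_ hα.le)
        (by positivity))
      rw [abs_of_neg (by linarith [hk.2]), abs_of_neg (by linarith)]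
      linarith
    have h2 : |u s'| ≤ 6 * K * |s - s'| ^ α := by
      by_cases h0 : u s' = 0
      · rw [h0, abs_zero]; positivity
      obtain ⟨k, hk⟩ := hsupp s' h0
      have hs' : s < x k := by
        by_contra hcon
        exact hsame ⟨k, ⟨not_lt.1 hcon, (hss.trans hk.2).le⟩, ⟨hk.1.le, hk.2.le⟩⟩
      have h2 := hloc k s' ⟨hk.1.le, hk.2.le⟩ (x k) (left_mem_Icc.2 (hlt k).le)
      rw [hL, sub_zero] at h2
      refine h2.trans (mul_le_mul_of_nonneg_left (Real.rpow_le_rpow (abs_nonneg _) ?_ hα.le)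
        (by positivity))
      rw [abs_of_pos (by linarith [hk.1]), abs_of_neg (by linarith)]
      linarith
    have := abs_sub (u s) (u s')
    linarith
  refine ⟨u, fun s s' => ?_, fun s hs => ?_, fun k => ?_⟩
  · rcases lt_trichotomy s s' with h | h | h
    · exact hmain s s' h
    · subst h; simp only [sub_self, abs_zero]; positivity
    · rw [abs_sub_comm, abs_sub_comm s]; exact hmain s' s h
  · obtain ⟨k, hk⟩ := hsupp s hs
    have h1 := abs_parabola_le (c := c k) (hlt k) ⟨hk.1.le, hk.2.le⟩
    rw [← hu k s ⟨hk.1.le, hk.2.le⟩] at h1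
    refine ⟨k, hk, ?_, h1⟩
    rintro h0
    rw [h0, abs_zero, mul_zero] at h1
    exact hs (abs_nonpos_iff.1 h1)
  · rw [← integral_parabola (c k) (hlt k)]
    refine intervalIntegral.integral_congr fun s hs => ?_
    rw [uIcc_of_le (hlt k).le] at hs
    exact hu k s hs

theorem continuous_of_holder {α C : ℝ} (hα : 0 < α) {f : ℝ → ℝ}
    (hf : ∀ s s', |f s - f s'| ≤ C * |s - s'| ^ α) : Continuous f := by
  rw [continuous_iff_continuousAt]
  intro x
  rw [ContinuousAt, tendsto_iff_dist_tendsto_zero]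
  have h : Tendsto (fun s : ℝ => C * |s - x| ^ α) (𝓝 x) (𝓝 0) := by
    have : ContinuousAt (fun s : ℝ => C * |s - x| ^ α) x :=
      continuousAt_const.mul (ContinuousAt.rpow_const (by fun_prop) (Or.inr hα.le))
    have h2 := this.tendsto
    simpa [Real.zero_rpow hα.ne'] using h2
  exact squeeze_zero (fun _ => dist_nonneg) (fun s => by rw [Real.dist_eq]; exact hf s x) h

/-! ### Correcting a Hölder derivative so that its primitive follows given values -/

theorem abs_integral_sub_const_mul_le {α B : ℝ} (hα : 0 < α) {w : ℝ → ℝ}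
    (hw : ∀ x y, |w x - w y| ≤ B * |x - y| ^ α) (hB : 0 ≤ B) (x y : ℝ) :
    |(∫ s in y..x, w s) - w x * (x - y)| ≤ B * (|x - y| * |x - y| ^ α) := by
  have hc := continuous_of_holder hα hw
  have e : (∫ s in y..x, w s) - w x * (x - y) = ∫ s in y..x, (w s - w x) := by
    rw [intervalIntegral.integral_sub (hc.intervalIntegrable _ _) (by simp)]
    simp [mul_comm]
  rw [e]
  have := intervalIntegral.norm_integral_le_of_norm_le_const (a := y) (b := x)
    (f := fun s => w s - w x) (C := B * |x - y| ^ α) (fun s hs => by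
      rw [Real.norm_eq_abs]
      refine (hw s x).trans (mul_le_mul_of_nonneg_left
        (Real.rpow_le_rpow (abs_nonneg _) ?_ hα.le) hB)
      rw [abs_sub_comm s x]
      exact abs_sub_right_of_mem_uIcc (uIoc_subset_uIcc hs))
  rw [Real.norm_eq_abs] at this
  linarith

/-- A sequence of nodes advancing by a step comparable to `τ` exhausts `X` above `x₀`. -/
theorem exists_nodes {B : ℝ} (hB : 1 ≤ B) {X : Set ℝ} (hX : X.OrdConnected)
    (hpos : ∀ x ∈ X, 0 < x) {τ : ℝ → ℝ} {x₀ : ℝ} (hx₀ : x₀ ∈ X) (hτ0 : ∀ x ∈ X, 0 < τ x)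
    (hττ : ∀ x ∈ X, ∀ y ∈ X, x ≤ 2 * y → y ≤ 2 * x → τ x ≤ B * τ y) :
    ∃ x : ℕ → ℝ, x 0 = x₀ ∧ StrictMono x ∧ (∀ k, x k ∈ X → x (k + 1) - x k = τ (x k) / B) ∧
      ∀ y ∈ X, x₀ ≤ y → ∃ k, x k ≤ y ∧ y < x (k + 1) := by
  classical
  have hB0 : 0 < B := by linarith
  let δ : ℝ → ℝ := fun x => if x ∈ X then τ x / B else 1
  have hδ : ∀ x, 0 < δ x := fun x => by
    by_cases h : x ∈ X
    · simp only [δ, if_pos h]; exact div_pos (hτ0 x h) hB0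
    · simp only [δ, if_neg h]; exact one_pos
  let x : ℕ → ℝ := fun k => (fun y => y + δ y)^[k] x₀
  have hstep : ∀ k, x (k + 1) = x k + δ (x k) := fun k => by
    simp only [x, Function.iterate_succ_apply']
  have hmono : StrictMono x := strictMono_nat_of_lt_succ fun k => by
    rw [hstep]; linarith [hδ (x k)]
  have hx0 : x 0 = x₀ := rfl
  refine ⟨x, hx0, hmono, fun k hk => ?_, fun y hy hxy => ?_⟩
  · rw [hstep]; simp only [δ, if_pos hk]; ring
  · by_contra hcon
    push Not at hcon
    have hle : ∀ k, x k ≤ y := fun k => by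
      induction k with
      | zero => exact hxy
      | succ k ih => exact hcon k ih
    have hmem : ∀ k, x k ∈ X := fun k =>
      hX.out hx₀ hy ⟨hx0 ▸ hmono.monotone (Nat.zero_le k), hle k⟩
    have hbdd : BddAbove (range x) := ⟨y, by rintro _ ⟨k, rfl⟩; exact hle k⟩
    have hlim := tendsto_atTop_ciSup hmono.monotone hbdd
    set l := ⨆ k, x k
    have hxl : ∀ k, x k ≤ l := fun k => le_ciSup hbdd k
    have hly : l ≤ y := ciSup_le hle
    have hl : l ∈ X := hX.out hx₀ hy ⟨hx0 ▸ hxl 0, hly⟩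
    have h1 : ∀ᶠ k in atTop, l / 2 < x k :=
      hlim.eventually (lt_mem_nhds (by linarith [hpos l hl]))
    have h2 : Tendsto (fun k => x (k + 1) - x k) atTop (𝓝 0) := by
      have := (hlim.comp (tendsto_add_atTop_nat 1)).sub hlim
      simpa using this
    have h3 : ∀ᶠ k in atTop, x (k + 1) - x k < τ l / B ^ 2 :=
      h2.eventually (gt_mem_nhds (div_pos (hτ0 l hl) (by positivity)))
    obtain ⟨k, hk1, hk2⟩ := (h1.and h3).exists
    rw [hstep] at hk2
    simp only [δ, if_pos (hmem k)] at hk2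
    have h4 := hττ l hl (x k) (hmem k) (by linarith) (by linarith [hxl k, hpos _ (hmem k)])
    have h5 : τ l / B ^ 2 ≤ τ (x k) / B := by
      rw [div_le_div_iff₀ (by positivity) hB0]
      nlinarith
    linarith

/-- Suppose that `w` is Hölder continuous and describes the increments of `h` up to an error
`τ |x - y| ^ α` on small scales. Correcting `w` at the scale `τ`, the only scale at which the two
error terms balance, produces a primitive that follows `h` with an error that is itself of Hölder
size `τ |x - y| ^ α`. -/
theorem exists_correction {α B : ℝ} (hα : 0 < α) (hα1 : α ≤ 1) (hB : 1 ≤ B) {X : Set ℝ}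
    (hX : X.OrdConnected) (hpos : ∀ x ∈ X, 0 < x) {h τ w : ℝ → ℝ} {x₀ : ℝ} (hx₀ : x₀ ∈ X)
    (hτ0 : ∀ x ∈ X, 0 < τ x) (hτ : ∀ x ∈ X, τ x ≤ B * x)
    (hττ : ∀ x ∈ X, ∀ y ∈ X, x ≤ 2 * y → y ≤ 2 * x → τ x ≤ B * τ y)
    (hw : ∀ x y, |w x - w y| ≤ B * |x - y| ^ α)
    (hh : ∀ x ∈ X, ∀ y ∈ X,
      |h x - h y - w x * (x - y)| ≤ B * (τ x * |x - y| ^ α + |x - y| * |x - y| ^ α))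
    (hlow : ∀ x ∈ X, x < x₀ → x₀ - x ≤ τ x₀ ∧ x₀ ≤ 2 * x) :
    ∃ u : ℝ → ℝ, (∀ s s', |u s - u s'| ≤ 36 * B ^ 7 * |s - s'| ^ α) ∧ (∀ s ≤ x₀, u s = 0) ∧
      ∀ g : ℝ → ℝ, (∀ x, g x = h x - h x₀ - ∫ s in x₀..x, (w s + u s)) →
        (∀ x ∈ X, |g x| ≤ 36 * B ^ 7 * (τ x * τ x ^ α)) ∧
        ∀ x ∈ X, ∀ y ∈ X, x ≤ 2 * y → y ≤ 2 * x →
          |g x - g y| ≤ 36 * B ^ 7 * (τ x * |x - y| ^ α) := by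
  classical
  have hB0 : 0 < B := by linarith
  obtain ⟨x, hx0, hmono, hstep, hcover⟩ := exists_nodes hB hX hpos hx₀ hτ0 hττ
  have hlt : ∀ k, x k < x (k + 1) := fun k => hmono k.lt_succ_self
  have hwc := continuous_of_holder hα hw
  have hmem : ∀ k, x (k + 1) ∈ X → x k ∈ X := fun k hk =>
    hX.out hx₀ hk ⟨hx0 ▸ hmono.monotone (Nat.zero_le k), (hlt k).le⟩
  let c : ℕ → ℝ := fun k => if x (k + 1) ∈ X then
    (h (x (k + 1)) - h (x k) - ∫ s in x k..x (k + 1), w s) / (x (k + 1) - x k) else 0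
  have hc : ∀ k, |c k| ≤ 3 * B ^ 2 * (x (k + 1) - x k) ^ α := fun k => by
    have hd : 0 < x (k + 1) - x k := sub_pos.2 (hlt k)
    have hdα := Real.rpow_pos_of_pos hd α
    by_cases hk : x (k + 1) ∈ X
    · simp only [c, if_pos hk]
      rw [abs_div, abs_of_pos hd, div_le_iff₀ hd]
      have h1 := hh _ (hmem k hk) _ hk
      have h2 := abs_integral_sub_const_mul_le hα hw hB0.le (x k) (x (k + 1))
      have h3 : τ (x k) = B * (x (k + 1) - x k) := by
        rw [hstep k (hmem k hk)]; field_simp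
      rw [intervalIntegral.integral_symm] at h2
      rw [abs_sub_comm (x k), abs_of_pos hd] at h1 h2
      rw [h3] at h1
      have h4 := abs_add_le (h (x k) - h (x (k + 1)) - w (x k) * (x k - x (k + 1)))
        (w (x k) * (x k - x (k + 1)) + ∫ s in x k..x (k + 1), w s)
      have h5 : |w (x k) * (x k - x (k + 1)) + ∫ s in x k..x (k + 1), w s| =
          |(-∫ s in x k..x (k + 1), w s) - w (x k) * (x k - x (k + 1))| := by
        rw [← abs_neg]; ring_nf
      have h6 : |h (x (k + 1)) - h (x k) - ∫ s in x k..x (k + 1), w s| =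
          |h (x k) - h (x (k + 1)) - w (x k) * (x k - x (k + 1)) +
            (w (x k) * (x k - x (k + 1)) + ∫ s in x k..x (k + 1), w s)| := by
        rw [← abs_neg]; ring_nf
      rw [h6]
      have hP : 0 < (x (k + 1) - x k) * (x (k + 1) - x k) ^ α := mul_pos hd hdα
      have hBB : B * ((x (k + 1) - x k) * (x (k + 1) - x k) ^ α) ≤
          B ^ 2 * ((x (k + 1) - x k) * (x (k + 1) - x k) ^ α) :=
        mul_le_mul_of_nonneg_right (le_self_pow₀ hB two_ne_zero) hP.le
      rw [h5] at h4
      linarith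
    · simp only [c, if_neg hk, abs_zero]
      positivity
  obtain ⟨u, hu1, hu2, hu3⟩ := exists_holder_of_means hα hα1 hmono hc
  have huc := continuous_of_holder hα hu1
  have hBn : ∀ n, 1 ≤ B ^ n := fun n => one_le_pow₀ hB
  have hB27 : B ^ 2 ≤ B ^ 7 := pow_le_pow_right₀ hB (by norm_num)
  refine ⟨u, fun s s' => (hu1 s s').trans ?_, fun s hs => ?_, fun g hg => ?_⟩
  · have := Real.rpow_nonneg (abs_nonneg (s - s')) α
    have : (12 * (3 * B ^ 2)) ≤ 36 * B ^ 7 := by linarith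
    gcongr
  · by_contra h0
    obtain ⟨k, hk, -⟩ := hu2 s h0
    have : x₀ ≤ x k := hx0 ▸ hmono.monotone (Nat.zero_le k)
    linarith [hk.1]
  have hi : ∀ a b, IntervalIntegrable (fun s => w s + u s) MeasureTheory.volume a b :=
    fun a b => (hwc.add huc).intervalIntegrable a b
  have hsplit : ∀ y z, (∫ s in x₀..y, (w s + u s)) - ∫ s in x₀..z, (w s + u s) =
      (∫ s in z..y, w s) + ∫ s in z..y, u s := fun y z => by
    rw [intervalIntegral.integral_interval_sub_left (hi _ _) (hi _ _),
      intervalIntegral.integral_add (hwc.intervalIntegrable _ _) (huc.intervalIntegrable _ _)]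
  -- Near `x`, the correction has at most the size `τ x ^ α`.
  have husize : ∀ y ∈ X, ∀ z ∈ X, y ≤ 2 * z → z ≤ 2 * y → |u z| ≤ 6 * B ^ 3 * τ y ^ α := by
    intro y hy z hz hyz hzy
    have hτy := hτ0 y hy
    by_cases h0 : u z = 0
    · rw [h0, abs_zero]; positivity
    obtain ⟨k, hk, hck, huk⟩ := hu2 z h0
    have hk1 : x (k + 1) ∈ X := by
      by_contra hcon
      exact hck (by simp only [c, if_neg hcon])
    have hk0 := hmem k hk1
    have h1 : x (k + 1) - x k ≤ x k := by
      rw [hstep k hk0, div_le_iff₀ hB0]; linarith [hτ _ hk0]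
    have h2 := hττ _ hk0 z hz (by linarith [hk.1, hpos z hz]) (by linarith [hk.2])
    have h3 := hττ z hz y hy (by linarith) (by linarith)
    have h4 : x (k + 1) - x k ≤ B * τ y := by
      rw [hstep k hk0, div_le_iff₀ hB0]; nlinarith
    have h5 : (x (k + 1) - x k) ^ α ≤ B * τ y ^ α :=
      (Real.rpow_le_rpow (sub_pos.2 (hlt k)).le h4 hα.le).trans
        (const_mul_rpow_le hα1 hB hτy.le)
    calc |u z| ≤ 2 * (3 * B ^ 2 * (B * τ y ^ α)) := by
          refine huk.trans (mul_le_mul_of_nonneg_left ((hc k).trans ?_) (by norm_num))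
          gcongr
      _ = _ := by ring
  have hlocal : ∀ y ∈ X, ∀ z ∈ X, y ≤ 2 * z → z ≤ 2 * y → |y - z| ≤ τ y →
      |g y - g z| ≤ 9 * B ^ 3 * (τ y * |y - z| ^ α) := by
    intro y hy z hz hyz hzy hd
    have hτy := hτ0 y hy
    have e : g y - g z = (h y - h z - w y * (y - z)) - ((∫ s in z..y, w s) - w y * (y - z))
        - ∫ s in z..y, u s := by
      rw [hg, hg]
      have h1 : (∫ s in x₀..y, (w s + u s)) - ∫ s in x₀..z, (w s + u s) =
          (∫ s in z..y, w s) + ∫ s in z..y, u s := hsplit _ _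
      linarith
    have h1 := hh y hy z hz
    have h2 := abs_integral_sub_const_mul_le hα hw hB0.le y z
    have h3 : |∫ s in z..y, u s| ≤ 6 * B ^ 3 * τ y ^ α * |y - z| := by
      have := intervalIntegral.norm_integral_le_of_norm_le_const (a := z) (b := y)
        (f := u) (C := 6 * B ^ 3 * τ y ^ α) (fun s hs => by
          rw [Real.norm_eq_abs]
          have hs' := uIoc_subset_uIcc hs
          have hsX : s ∈ X := hX.uIcc_subset hz hy hs'
          rw [mem_uIcc] at hs'
          refine husize y hy s hsX ?_ ?_ <;>
          rcases hs' with hs' | hs' <;> linarith [hs'.1, hs'.2, hpos y hy, hpos s hsX])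
      simpa using this
    have hα0 := Real.rpow_nonneg (abs_nonneg (y - z)) α
    have h4 : |y - z| * |y - z| ^ α ≤ τ y * |y - z| ^ α := mul_le_mul_of_nonneg_right hd hα0
    have h5 := mul_rpow_le_mul_rpow hα1 (abs_nonneg (y - z)) hd
    rw [e]
    have h6 := abs_sub ((h y - h z - w y * (y - z)) - ((∫ s in z..y, w s) - w y * (y - z)))
      (∫ s in z..y, u s)
    have h7 := abs_sub (h y - h z - w y * (y - z)) ((∫ s in z..y, w s) - w y * (y - z))
    have hP : 0 ≤ τ y * |y - z| ^ α := by positivity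
    have hB3 : B ≤ B ^ 3 := le_self_pow₀ hB (by norm_num)
    have h8 : 6 * B ^ 3 * τ y ^ α * |y - z| ≤ 6 * B ^ 3 * (τ y * |y - z| ^ α) := by
      rw [mul_assoc]
      exact mul_le_mul_of_nonneg_left (by linarith) (by positivity)
    have h9 : B * (τ y * |y - z| ^ α) ≤ B ^ 3 * (τ y * |y - z| ^ α) :=
      mul_le_mul_of_nonneg_right hB3 hP
    have h10 := mul_le_mul_of_nonneg_left h4 hB0.le
    linarith
  have hnode : ∀ k, x k ∈ X → g (x k) = 0 := by
    intro k
    induction k with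
    | zero => intro _; rw [hg, hx0]; simp
    | succ k ih =>
      intro hk
      have h1 := ih (hmem k hk)
      rw [hg] at h1 ⊢
      have h2 : (∫ s in x₀..x (k + 1), (w s + u s)) - ∫ s in x₀..x k, (w s + u s) =
          (∫ s in x k..x (k + 1), w s) + ∫ s in x k..x (k + 1), u s := hsplit _ _
      rw [hu3 k] at h2
      simp only [c, if_pos hk] at h2
      rw [div_mul_cancel₀ _ (sub_pos.2 (hlt k)).ne'] at h2
      linarith
  have hnear : ∀ y ∈ X, ∃ z ∈ X, g z = 0 ∧ |z - y| ≤ τ z ∧ y ≤ 2 * z ∧ z ≤ 2 * y := by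
    intro y hy
    rcases lt_or_ge y x₀ with hlt' | hge
    · obtain ⟨h1, h2⟩ := hlow y hy hlt'
      refine ⟨x₀, hx₀, hx0 ▸ hnode 0 (hx0.symm ▸ hx₀), ?_, ?_, h2⟩
      · rwa [abs_of_pos (by linarith)]
      · linarith [hpos y hy]
    · obtain ⟨k, h1, h2⟩ := hcover y hy hge
      have hk : x k ∈ X := hX.out hx₀ hy ⟨hx0 ▸ hmono.monotone (Nat.zero_le k), h1⟩
      have h3 := hstep k hk
      have h4 : τ (x k) / B ≤ τ (x k) := div_le_self (hτ0 _ hk).le hB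
      have h5 : τ (x k) / B ≤ x k := by rw [div_le_iff₀ hB0]; linarith [hτ _ hk]
      refine ⟨x k, hk, hnode k hk, ?_, ?_, ?_⟩
      · rw [abs_sub_comm, abs_of_nonneg (by linarith)]; linarith
      · linarith
      · linarith [hpos y hy]
  have hsize : ∀ y ∈ X, |g y| ≤ 9 * B ^ 5 * (τ y * τ y ^ α) := by
    intro y hy
    obtain ⟨z, hz, hgz, hd, h1, h2⟩ := hnear y hy
    have h3 := hlocal z hz y hy h2 h1 hd
    rw [hgz, zero_sub, abs_neg] at h3
    have hτz := hτ0 z hz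
    have hτy := hτ0 y hy
    have h4 := hττ z hz y hy h2 h1
    have h5 : |z - y| ^ α ≤ B * τ y ^ α :=
      (Real.rpow_le_rpow (abs_nonneg _) (hd.trans h4) hα.le).trans
        (const_mul_rpow_le hα1 hB hτy.le)
    calc |g y| ≤ 9 * B ^ 3 * (B * τ y * (B * τ y ^ α)) := by
          refine h3.trans ?_
          gcongr
      _ = _ := by ring
  have hB57 : B ^ 5 ≤ B ^ 7 := pow_le_pow_right₀ hB (by norm_num)
  have hB37 : B ^ 3 ≤ B ^ 7 := pow_le_pow_right₀ hB (by norm_num)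
  refine ⟨fun y hy => (hsize y hy).trans ?_, fun y hy z hz hyz hzy => ?_⟩
  · have hτy := hτ0 y hy
    have : 9 * B ^ 5 ≤ 36 * B ^ 7 := by linarith [hBn 7]
    gcongr
  · have hτy := hτ0 y hy
    have hτz := hτ0 z hz
    rcases le_total |y - z| (τ y) with hd | hd
    · have : 9 * B ^ 3 ≤ 36 * B ^ 7 := by linarith [hBn 7]
      refine (hlocal y hy z hz hyz hzy hd).trans ?_
      gcongr
    · have h1 := hsize y hy
      have h2 := hsize z hz
      have h3 := abs_sub (g y) (g z)
      have h4 : τ y * τ y ^ α ≤ τ y * |y - z| ^ α := by gcongr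
      have h5 : τ z ≤ B * τ y := hττ z hz y hy hzy hyz
      have h6 : τ z ^ α ≤ B * τ y ^ α :=
        (Real.rpow_le_rpow hτz.le h5 hα.le).trans (const_mul_rpow_le hα1 hB hτy.le)
      have h7 : τ z * τ z ^ α ≤ B ^ 2 * (τ y * |y - z| ^ α) := by
        calc τ z * τ z ^ α ≤ (B * τ y) * (B * τ y ^ α) := by gcongr
          _ = B ^ 2 * (τ y * τ y ^ α) := by ring
          _ ≤ _ := by gcongr
      have hP : 0 ≤ τ y * |y - z| ^ α := by positivity
      have h8 : 9 * B ^ 5 * (τ y * τ y ^ α) ≤ 9 * B ^ 7 * (τ y * |y - z| ^ α) := by gcongr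
      have h9 : 9 * B ^ 5 * (τ z * τ z ^ α) ≤ 9 * B ^ 7 * (τ y * |y - z| ^ α) := by
        calc 9 * B ^ 5 * (τ z * τ z ^ α) ≤ 9 * B ^ 5 * (B ^ 2 * (τ y * |y - z| ^ α)) := by gcongr
          _ = _ := by ring
      have h10 : 0 ≤ B ^ 7 * (τ y * |y - z| ^ α) := by positivity
      linarith

/-! ### Convex curves in polar coordinates -/

/-- The coefficient `ρ (ρ φ') ^ α` of the error terms `ξ`; here `ω = φ'`. It is also the length
scale on which the divided differences of `F` along a radial piece of the curve are meaningful. -/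
noncomputable def curveScale (α : ℝ) (ρ ω : ℝ → ℝ) (t : ℝ) : ℝ := ρ t * (ρ t * ω t) ^ α

/-- The divided difference of `F` with respect to `ρ`. -/
noncomputable def dividedDiff (ρ F : ℝ → ℝ) (s t : ℝ) : ℝ := (F s - F t) / (ρ s - ρ t)

/-- The relative error of divided differences. -/
noncomputable def dividedError (α : ℝ) (ρ ω : ℝ → ℝ) (s t : ℝ) : ℝ :=
  curveScale α ρ ω s * |s - t| ^ α / |ρ s - ρ t|

/-- A convex curve `ρ e ^ (i φ)` over an interval `T`, with `u = ρ'` and `ω = φ'`, carrying a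
function `F` that satisfies the finitely detected estimates. The formulation refers neither to the
base curvature nor to the base point, and is invariant under the reflection `t ↦ -t`. -/
structure CurveData (B α : ℝ) (T : Set ℝ) (ρ u ω φ F : ℝ → ℝ) : Prop where
  one_le : 1 ≤ B
  alpha_pos : 0 < α
  alpha_le : α ≤ 1
  ordConnected : T.OrdConnected
  pos : ∀ t ∈ T, 0 < ρ t
  hasDerivAt : ∀ t ∈ T, HasDerivAt ρ (u t) t
  abs_le_one : ∀ t ∈ T, |u t| ≤ 1
  strictMono : StrictMonoOn u T
  continuousOn : ContinuousOn u T
  hasDerivAt_angle : ∀ t ∈ T, HasDerivAt φ (ω t) t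
  speed_pos : ∀ t ∈ T, 0 < ω t
  speed_le : ∀ t ∈ T, ρ t * ω t ≤ B
  le_speed : ∀ t ∈ T, |u t| ≤ 1 / 2 → 1 ≤ B * (ρ t * ω t)
  turning : ∀ s ∈ T, ∀ t ∈ T, s ≤ t → u t - u s ≤ B * (φ t - φ s)
  speed_comparable : ∀ J ⊆ T, J.OrdConnected → ∀ r > 0, (∀ t ∈ J, r / 2 ≤ ρ t ∧ ρ t ≤ 2 * r) →
    ∀ s ∈ J, ∀ t ∈ J, ω s ≤ B * ω t
  value_le : ∀ t ∈ T, |F t| ≤ B * (ρ t * ρ t ^ α)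
  slope_le : ∀ J ⊆ T, J.OrdConnected → ∀ r > 0, (∀ t ∈ J, r / 2 ≤ ρ t ∧ ρ t ≤ 2 * r) →
    ∀ s ∈ J, ∀ t ∈ J, ρ s ≠ ρ t →
      |dividedDiff ρ F s t| ≤ B * (r ^ α + dividedError α ρ ω s t)
  slope_compare : ∀ J ⊆ T, J.OrdConnected → ∀ r > 0, (∀ t ∈ J, r / 2 ≤ ρ t ∧ ρ t ≤ 2 * r) →
    ∀ d, ∀ t₁ ∈ J, ∀ t₂ ∈ J, ∀ t₃ ∈ J, ∀ t₄ ∈ J, ρ t₁ ≠ ρ t₂ → ρ t₃ ≠ ρ t₄ →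
      |t₂ - t₁| ≤ d → |t₃ - t₁| ≤ d → |t₄ - t₁| ≤ d →
      |dividedDiff ρ F t₁ t₂ - dividedDiff ρ F t₃ t₄| ≤
        B * (d ^ α + dividedError α ρ ω t₁ t₂ + dividedError α ρ ω t₃ t₄)

namespace CurveData

variable {B α : ℝ} {T : Set ℝ} {ρ u ω φ F : ℝ → ℝ}

theorem mono (h : CurveData B α T ρ u ω φ F) {S : Set ℝ} (hS : S ⊆ T) (hS' : S.OrdConnected) :
    CurveData B α S ρ u ω φ F where
  one_le := h.one_le
  alpha_pos := h.alpha_pos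
  alpha_le := h.alpha_le
  ordConnected := hS'
  pos t ht := h.pos t (hS ht)
  hasDerivAt t ht := h.hasDerivAt t (hS ht)
  abs_le_one t ht := h.abs_le_one t (hS ht)
  strictMono := h.strictMono.mono hS
  continuousOn := h.continuousOn.mono hS
  hasDerivAt_angle t ht := h.hasDerivAt_angle t (hS ht)
  speed_pos t ht := h.speed_pos t (hS ht)
  speed_le t ht := h.speed_le t (hS ht)
  le_speed t ht := h.le_speed t (hS ht)
  turning s hs t ht := h.turning s (hS hs) t (hS ht)
  speed_comparable J hJ := h.speed_comparable J (hJ.trans hS)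
  value_le t ht := h.value_le t (hS ht)
  slope_le J hJ := h.slope_le J (hJ.trans hS)
  slope_compare J hJ := h.slope_compare J (hJ.trans hS)

theorem scale_pos (h : CurveData B α T ρ u ω φ F) {t : ℝ} (ht : t ∈ T) :
    0 < curveScale α ρ ω t :=
  mul_pos (h.pos t ht) (Real.rpow_pos_of_pos (mul_pos (h.pos t ht) (h.speed_pos t ht)) _)

theorem scale_le (h : CurveData B α T ρ u ω φ F) {t : ℝ} (ht : t ∈ T) :
    curveScale α ρ ω t ≤ B * ρ t := by
  have h1 : (ρ t * ω t) ^ α ≤ B := by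
    refine (Real.rpow_le_rpow (mul_pos (h.pos t ht) (h.speed_pos t ht)).le (h.speed_le t ht)
      h.alpha_pos.le).trans ?_
    have := Real.rpow_le_rpow_of_exponent_le h.one_le h.alpha_le
    rwa [Real.rpow_one] at this
  unfold curveScale
  rw [mul_comm]
  exact mul_le_mul_of_nonneg_right h1 (h.pos t ht).le

theorem error_nonneg (h : CurveData B α T ρ u ω φ F) {s t : ℝ} (hs : s ∈ T) :
    0 ≤ dividedError α ρ ω s t :=
  div_nonneg (mul_nonneg (h.scale_pos hs).le (Real.rpow_nonneg (abs_nonneg _) _)) (abs_nonneg _)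

theorem strictMonoOn_angle (h : CurveData B α T ρ u ω φ F) : StrictMonoOn φ T :=
  strictMonoOn_of_hasDerivWithinAt_pos h.ordConnected.convex
    (fun t ht => (h.hasDerivAt_angle t ht).continuousAt.continuousWithinAt)
    (fun t ht => (h.hasDerivAt_angle t (interior_subset ht)).hasDerivWithinAt)
    fun t ht => h.speed_pos t (interior_subset ht)

theorem abs_radius_sub_le (h : CurveData B α T ρ u ω φ F) {s t : ℝ} (hs : s ∈ T) (ht : t ∈ T) :
    |ρ s - ρ t| ≤ |s - t| := by
  have := h.ordConnected.convex.norm_image_sub_le_of_norm_hasDerivWithin_le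
    (fun x hx => (h.hasDerivAt x hx).hasDerivWithinAt) (C := 1)
    (fun x hx => by rw [Real.norm_eq_abs]; exact h.abs_le_one x hx) ht hs
  simpa using this

theorem strictMonoOn_radius (h : CurveData B α T ρ u ω φ F) (hu : ∀ t ∈ T, 0 ≤ u t) :
    StrictMonoOn ρ T := by
  refine strictMonoOn_of_hasDerivWithinAt_pos h.ordConnected.convex
    (fun t ht => (h.hasDerivAt t ht).continuousAt.continuousWithinAt)
    (fun t ht => (h.hasDerivAt t (interior_subset ht)).hasDerivWithinAt) fun t ht => ?_
  obtain ⟨ε, hε, hb⟩ := Metric.mem_nhds_iff.1 (mem_interior_iff_mem_nhds.1 ht)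
  have h1 : t - ε / 2 ∈ T := hb (by
    rw [Metric.mem_ball, Real.dist_eq]; rw [abs_of_neg] <;> linarith)
  exact (hu _ h1).trans_lt (h.strictMono h1 (interior_subset ht) (by linarith))

theorem ordConnected_inter_radius (h : CurveData B α T ρ u ω φ F) (hu : ∀ t ∈ T, 0 ≤ u t)
    (r r' : ℝ) : (T ∩ {t | r ≤ ρ t ∧ ρ t ≤ r'}).OrdConnected := by
  have hm := (h.strictMonoOn_radius hu).monotoneOn
  refine ⟨fun x hx y hy z hz => ?_⟩
  have hzT := h.ordConnected.out hx.1 hy.1 hz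
  exact ⟨hzT, hx.2.1.trans (hm hx.1 hzT hz.1), (hm hzT hy.1 hz.2).trans hy.2.2⟩

theorem speed_le_of_comparable (h : CurveData B α T ρ u ω φ F) (hu : ∀ t ∈ T, 0 ≤ u t) {s t : ℝ}
    (hs : s ∈ T) (ht : t ∈ T) (hst : ρ s ≤ 4 * ρ t) (hts : ρ t ≤ 4 * ρ s) : ω s ≤ B * ω t := by
  have hs0 := h.pos s hs
  have ht0 := h.pos t ht
  have hm : 0 < min (ρ s) (ρ t) := lt_min hs0 ht0
  have h1 := min_le_left (ρ s) (ρ t)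
  have h2 := min_le_right (ρ s) (ρ t)
  have h3 : ρ s ≤ 4 * min (ρ s) (ρ t) := by
    rcases min_choice (ρ s) (ρ t) with e | e <;> rw [e] <;> linarith
  have h4 : ρ t ≤ 4 * min (ρ s) (ρ t) := by
    rcases min_choice (ρ s) (ρ t) with e | e <;> rw [e] <;> linarith
  refine h.speed_comparable _ inter_subset_left (h.ordConnected_inter_radius hu
    (min (ρ s) (ρ t)) (4 * min (ρ s) (ρ t))) (2 * min (ρ s) (ρ t)) (by linarith)
    (fun x hx => ⟨by linarith [hx.2.1], by linarith [hx.2.2]⟩) s ⟨hs, h1, h3⟩ t ⟨ht, h2, h4⟩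

theorem slope_le_of_comparable (h : CurveData B α T ρ u ω φ F) (hu : ∀ t ∈ T, 0 ≤ u t) {s t r : ℝ}
    (hs : s ∈ T) (ht : t ∈ T) (hr : 0 < r) (hrs : r ≤ ρ s) (hrt : r ≤ ρ t) (hsr : ρ s ≤ 4 * r)
    (htr : ρ t ≤ 4 * r) (hst : s ≠ t) :
    |dividedDiff ρ F s t| ≤ B * (2 * r ^ α + dividedError α ρ ω s t) := by
  have hinj := (h.strictMonoOn_radius hu).injOn
  have h1 := h.slope_le _ inter_subset_left (h.ordConnected_inter_radius hu r (4 * r)) (2 * r)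
    (by linarith) (fun x hx => ⟨by linarith [hx.2.1], by linarith [hx.2.2]⟩) s ⟨hs, hrs, hsr⟩ t
    ⟨ht, hrt, htr⟩ (fun e => hst (hinj hs ht e))
  have h2 := const_mul_rpow_le h.alpha_le one_le_two hr.le
  have hB := h.one_le
  refine h1.trans ?_
  gcongr

theorem value_sub_le_of_comparable (h : CurveData B α T ρ u ω φ F) (hu : ∀ t ∈ T, 0 ≤ u t)
    {s t : ℝ} (hs : s ∈ T) (ht : t ∈ T) (hst : ρ s ≤ 4 * ρ t) (hts : ρ t ≤ 4 * ρ s) :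
    |F s - F t| ≤ 2 * B * (ρ s ^ α * |ρ s - ρ t| + curveScale α ρ ω s * |s - t| ^ α) := by
  have hB := h.one_le
  have hs0 := h.pos s hs
  have ht0 := h.pos t ht
  have hτ := h.scale_pos hs
  rcases eq_or_ne s t with rfl | hne
  · have : 0 ≤ |s - s| ^ α := Real.rpow_nonneg (abs_nonneg _) _
    rw [sub_self, abs_zero]
    positivity
  have hρ : ρ s - ρ t ≠ 0 := sub_ne_zero.2 fun e =>
    hne ((h.strictMonoOn_radius hu).injOn hs ht e)
  have h1 := min_le_left (ρ s) (ρ t)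
  have h2 := min_le_right (ρ s) (ρ t)
  have hm : 0 < min (ρ s) (ρ t) := lt_min hs0 ht0
  have h3 := h.slope_le_of_comparable hu hs ht hm h1 h2
    (by rcases min_choice (ρ s) (ρ t) with e | e <;> rw [e] <;> linarith)
    (by rcases min_choice (ρ s) (ρ t) with e | e <;> rw [e] <;> linarith) hne
  have h4 : min (ρ s) (ρ t) ^ α ≤ ρ s ^ α := Real.rpow_le_rpow hm.le h1 h.alpha_pos.le
  have hab : 0 < |ρ s - ρ t| := abs_pos.2 hρ
  unfold dividedDiff dividedError at h3
  rw [abs_div, div_le_iff₀ hab] at h3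
  have e : B * (2 * min (ρ s) (ρ t) ^ α + curveScale α ρ ω s * |s - t| ^ α / |ρ s - ρ t|) *
      |ρ s - ρ t| = B * (2 * min (ρ s) (ρ t) ^ α * |ρ s - ρ t| +
        curveScale α ρ ω s * |s - t| ^ α) := by
    field_simp
  rw [e] at h3
  have hP : 0 ≤ curveScale α ρ ω s * |s - t| ^ α := by positivity
  have h5 : B * (2 * min (ρ s) (ρ t) ^ α * |ρ s - ρ t| + curveScale α ρ ω s * |s - t| ^ α) ≤
      B * (2 * ρ s ^ α * |ρ s - ρ t| + 2 * (curveScale α ρ ω s * |s - t| ^ α)) := by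
    refine mul_le_mul_of_nonneg_left (add_le_add ?_ (by linarith)) (by linarith)
    gcongr
  linarith

/-- The angle grows at least at the speed at one end, as long as the radius stays comparable. -/
theorem speed_mul_le_angle (h : CurveData B α T ρ u ω φ F) (hu : ∀ t ∈ T, 0 ≤ u t)
    {s t : ℝ} (hs : s ∈ T) (ht : t ∈ T) (hst : ρ s ≤ 4 * ρ t) (hts : ρ t ≤ 4 * ρ s) :
    ω s * |s - t| ≤ B * |φ s - φ t| := by
  have hm := (h.strictMonoOn_radius hu).monotoneOn
  have key : ∀ x ∈ T, ∀ y ∈ T, x < y → ρ y ≤ 4 * ρ x → ∃ z ∈ T, φ y - φ x = ω z * (y - x) ∧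
      ρ x ≤ ρ z ∧ ρ z ≤ ρ y := by
    intro x hx y hy hxy _
    have hsub : Icc x y ⊆ T := h.ordConnected.out hx hy
    obtain ⟨z, hz, e⟩ := exists_hasDerivAt_eq_slope φ ω hxy
      (fun z hz => (h.hasDerivAt_angle z (hsub hz)).continuousAt.continuousWithinAt)
      (fun z hz => h.hasDerivAt_angle z (hsub ⟨hz.1.le, hz.2.le⟩))
    have hzT := hsub ⟨hz.1.le, hz.2.le⟩
    refine ⟨z, hzT, ?_, hm hx hzT hz.1.le, hm hzT hy hz.2.le⟩
    rw [e, div_mul_cancel₀ _ (sub_pos.2 hxy).ne']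
  have hs0 := h.pos s hs
  have ht0 := h.pos t ht
  rcases lt_trichotomy s t with hlt | rfl | hlt
  · obtain ⟨z, hz, e, h1, h2⟩ := key s hs t ht hlt hts
    have h3 := h.speed_le_of_comparable hu hs hz (by linarith) (by linarith)
    rw [abs_sub_comm s, abs_sub_comm (φ s), e, abs_of_pos (sub_pos.2 hlt),
      abs_of_pos (mul_pos (h.speed_pos z hz) (sub_pos.2 hlt)), ← mul_assoc]
    exact mul_le_mul_of_nonneg_right h3 (sub_pos.2 hlt).le
  · simp
  · obtain ⟨z, hz, e, h1, h2⟩ := key t ht s hs hlt hst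
    have h3 := h.speed_le_of_comparable hu hs hz (by linarith) (by linarith)
    rw [e, abs_of_pos (sub_pos.2 hlt),
      abs_of_pos (mul_pos (h.speed_pos z hz) (sub_pos.2 hlt)), ← mul_assoc]
    exact mul_le_mul_of_nonneg_right h3 (sub_pos.2 hlt).le

theorem scale_le_of_comparable (h : CurveData B α T ρ u ω φ F) (hu : ∀ t ∈ T, 0 ≤ u t)
    {s t : ℝ} (hs : s ∈ T) (ht : t ∈ T) (hst : ρ s ≤ 2 * ρ t) (hts : ρ t ≤ 2 * ρ s) :
    curveScale α ρ ω s ≤ 4 * B * curveScale α ρ ω t := by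
  have hB := h.one_le
  have hs0 := h.pos s hs
  have ht0 := h.pos t ht
  have hωs := h.speed_pos s hs
  have hωt := h.speed_pos t ht
  have h1 := h.speed_le_of_comparable hu hs ht (by linarith) (by linarith)
  have h2 : ρ s * ω s ≤ (2 * B) * (ρ t * ω t) := by
    calc ρ s * ω s ≤ (2 * ρ t) * (B * ω t) := by gcongr
      _ = _ := by ring
  have h3 : (ρ s * ω s) ^ α ≤ (2 * B) * (ρ t * ω t) ^ α :=
    (Real.rpow_le_rpow (by positivity) h2 h.alpha_pos.le).trans
      (const_mul_rpow_le h.alpha_le (by linarith) (by positivity))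
  unfold curveScale
  calc ρ s * (ρ s * ω s) ^ α ≤ (2 * ρ t) * ((2 * B) * (ρ t * ω t) ^ α) := by gcongr
    _ = _ := by ring

/-- A bound for divided differences without any comparability assumption. -/
theorem abs_slope_le (h : CurveData B α T ρ u ω φ F) (hu : ∀ t ∈ T, 0 ≤ u t) {s t M : ℝ}
    (hs : s ∈ T) (ht : t ∈ T) (hst : s ≠ t) (hsM : ρ s ≤ M) (htM : ρ t ≤ M) :
    |dividedDiff ρ F s t| ≤ 3 * B * M ^ α + B * dividedError α ρ ω s t := by
  have hB := h.one_le
  have hs0 := h.pos s hs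
  have ht0 := h.pos t ht
  have hα := h.alpha_pos
  have he := h.error_nonneg hs (t := t)
  have hM0 : 0 < M := hs0.trans_le hsM
  have hMα : 0 < M ^ α := Real.rpow_pos_of_pos hM0 _
  have hsα := Real.rpow_le_rpow hs0.le hsM hα.le
  have htα := Real.rpow_le_rpow ht0.le htM hα.le
  have hBM : 0 < B * M ^ α := by positivity
  have far : ∀ x ∈ T, ∀ y ∈ T, 4 * ρ x < ρ y → ρ y ≤ M →
      |F x - F y| ≤ 3 * (B * M ^ α) * |ρ x - ρ y| := by
    intro x hx y hy hxy hyM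
    have hx0 := h.pos x hx
    have hy0 := h.pos y hy
    have h1 := h.value_le x hx
    have h2 := h.value_le y hy
    have h3 := abs_sub (F x) (F y)
    have hxα := Real.rpow_le_rpow hx0.le (by linarith : ρ x ≤ M) hα.le
    have hyα := Real.rpow_le_rpow hy0.le hyM hα.le
    have h4 : ρ x * ρ x ^ α ≤ (1 / 4 * ρ y) * M ^ α := by
      have : 0 ≤ ρ x ^ α := by positivity
      gcongr
      linarith
    have h5 : ρ y * ρ y ^ α ≤ ρ y * M ^ α := by gcongr
    rw [abs_of_neg (by linarith : ρ x - ρ y < 0)]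
    have h6 : B * (ρ x * ρ x ^ α) ≤ B * ((1 / 4 * ρ y) * M ^ α) := by gcongr
    have h7 : B * (ρ y * ρ y ^ α) ≤ B * (ρ y * M ^ α) := by gcongr
    have h8 : B * M ^ α * (4 * ρ x) ≤ B * M ^ α * ρ y := by gcongr
    nlinarith
  have hfin : ∀ X : ℝ, X ≤ 3 * (B * M ^ α) → X ≤ 3 * B * M ^ α + B * dividedError α ρ ω s t := by
    intro X hX
    have : 0 ≤ B * dividedError α ρ ω s t := by positivity
    linarith
  have hρ : 0 < |ρ s - ρ t| := abs_pos.2 (sub_ne_zero.2 fun e =>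
    hst ((h.strictMonoOn_radius hu).injOn hs ht e))
  rcases lt_or_ge (4 * ρ s) (ρ t) with h1 | h1
  · apply hfin
    unfold dividedDiff
    rw [abs_div, div_le_iff₀ hρ]
    exact far s hs t ht h1 htM
  rcases lt_or_ge (4 * ρ t) (ρ s) with h2 | h2
  · apply hfin
    unfold dividedDiff
    rw [abs_div, div_le_iff₀ hρ, abs_sub_comm, abs_sub_comm (ρ s)]
    exact far t ht s hs h2 hsM
  have hm : 0 < min (ρ s) (ρ t) := lt_min hs0 ht0
  have h3 := h.slope_le_of_comparable hu hs ht hm (min_le_left _ _) (min_le_right _ _)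
    (by rcases min_choice (ρ s) (ρ t) with e | e <;> rw [e] <;> linarith)
    (by rcases min_choice (ρ s) (ρ t) with e | e <;> rw [e] <;> linarith) hst
  have h4 : min (ρ s) (ρ t) ^ α ≤ M ^ α :=
    Real.rpow_le_rpow hm.le ((min_le_left _ _).trans hsM) hα.le
  have h5 : B * min (ρ s) (ρ t) ^ α ≤ B * M ^ α := by gcongr
  nlinarith

end CurveData

theorem rpow_sum_four_le {α a b c d : ℝ} (hα : 0 < α) (hα1 : α ≤ 1) (ha : 0 ≤ a) (hb : 0 ≤ b)
    (hc : 0 ≤ c) (hd : 0 ≤ d) :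
    (2 * (a + b + c + d)) ^ α ≤ 2 * (a ^ α + b ^ α + c ^ α + d ^ α) := by
  have h0 := const_mul_rpow_le hα1 one_le_two (by positivity : 0 ≤ a + b + c + d)
  have h1 := rpow_add_le_add_rpow hα hα1 (by positivity : 0 ≤ a + b + c) hd
  have h2 := rpow_add_le_add_rpow hα hα1 (by positivity : 0 ≤ a + b) hc
  have h3 := rpow_add_le_add_rpow hα hα1 ha hb
  linarith

namespace CurveData

variable {B α : ℝ} {T : Set ℝ} {ρ u ω φ F : ℝ → ℝ}

theorem abs_sub_le_two_mul (h : CurveData B α T ρ u ω φ F) (hu : ∀ t ∈ T, 1 / 2 ≤ u t) {s t : ℝ}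
    (hs : s ∈ T) (ht : t ∈ T) : |s - t| ≤ 2 * |ρ s - ρ t| := by
  have key : ∀ x ∈ T, ∀ y ∈ T, x < y → |x - y| ≤ 2 * |ρ x - ρ y| := by
    intro x hx y hy hxy
    have hsub : Icc x y ⊆ T := h.ordConnected.out hx hy
    obtain ⟨z, hz, e⟩ := exists_hasDerivAt_eq_slope ρ u hxy
      (fun z hz => (h.hasDerivAt z (hsub hz)).continuousAt.continuousWithinAt)
      (fun z hz => h.hasDerivAt z (hsub ⟨hz.1.le, hz.2.le⟩))
    have h1 := hu z (hsub ⟨hz.1.le, hz.2.le⟩)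
    rw [e, le_div_iff₀ (sub_pos.2 hxy)] at h1
    rw [abs_sub_comm, abs_of_pos (sub_pos.2 hxy), abs_sub_comm]
    linarith [le_abs_self (ρ y - ρ x)]
  rcases lt_trichotomy s t with hlt | rfl | hlt
  · exact key s hs t ht hlt
  · simp
  · rw [abs_sub_comm, abs_sub_comm (ρ s)]; exact key t ht s hs hlt

/-- Two divided differences along a radial piece of the curve, compared at an arbitrary radius. -/
theorem slope_sub_le (h : CurveData B α T ρ u ω φ F) (hu : ∀ t ∈ T, 1 / 2 ≤ u t)
    {t₁ t₂ t₃ t₄ : ℝ} (h1 : t₁ ∈ T) (h2 : t₂ ∈ T) (h3 : t₃ ∈ T) (h4 : t₄ ∈ T) (h12 : t₁ ≠ t₂)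
    (h34 : t₃ ≠ t₄) (r : ℝ) :
    |dividedDiff ρ F t₁ t₂ - dividedDiff ρ F t₃ t₄| ≤
      B * dividedError α ρ ω t₁ t₂ + B * dividedError α ρ ω t₃ t₄ +
      24 * B * (|r - ρ t₁| ^ α + |r - ρ t₂| ^ α + |r - ρ t₃| ^ α + |r - ρ t₄| ^ α) := by
  have hB := h.one_le
  have hu0 : ∀ t ∈ T, 0 ≤ u t := fun t ht => by linarith [hu t ht]
  have hinj := (h.strictMonoOn_radius hu0).injOn
  have hα := h.alpha_pos
  set S := |r - ρ t₁| ^ α + |r - ρ t₂| ^ α + |r - ρ t₃| ^ α + |r - ρ t₄| ^ α with hS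
  have hS0 : 0 ≤ S := by positivity
  have hpow := rpow_sum_four_le hα h.alpha_le (abs_nonneg (r - ρ t₁)) (abs_nonneg (r - ρ t₂))
    (abs_nonneg (r - ρ t₃)) (abs_nonneg (r - ρ t₄))
  rw [← hS] at hpow
  set D := |r - ρ t₁| + |r - ρ t₂| + |r - ρ t₃| + |r - ρ t₄|
  have hn1 := abs_nonneg (r - ρ t₁)
  have hn2 := abs_nonneg (r - ρ t₂)
  have hn3 := abs_nonneg (r - ρ t₃)
  have hn4 := abs_nonneg (r - ρ t₄)
  have hdiff : ∀ x y : ℝ, |x - y| ≤ |r - x| + |r - y| := fun x y => by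
    have := abs_sub (r - y) (r - x)
    rw [show r - y - (r - x) = x - y by ring] at this
    linarith
  set M := max (max (ρ t₁) (ρ t₂)) (max (ρ t₃) (ρ t₄))
  set μ := min (min (ρ t₁) (ρ t₂)) (min (ρ t₃) (ρ t₄))
  have hM1 : ρ t₁ ≤ M := (le_max_left _ _).trans (le_max_left _ _)
  have hM2 : ρ t₂ ≤ M := (le_max_right _ _).trans (le_max_left _ _)
  have hM3 : ρ t₃ ≤ M := (le_max_left _ _).trans (le_max_right _ _)
  have hM4 : ρ t₄ ≤ M := (le_max_right _ _).trans (le_max_right _ _)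
  have hm1 : μ ≤ ρ t₁ := (min_le_left _ _).trans (min_le_left _ _)
  have hm2 : μ ≤ ρ t₂ := (min_le_left _ _).trans (min_le_right _ _)
  have hm3 : μ ≤ ρ t₃ := (min_le_right _ _).trans (min_le_left _ _)
  have hm4 : μ ≤ ρ t₄ := (min_le_right _ _).trans (min_le_right _ _)
  have hμ : 0 < μ := lt_min (lt_min (h.pos _ h1) (h.pos _ h2)) (lt_min (h.pos _ h3) (h.pos _ h4))
  rcases le_or_gt M (4 * μ) with hle | hgt
  · have hd : ∀ t ∈ T, |ρ t - ρ t₁| ≤ D → |t - t₁| ≤ 2 * D := fun t ht hh =>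
      (h.abs_sub_le_two_mul hu ht h1).trans (by linarith)
    have key := h.slope_compare _ inter_subset_left (h.ordConnected_inter_radius hu0 μ (4 * μ))
      (2 * μ) (by linarith) (fun x hx => ⟨by linarith [hx.2.1], by linarith [hx.2.2]⟩) (2 * D)
      t₁ ⟨h1, hm1, hM1.trans hle⟩ t₂ ⟨h2, hm2, hM2.trans hle⟩ t₃ ⟨h3, hm3, hM3.trans hle⟩
      t₄ ⟨h4, hm4, hM4.trans hle⟩ (fun e => h12 (hinj h1 h2 e)) (fun e => h34 (hinj h3 h4 e))
      (hd t₂ h2 ((hdiff _ _).trans (by linarith))) (hd t₃ h3 ((hdiff _ _).trans (by linarith)))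
      (hd t₄ h4 ((hdiff _ _).trans (by linarith)))
    have : B * (2 * D) ^ α ≤ B * (2 * S) := by gcongr
    have : 0 ≤ B * S := by positivity
    linarith
  · have k1 := h.abs_slope_le hu0 h1 h2 h12 hM1 hM2
    have k2 := h.abs_slope_le hu0 h3 h4 h34 hM3 hM4
    have k3 := abs_sub (dividedDiff ρ F t₁ t₂) (dividedDiff ρ F t₃ t₄)
    have hMr : M ≤ r + D := by
      refine max_le (max_le ?_ ?_) (max_le ?_ ?_)
      · linarith [neg_abs_le (r - ρ t₁)]
      · linarith [neg_abs_le (r - ρ t₂)]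
      · linarith [neg_abs_le (r - ρ t₃)]
      · linarith [neg_abs_le (r - ρ t₄)]
    have hμr : r - D ≤ μ := by
      refine le_min (le_min ?_ ?_) (le_min ?_ ?_)
      · linarith [le_abs_self (r - ρ t₁)]
      · linarith [le_abs_self (r - ρ t₂)]
      · linarith [le_abs_self (r - ρ t₃)]
      · linarith [le_abs_self (r - ρ t₄)]
    have hM0 : 0 < M := by linarith
    have hMα : M ^ α ≤ 4 * S := by
      have e : M ≤ 2 * (2 * D) := by linarith
      refine (Real.rpow_le_rpow hM0.le e hα.le).trans ?_
      have := const_mul_rpow_le h.alpha_le one_le_two (by positivity : 0 ≤ 2 * D)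
      linarith
    have : B * M ^ α ≤ B * (4 * S) := by gcongr
    linarith

end CurveData

/-! ### The radial part of the construction -/

namespace CurveData

variable {B α : ℝ} {T : Set ℝ} {ρ u ω φ F : ℝ → ℝ}

/-- On a radial piece of the curve there is one Hölder continuous function of the radius that
approximates all divided differences; it can be chosen to vanish well inside the curve. -/
theorem exists_slope_function (h : CurveData B α T ρ u ω φ F) (hu : ∀ t ∈ T, 1 / 2 ≤ u t) {a : ℝ}
    (haρ : ∀ t ∈ T, a ≤ ρ t) :
    ∃ v : ℝ → ℝ, (∀ r r', |v r - v r'| ≤ 48 * B * |r - r'| ^ α) ∧ (∀ r ≤ a / 2, v r = 0) ∧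
      ∀ s ∈ T, ∀ t ∈ T, |F s - F t - v (ρ s) * (ρ s - ρ t)| ≤
        24 * B * (curveScale α ρ ω s * |s - t| ^ α + |ρ s - ρ t| * |ρ s - ρ t| ^ α) := by
  have hB := h.one_le
  have hα := h.alpha_pos
  have hα1 := h.alpha_le
  have hu0 : ∀ t ∈ T, 0 ≤ u t := fun t ht => by linarith [hu t ht]
  have hdiff : ∀ x r r' : ℝ, |r - x| ^ α ≤ |r' - x| ^ α + |r - r'| ^ α := fun x r r' => by
    have := abs_rpow_le_add hα hα1 (r - x) (r' - x)
    rwa [show r - x - (r' - x) = r - r' by ring] at this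
  -- The data to be interpolated are the divided differences over all pairs of points, and the
  -- value `0` at all radii below `a / 2`.
  let ι := {p : ℝ × ℝ // p.1 ∈ T ∧ p.2 ∈ T ∧ p.1 ≠ p.2} ⊕ {r : ℝ // r ≤ a / 2}
  let y : ι → ℝ := Sum.elim (fun p => dividedDiff ρ F p.1.1 p.1.2) fun _ => 0
  let e : ι → ℝ := Sum.elim (fun p => B * dividedError α ρ ω p.1.1 p.1.2) fun _ => 0
  let d : ι → ℝ → ℝ := Sum.elim
    (fun p r => 24 * B * (|r - ρ p.1.1| ^ α + |r - ρ p.1.2| ^ α))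
    fun r' r => 24 * B * |r - r'| ^ α
  have hanchor : ∀ s ∈ T, ∀ t ∈ T, s ≠ t → ∀ r' ≤ a / 2, ∀ r,
      |dividedDiff ρ F s t| ≤ B * dividedError α ρ ω s t +
        24 * B * (|r - ρ s| ^ α + |r - ρ t| ^ α + |r - r'| ^ α) := by
    intro s hs t ht hst r' hr' r
    have k1 := h.abs_slope_le hu0 hs ht hst (le_max_left _ _) (le_max_right _ _)
    have k2 := rpow_sum_four_le hα hα1 (abs_nonneg (r - ρ s)) (abs_nonneg (r - ρ t))
      (abs_nonneg (r - r')) le_rfl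
    rw [Real.zero_rpow hα.ne', add_zero, add_zero] at k2
    have hM : max (ρ s) (ρ t) ≤ 2 * (|r - ρ s| + |r - ρ t| + |r - r'|) := by
      have := haρ s hs
      have := haρ t ht
      refine max_le ?_ ?_
      · linarith [neg_abs_le (r - ρ s), le_abs_self (r - r'), abs_nonneg (r - ρ t)]
      · linarith [neg_abs_le (r - ρ t), le_abs_self (r - r'), abs_nonneg (r - ρ s)]
    have k3 := (Real.rpow_le_rpow ((h.pos s hs).le.trans (le_max_left _ _)) hM hα.le).trans k2
    have k4 := mul_le_mul_of_nonneg_left k3 (by linarith : 0 ≤ B)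
    have k5 : 0 ≤ B * (|r - ρ s| ^ α + |r - ρ t| ^ α + |r - r'| ^ α) := by positivity
    linarith
  have : Nonempty ι := ⟨Sum.inr ⟨a / 2, le_rfl⟩⟩
  obtain ⟨v, hv1, hv2⟩ := exists_between_of_compatible y e d (by
    rintro (⟨⟨s, t⟩, hs, ht, hst⟩ | ⟨r', hr'⟩) (⟨⟨s₂, t₂⟩, hs₂, ht₂, hst₂⟩ | ⟨r₂, hr₂⟩) r
    · simp only [y, e, d, Sum.elim_inl]
      have := h.slope_sub_le hu hs ht hs₂ ht₂ hst hst₂ r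
      linarith [le_abs_self (dividedDiff ρ F s t - dividedDiff ρ F s₂ t₂)]
    · simp only [y, e, d, Sum.elim_inl, Sum.elim_inr]
      have := hanchor s hs t ht hst r₂ hr₂ r
      linarith [le_abs_self (dividedDiff ρ F s t)]
    · simp only [y, e, d, Sum.elim_inl, Sum.elim_inr]
      have := hanchor s₂ hs₂ t₂ ht₂ hst₂ r' hr' r
      linarith [neg_abs_le (dividedDiff ρ F s₂ t₂)]
    · simp only [y, e, d, Sum.elim_inr]
      have : 0 ≤ 24 * B * |r - r'| ^ α := by positivity
      have : 0 ≤ 24 * B * |r - r₂| ^ α := by positivity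
      linarith) (fun r r' => 48 * B * |r - r'| ^ α) (by
    rintro (⟨⟨s, t⟩, hs, ht, hst⟩ | ⟨r₁, hr₁⟩) r r'
    · simp only [d, Sum.elim_inl]
      have := mul_le_mul_of_nonneg_left (add_le_add (hdiff (ρ s) r r') (hdiff (ρ t) r r'))
        (by linarith : 0 ≤ 24 * B)
      linarith
    · simp only [d, Sum.elim_inr]
      have := mul_le_mul_of_nonneg_left (hdiff r₁ r r') (by linarith : 0 ≤ 24 * B)
      have : 0 ≤ 24 * B * |r - r'| ^ α := by positivity
      linarith)
  refine ⟨v, fun r r' => ?_, fun r hr => ?_, fun s hs t ht => ?_⟩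
  · have h1 := hv1 r r'
    have h2 := hv1 r' r
    rw [abs_sub_comm r' r] at h2
    rw [abs_le]
    constructor <;> linarith
  · have := hv2 (Sum.inr ⟨r, hr⟩) r
    simpa [y, e, d, Real.zero_rpow hα.ne'] using this
  · have hτ := h.scale_pos hs
    rcases eq_or_ne s t with rfl | hst
    · simp only [sub_self, mul_zero, abs_zero]
      have := Real.rpow_nonneg (le_refl (0 : ℝ)) α
      positivity
    have h1 := hv2 (Sum.inl ⟨(s, t), hs, ht, hst⟩) (ρ s)
    simp only [y, e, d, Sum.elim_inl, sub_self, abs_zero, Real.zero_rpow hα.ne', zero_add] at h1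
    have hρ : ρ s - ρ t ≠ 0 := sub_ne_zero.2 fun e =>
      hst ((h.strictMonoOn_radius hu0).injOn hs ht e)
    have hab : 0 < |ρ s - ρ t| := abs_pos.2 hρ
    have e1 : F s - F t - v (ρ s) * (ρ s - ρ t) =
        -((v (ρ s) - dividedDiff ρ F s t) * (ρ s - ρ t)) := by
      unfold dividedDiff
      field_simp
      ring
    rw [e1, abs_neg, abs_mul]
    refine (mul_le_mul_of_nonneg_right h1 hab.le).trans ?_
    have e2 : (B * dividedError α ρ ω s t + 24 * B * |ρ s - ρ t| ^ α) * |ρ s - ρ t| =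
        B * (curveScale α ρ ω s * |s - t| ^ α) +
          24 * B * (|ρ s - ρ t| * |ρ s - ρ t| ^ α) := by
      unfold dividedError
      field_simp
    rw [e2]
    have : 0 ≤ B * (curveScale α ρ ω s * |s - t| ^ α) := by positivity
    linarith

/-- The slope function, modified well inside the curve so that its primitive takes the right value
at one point `t₀` near the inner end of the curve. -/
theorem exists_anchored_slope_function (h : CurveData B α T ρ u ω φ F)
    (hu : ∀ t ∈ T, 1 / 2 ≤ u t) {a : ℝ} (ha : 0 < a) (haρ : ∀ t ∈ T, a ≤ ρ t) {t₀ : ℝ}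
    (ht₀ : t₀ ∈ T) (ht₀a : ρ t₀ ≤ 2 * a) :
    ∃ w : ℝ → ℝ, (∀ r r', |w r - w r'| ≤ 9648 * B * |r - r'| ^ α) ∧ (∀ r ≤ a / 2, w r = 0) ∧
      (∫ r in 0..ρ t₀, w r) = F t₀ ∧
      ∀ s ∈ T, ∀ t ∈ T, |F s - F t - w (ρ s) * (ρ s - ρ t)| ≤
        24 * B * (curveScale α ρ ω s * |s - t| ^ α + |ρ s - ρ t| * |ρ s - ρ t| ^ α) := by
  have hB := h.one_le
  have hα := h.alpha_pos
  have hα1 := h.alpha_le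
  obtain ⟨v, hv1, hv2, hv3⟩ := h.exists_slope_function hu haρ
  have hvc := continuous_of_holder hα hv1
  have hρ0 := h.pos t₀ ht₀
  have haα : 0 < a ^ α := Real.rpow_pos_of_pos ha _
  have hpow : ρ t₀ ^ α ≤ 2 * a ^ α :=
    (Real.rpow_le_rpow hρ0.le ht₀a hα.le).trans (const_mul_rpow_le hα1 one_le_two ha.le)
  set E := F t₀ - ∫ r in 0..ρ t₀, v r with hE
  have hEle : |E| ≤ 200 * B * (a * a ^ α) := by
    have h1 := h.value_le t₀ ht₀
    have h2 := intervalIntegral.norm_integral_le_of_norm_le_const (a := 0) (b := ρ t₀)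
      (f := v) (C := 48 * B * ρ t₀ ^ α) (fun r hr => by
        rw [uIoc_of_le hρ0.le] at hr
        have := hv1 r 0
        rw [hv2 0 (by linarith), sub_zero, sub_zero, abs_of_pos hr.1] at this
        rw [Real.norm_eq_abs]
        refine this.trans ?_
        have := Real.rpow_le_rpow hr.1.le hr.2 hα.le
        gcongr)
    rw [Real.norm_eq_abs, sub_zero, abs_of_pos hρ0] at h2
    have h3 := abs_sub (F t₀) (∫ r in 0..ρ t₀, v r)
    have h4 : ρ t₀ * ρ t₀ ^ α ≤ (2 * a) * (2 * a ^ α) := by gcongr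
    have h5 : B * (ρ t₀ * ρ t₀ ^ α) ≤ B * ((2 * a) * (2 * a ^ α)) := by gcongr
    have h6 : 0 ≤ B * (a * a ^ α) := by positivity
    have h7 : 48 * B * ρ t₀ ^ α * ρ t₀ = 48 * (B * (ρ t₀ * ρ t₀ ^ α)) := by ring
    have h8 : B * ((2 * a) * (2 * a ^ α)) = 4 * (B * (a * a ^ α)) := by ring
    linarith
  let x : ℕ → ℝ := fun k => a / 2 + k * (a / 2)
  have hstep : ∀ k, x (k + 1) - x k = a / 2 := fun k => by simp only [x]; push_cast; ring
  have hx : StrictMono x := strictMono_nat_of_lt_succ fun k => by linarith [hstep k]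
  -- The missing integral `E` is supplied by a single bump on `[a / 2, a]`.
  let c : ℕ → ℝ := fun k => if k = 0 then E / (a / 2) else 0
  have hc : ∀ k, |c k| ≤ 800 * B * (x (k + 1) - x k) ^ α := fun k => by
    rw [hstep]
    have h1 : a ^ α ≤ 2 * (a / 2) ^ α := by
      have := const_mul_rpow_le hα1 one_le_two (by linarith : 0 ≤ a / 2)
      rwa [mul_div_cancel₀ _ (two_ne_zero' ℝ)] at this
    have h2 : 0 ≤ (a / 2) ^ α := by positivity
    by_cases hk : k = 0
    · simp only [c, if_pos hk]
      rw [abs_div, abs_of_pos (by linarith : 0 < a / 2), div_le_iff₀ (by linarith)]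
      have h3 : 200 * B * (a * a ^ α) ≤ 200 * B * (a * (2 * (a / 2) ^ α)) := by gcongr
      linarith
    · simp only [c, if_neg hk, abs_zero]
      positivity
  obtain ⟨b, hb1, hb2, hb3⟩ := exists_holder_of_means hα hα1 hx hc
  have hbc := continuous_of_holder hα hb1
  have hx0 : x 0 = a / 2 := by simp [x]
  have hx1 : x (0 + 1) = a := by simp [x]
  have hbsupp : ∀ s, b s ≠ 0 → a / 2 < s ∧ s < a := fun s hs => by
    obtain ⟨k, hk, hck, -⟩ := hb2 s hs
    have hk0 : k = 0 := by
      by_contra hk0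
      exact hck (by simp only [c, if_neg hk0])
    subst hk0
    rwa [hx0, hx1] at hk
  have hbint : ∫ s in 0..ρ t₀, b s = E := by
    have e1 : ∫ s in 0..a / 2, b s = 0 := by
      rw [intervalIntegral.integral_congr (g := fun _ => 0)]
      · simp
      · intro s hs
        rw [uIcc_of_le (by linarith)] at hs
        by_contra h0
        linarith [(hbsupp s h0).1, hs.2]
    have e2 : ∫ s in a..ρ t₀, b s = 0 := by
      rw [intervalIntegral.integral_congr (g := fun _ => 0)]
      · simp
      · intro s hs
        rw [uIcc_of_le (haρ t₀ ht₀)] at hs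
        by_contra h0
        linarith [(hbsupp s h0).2, hs.1]
    have e3 := hb3 0
    rw [hstep, hx0, hx1] at e3
    simp only [c, if_true] at e3
    rw [div_mul_cancel₀ _ (by positivity)] at e3
    have hi := fun p q => hbc.intervalIntegrable (μ := MeasureTheory.volume) p q
    rw [← intervalIntegral.integral_add_adjacent_intervals (hi 0 a) (hi a _),
      ← intervalIntegral.integral_add_adjacent_intervals (hi 0 (a / 2)) (hi _ a), e1, e2, e3]
    ring
  refine ⟨fun s => v s + b s, fun r r' => ?_, fun r hr => ?_, ?_, fun s hs t ht => ?_⟩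
  · have h1 := hv1 r r'
    have h2 := hb1 r r'
    have h3 := abs_add_le (v r - v r') (b r - b r')
    rw [show v r + b r - (v r' + b r') = v r - v r' + (b r - b r') by ring]
    linarith
  · have : b r = 0 := by
      by_contra h0
      linarith [(hbsupp r h0).1]
    simp only [hv2 r hr, this, add_zero]
  · rw [intervalIntegral.integral_add (hvc.intervalIntegrable _ _) (hbc.intervalIntegrable _ _),
      hbint, hE]
    ring
  · have : b (ρ s) = 0 := by
      by_contra h0
      linarith [(hbsupp _ h0).2, haρ s hs]
    simp only [this, add_zero]
    exact hv3 s hs t ht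

/-- On a radial piece of the curve, `F` is the primitive of a Hölder continuous function of the
radius up to a remainder `g` that is small of the order required of a function of the angle. -/
theorem exists_radial_part (h : CurveData B α T ρ u ω φ F)
    (hu : ∀ t ∈ T, 1 / 2 ≤ u t) {a : ℝ} (ha : 0 < a) (haρ : ∀ t ∈ T, a ≤ ρ t) {t₀ : ℝ}
    (ht₀ : t₀ ∈ T) (ht₀a : ρ t₀ ≤ 2 * a) (hlow : ∀ t ∈ T, ρ t₀ - ρ t ≤ curveScale α ρ ω t₀) :
    ∃ p : ℝ → ℝ, (∀ r r', |p r - p r'| ≤ 37 * (9648 * B) ^ 8 * |r - r'| ^ α) ∧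
      (∀ r ≤ a / 2, p r = 0) ∧
      ∀ g : ℝ → ℝ, (∀ t, g t = F t - ∫ r in 0..ρ t, p r) →
      (∀ t ∈ T, |g t| ≤ 37 * (9648 * B) ^ 8 * (ρ t ^ α * curveScale α ρ ω t)) ∧
      ∀ s ∈ T, ∀ t ∈ T, ρ s ≤ 2 * ρ t → ρ t ≤ 2 * ρ s →
        |g s - g t| ≤ 37 * (9648 * B) ^ 8 * (curveScale α ρ ω s * |s - t| ^ α) := by
  have hB := h.one_le
  have hα := h.alpha_pos
  have hα1 := h.alpha_le
  have hu0 : ∀ t ∈ T, 0 ≤ u t := fun t ht => by linarith [hu t ht]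
  have hsm := h.strictMonoOn_radius hu0
  obtain ⟨w, hw1, hw2, hw3, hw4⟩ := h.exists_anchored_slope_function hu ha haρ ht₀ ht₀a
  set B' := 9648 * B with hB'
  have hB'1 : 1 ≤ B' := by linarith
  have hBB' : 48 * B ≤ B' := by linarith
  -- On `T` the radius is a coordinate, with inverse `σ`.
  let σ := Function.invFunOn ρ T
  have hσ : ∀ t ∈ T, σ (ρ t) = t := fun t ht => hsm.injOn.leftInvOn_invFunOn ht
  have hX : (ρ '' T).OrdConnected :=
    (h.ordConnected.isPreconnected.image ρ
      fun t ht => (h.hasDerivAt t ht).continuousAt.continuousWithinAt).ordConnected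
  have hwc := continuous_of_holder hα hw1
  obtain ⟨b, hb1, hb2, hb3⟩ := exists_correction (h := fun x => F (σ x))
    (τ := fun x => curveScale α ρ ω (σ x)) (w := w) (x₀ := ρ t₀) hα hα1 hB'1 hX
    (by rintro _ ⟨t, ht, rfl⟩; exact h.pos t ht) ⟨t₀, ht₀, rfl⟩
    (by rintro _ ⟨t, ht, rfl⟩; rw [hσ t ht]; exact h.scale_pos ht)
    (by
      rintro _ ⟨t, ht, rfl⟩
      rw [hσ t ht]
      have := h.pos t ht
      refine (h.scale_le ht).trans ?_
      gcongr
      linarith)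
    (by
      rintro _ ⟨s, hs, rfl⟩ _ ⟨t, ht, rfl⟩ h1 h2
      rw [hσ t ht, hσ s hs]
      have := h.scale_pos ht
      refine (h.scale_le_of_comparable hu0 hs ht h1 h2).trans ?_
      gcongr
      linarith) hw1
    (by
      rintro _ ⟨s, hs, rfl⟩ _ ⟨t, ht, rfl⟩
      rw [hσ t ht, hσ s hs]
      have hτ := h.scale_pos hs
      have h1 : |s - t| ^ α ≤ 2 * |ρ s - ρ t| ^ α :=
        (Real.rpow_le_rpow (abs_nonneg _) (h.abs_sub_le_two_mul hu hs ht) hα.le).trans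
          (const_mul_rpow_le hα1 one_le_two (abs_nonneg _))
      have h0 : 0 ≤ |ρ s - ρ t| ^ α := by positivity
      calc _ ≤ _ := hw4 s hs t ht
        _ ≤ 24 * B * (curveScale α ρ ω s * (2 * |ρ s - ρ t| ^ α) +
            2 * (|ρ s - ρ t| * |ρ s - ρ t| ^ α)) := by
          have : 0 ≤ |ρ s - ρ t| * |ρ s - ρ t| ^ α := by positivity
          refine mul_le_mul_of_nonneg_left (add_le_add ?_ (by linarith)) (by linarith)
          exact mul_le_mul_of_nonneg_left h1 hτ.le
        _ = 48 * B * (curveScale α ρ ω s * |ρ s - ρ t| ^ α + |ρ s - ρ t| * |ρ s - ρ t| ^ α) := by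
          ring
        _ ≤ _ := by gcongr)
    (by
      rintro _ ⟨t, ht, rfl⟩ -
      rw [hσ t₀ ht₀]
      exact ⟨hlow t ht, by linarith [haρ t ht]⟩)
  have hbc := continuous_of_holder hα hb1
  have hpow : B' ^ 7 ≤ B' ^ 8 := pow_le_pow_right₀ hB'1 (by norm_num)
  have hpow1 : B' ≤ B' ^ 8 := le_self_pow₀ hB'1 (by norm_num)
  have hpow0 : 0 < B' ^ 8 := by positivity
  refine ⟨fun s => w s + b s, fun r r' => ?_, fun r hr => ?_, fun g hg => ?_⟩
  · have h1 := hw1 r r'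
    have h2 := hb1 r r'
    have h3 := abs_add_le (w r - w r') (b r - b r')
    have h4 : 0 ≤ |r - r'| ^ α := by positivity
    have h5 : B' * |r - r'| ^ α ≤ B' ^ 8 * |r - r'| ^ α := by gcongr
    have h6 : 36 * B' ^ 7 * |r - r'| ^ α ≤ 36 * B' ^ 8 * |r - r'| ^ α := by gcongr
    rw [show w r + b r - (w r' + b r') = w r - w r' + (b r - b r') by ring]
    linarith
  · simp only [hw2 r hr, hb2 r (by linarith [haρ t₀ ht₀]), add_zero]
  · have hi := fun p q => (hwc.add hbc).intervalIntegrable (μ := MeasureTheory.volume) p q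
    have hint0 : ∫ s in 0..ρ t₀, (w s + b s) = F t₀ := by
      rw [← hw3]
      refine intervalIntegral.integral_congr fun s hs => ?_
      rw [uIcc_of_le (h.pos t₀ ht₀).le] at hs
      simp only [hb2 s hs.2, add_zero]
    obtain ⟨k1, k2⟩ := hb3 (fun x => F (σ x) - F (σ (ρ t₀)) - ∫ s in ρ t₀..x, (w s + b s))
      fun x => rfl
    have hgeq : ∀ t ∈ T, F (σ (ρ t)) - F (σ (ρ t₀)) - (∫ s in ρ t₀..ρ t, (w s + b s)) = g t := by
      intro t ht
      have := intervalIntegral.integral_add_adjacent_intervals (hi 0 (ρ t₀)) (hi (ρ t₀) (ρ t))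
      simp only [Pi.add_apply] at this
      rw [hg, hσ t ht, hσ t₀ ht₀, ← this, hint0]
      ring
    refine ⟨fun t ht => ?_, fun s hs t ht h1 h2 => ?_⟩
    · have h1 := k1 (ρ t) ⟨t, ht, rfl⟩
      beta_reduce at h1
      rw [hgeq t ht, hσ t ht] at h1
      have hτ := h.scale_pos ht
      have hρ := h.pos t ht
      have h2 : curveScale α ρ ω t ^ α ≤ B * ρ t ^ α :=
        (Real.rpow_le_rpow hτ.le (h.scale_le ht) hα.le).trans
          (const_mul_rpow_le hα1 hB hρ.le)
      calc |g t| ≤ 36 * B' ^ 7 * (curveScale α ρ ω t * (B * ρ t ^ α)) := by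
            refine h1.trans ?_
            gcongr
        _ = 36 * B' ^ 7 * B * (ρ t ^ α * curveScale α ρ ω t) := by ring
        _ ≤ 37 * B' ^ 8 * (ρ t ^ α * curveScale α ρ ω t) := by
            have k3 : B' ^ 7 * B ≤ B' ^ 7 * B' := by gcongr; linarith
            have k4 : B' ^ 7 * B' = B' ^ 8 := by ring
            exact mul_le_mul_of_nonneg_right (by linarith) (by positivity)
    · have h3 := k2 (ρ s) ⟨s, hs, rfl⟩ (ρ t) ⟨t, ht, rfl⟩ h1 h2
      beta_reduce at h3
      rw [hgeq s hs, hgeq t ht, hσ s hs] at h3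
      have hτ := h.scale_pos hs
      have h4 : |ρ s - ρ t| ^ α ≤ |s - t| ^ α :=
        Real.rpow_le_rpow (abs_nonneg _) (h.abs_radius_sub_le hs ht) hα.le
      refine h3.trans ?_
      gcongr
      linarith

end CurveData

/-! ### The angular part of the construction -/

/-- A Lipschitz bump supported in `[1 / 2, 1]`, of mean one on `[0, 1]`. -/
noncomputable def bump (x : ℝ) : ℝ := parabola (1 / 2) 1 2 (max (1 / 2) (min 1 x))

theorem bump_eq_zero {x : ℝ} (hx : x ≤ 1 / 2 ∨ 1 ≤ x) : bump x = 0 := by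
  unfold bump
  rcases hx with hx | hx
  · rw [min_eq_right (by linarith), max_eq_left hx, parabola_left]
  · rw [min_eq_left hx, max_eq_right (by norm_num), parabola_right]

theorem clamp_mem (x : ℝ) : max (1 / 2) (min 1 x) ∈ Icc (1 / 2 : ℝ) 1 :=
  ⟨le_max_left _ _, max_le (by norm_num) (min_le_left _ _)⟩

theorem abs_bump_le (x : ℝ) : |bump x| ≤ 4 := by
  have := abs_parabola_le (c := 2) (by norm_num) (clamp_mem x)
  unfold bump
  rw [abs_of_pos (by norm_num : (0 : ℝ) < 2)] at this
  linarith

theorem abs_bump_sub_le (x y : ℝ) : |bump x - bump y| ≤ 24 * |x - y| := by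
  have h1 := abs_parabola_sub_le (α := 1) (c := 2) (K := 4) le_rfl (by norm_num)
    (by norm_num) (clamp_mem x) (clamp_mem y)
  rw [Real.rpow_one] at h1
  have h2 : |max (1 / 2) (min 1 x) - max (1 / 2) (min 1 y)| ≤ |x - y| := by
    refine (abs_max_sub_max_le_max _ _ _ _).trans ?_
    rw [sub_self, abs_zero]
    refine max_le (abs_nonneg _) ((abs_min_sub_min_le_max _ _ _ _).trans ?_)
    rw [sub_self, abs_zero]
    exact max_le (abs_nonneg _) le_rfl
  unfold bump
  linarith

theorem integral_bump : ∫ x in (0 : ℝ)..1, bump x = 1 := by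
  have hc : Continuous bump := by
    unfold bump parabola
    fun_prop
  have hi := fun p q => hc.intervalIntegrable (μ := MeasureTheory.volume) p q
  rw [← intervalIntegral.integral_add_adjacent_intervals (hi 0 (1 / 2)) (hi _ 1)]
  have e1 : ∫ x in (0 : ℝ)..1 / 2, bump x = 0 := by
    rw [intervalIntegral.integral_congr (g := fun _ => 0)]
    · simp
    · intro s hs
      rw [uIcc_of_le (by norm_num)] at hs
      exact bump_eq_zero (Or.inl hs.2)
  have e2 : ∫ x in (1 / 2 : ℝ)..1, bump x = ∫ x in (1 / 2 : ℝ)..1, parabola (1 / 2) 1 2 x := by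
    refine intervalIntegral.integral_congr fun s hs => ?_
    rw [uIcc_of_le (by norm_num)] at hs
    unfold bump
    rw [min_eq_right hs.2, max_eq_right hs.1]
  rw [e1, e2, integral_parabola _ (by norm_num)]
  norm_num

/-- The bump rescaled to `[r / 2, r]`, with integral one. -/
noncomputable def kernel (r x : ℝ) : ℝ := bump (x / r) / r

theorem kernel_eq_zero {r x : ℝ} (hr : 0 < r) (hx : x ≤ r / 2 ∨ r ≤ x) : kernel r x = 0 := by
  unfold kernel
  rw [bump_eq_zero, zero_div]
  rcases hx with hx | hx
  · left; rw [div_le_iff₀ hr]; linarith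
  · right; rw [le_div_iff₀ hr]; linarith

theorem abs_kernel_le {r : ℝ} (hr : 0 < r) (x : ℝ) : |kernel r x| ≤ 4 / r := by
  unfold kernel
  rw [abs_div, abs_of_pos hr]
  gcongr
  exact abs_bump_le _

theorem integral_kernel {r : ℝ} (hr : 0 < r) : ∫ x in 0..r, kernel r x = 1 := by
  unfold kernel
  rw [intervalIntegral.integral_div, intervalIntegral.integral_comp_div _ hr.ne', zero_div,
    div_self hr.ne', integral_bump, smul_eq_mul, mul_one, div_self hr.ne']

theorem continuous_kernel (r : ℝ) : Continuous (kernel r) := by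
  unfold kernel bump parabola
  fun_prop

theorem kernel_holder {α r : ℝ} (hα : 0 < α) (hα1 : α ≤ 1) (hr : 0 < r) (x y : ℝ) :
    r * r ^ α * |kernel r x - kernel r y| ≤ 24 * |x - y| ^ α := by
  have hrα : 0 < r ^ α := by positivity
  have h0 : 0 ≤ |x - y| ^ α := by positivity
  rcases le_total |x - y| r with h | h
  · have h1 := mul_rpow_le_mul_rpow hα1 (abs_nonneg (x - y)) h
    have h2 := abs_bump_sub_le (x / r) (y / r)
    unfold kernel
    rw [← sub_div, abs_div, abs_of_pos hr]
    rw [← sub_div, abs_div, abs_of_pos hr] at h2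
    calc r * r ^ α * (|bump (x / r) - bump (y / r)| / r)
        = r ^ α * |bump (x / r) - bump (y / r)| := by field_simp
      _ ≤ r ^ α * (24 * (|x - y| / r)) := by gcongr
      _ = 24 * (|x - y| * r ^ α) / r := by ring
      _ ≤ 24 * (r * |x - y| ^ α) / r := by gcongr
      _ = _ := by field_simp
  · have h1 : r ^ α ≤ |x - y| ^ α := Real.rpow_le_rpow hr.le h hα.le
    have h2 := abs_sub (kernel r x) (kernel r y)
    have h3 := abs_kernel_le hr x
    have h4 := abs_kernel_le hr y
    calc r * r ^ α * |kernel r x - kernel r y| ≤ r * |x - y| ^ α * (8 / r) := by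
          have : (8 : ℝ) / r = 4 / r + 4 / r := by ring
          gcongr
          linarith
      _ = 8 * |x - y| ^ α := by field_simp
      _ ≤ _ := by linarith

theorem abs_kernel_sub_le {r r' x : ℝ} (hr : 0 < r) (hr' : 0 < r') (h1 : r ≤ 2 * r')
    (h2 : r' ≤ 2 * r) (hx : 0 ≤ x) : |kernel r x - kernel r' x| ≤ 104 * |r - r'| / r ^ 2 := by
  by_cases hx2 : r ≤ x ∧ r' ≤ x
  · rw [kernel_eq_zero hr (Or.inr hx2.1), kernel_eq_zero hr' (Or.inr hx2.2), sub_self, abs_zero]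
    positivity
  have hx3 : x ≤ 2 * r := by
    by_contra hcon
    exact hx2 ⟨by linarith, by linarith⟩
  have e : kernel r x - kernel r' x =
      (bump (x / r) - bump (x / r')) / r + bump (x / r') * ((r' - r) / (r * r')) := by
    unfold kernel
    field_simp
    ring
  have hA := abs_bump_sub_le (x / r) (x / r')
  have e2 : x / r - x / r' = x * (r' - r) / (r * r') := by field_simp
  rw [e2, abs_div, abs_mul, abs_of_nonneg hx, abs_sub_comm r', abs_of_pos (mul_pos hr hr')] at hA
  have hB := abs_bump_le (x / r')
  have h3 : 1 / (r * r') ≤ 2 / r ^ 2 := by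
    rw [div_le_div_iff₀ (by positivity) (by positivity)]
    nlinarith
  rw [e]
  refine (abs_add_le _ _).trans ?_
  rw [abs_div, abs_mul, abs_div, abs_of_pos hr, abs_of_pos (mul_pos hr hr'), abs_sub_comm r']
  have h4 : |bump (x / r) - bump (x / r')| / r ≤ 96 * |r - r'| / r ^ 2 := by
    calc |bump (x / r) - bump (x / r')| / r ≤ 24 * (x * |r - r'| / (r * r')) / r := by gcongr
      _ = 24 * (x / r) * |r - r'| * (1 / (r * r')) := by field_simp
      _ ≤ 24 * 2 * |r - r'| * (2 / r ^ 2) := by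
          gcongr
          rw [div_le_iff₀ hr]
          linarith
      _ = _ := by ring
  have h5 : |bump (x / r')| * (|r - r'| / (r * r')) ≤ 8 * |r - r'| / r ^ 2 := by
    calc |bump (x / r')| * (|r - r'| / (r * r')) ≤ 4 * (|r - r'| / (r * r')) := by gcongr
      _ = 4 * |r - r'| * (1 / (r * r')) := by ring
      _ ≤ 4 * |r - r'| * (2 / r ^ 2) := by gcongr
      _ = _ := by ring
  calc _ ≤ _ := add_le_add h4 h5
    _ = _ := by ring

/-- What is left of `F` after subtracting the primitive of a function of the radius. -/
noncomputable def remainder (ρ F p : ℝ → ℝ) (t : ℝ) : ℝ := F t - ∫ r in 0..ρ t, p r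

namespace CurveData

variable {B α : ℝ} {T : Set ℝ} {ρ u ω φ F : ℝ → ℝ}

theorem angular_part_of_comparable (h : CurveData B α T ρ u ω φ F) (hu : ∀ t ∈ T, 0 ≤ u t)
    {C : ℝ} (hC : 0 ≤ C) {g : ℝ → ℝ}
    (hg1 : ∀ t ∈ T, |g t| ≤ C * (ρ t ^ α * curveScale α ρ ω t))
    (hg2 : ∀ s ∈ T, ∀ t ∈ T, ρ s ≤ 2 * ρ t → ρ t ≤ 2 * ρ s →
      |g s - g t| ≤ C * (curveScale α ρ ω s * |s - t| ^ α)) {s t x : ℝ} (hs : s ∈ T) (ht : t ∈ T)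
    (hst : ρ s ≤ 2 * ρ t) (hts : ρ t ≤ 2 * ρ s) (hx : 0 ≤ x) :
    |g s * kernel (ρ s) x - g t * kernel (ρ t) x| ≤ 448 * B * C * (x * |φ s - φ t|) ^ α := by
  have hB := h.one_le
  have hα := h.alpha_pos
  have hα1 := h.alpha_le
  have hs0 := h.pos s hs
  have ht0 := h.pos t ht
  have hω := h.speed_pos s hs
  by_cases hsmall : x ≤ ρ s / 2 ∧ x ≤ ρ t / 2
  · rw [kernel_eq_zero hs0 (Or.inl hsmall.1), kernel_eq_zero ht0 (Or.inl hsmall.2)]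
    simp only [mul_zero, sub_self, abs_zero]
    positivity
  have hx4 : ρ s ≤ 4 * x := by
    by_contra hcon
    exact hsmall ⟨by linarith, by linarith⟩
  have k1 := hg1 s hs
  have k2 := hg2 s hs t ht hst hts
  have k3 := abs_kernel_le ht0 x
  have k4 := abs_kernel_sub_le hs0 ht0 hst hts hx
  have k5 := h.abs_radius_sub_le hs ht
  have k6 := h.speed_mul_le_angle hu hs ht (by linarith) (by linarith)
  have hδ : |ρ s - ρ t| ≤ ρ s := by rw [abs_le]; constructor <;> linarith
  have k7 := mul_rpow_le_mul_rpow hα1 (abs_nonneg (ρ s - ρ t)) hδ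
  have k8 : |ρ s - ρ t| ^ α ≤ |s - t| ^ α := Real.rpow_le_rpow (abs_nonneg _) k5 hα.le
  set W := (ρ s * ω s) ^ α with hW
  have hW0 : 0 ≤ W := by positivity
  have hτ : curveScale α ρ ω s = ρ s * W := rfl
  have hn : 0 ≤ |s - t| ^ α := by positivity
  have first : |g s - g t| * |kernel (ρ t) x| ≤ 8 * C * (W * |s - t| ^ α) := by
    calc |g s - g t| * |kernel (ρ t) x| ≤ C * (ρ s * W * |s - t| ^ α) * (4 / ρ t) := by
          rw [hτ] at k2
          gcongr
      _ = 4 * C * (W * |s - t| ^ α) * (ρ s / ρ t) := by ring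
      _ ≤ 4 * C * (W * |s - t| ^ α) * 2 := by
          gcongr
          rwa [div_le_iff₀ ht0]
      _ = _ := by ring
  have second : |g s| * |kernel (ρ s) x - kernel (ρ t) x| ≤ 104 * C * (W * |s - t| ^ α) := by
    calc |g s| * |kernel (ρ s) x - kernel (ρ t) x|
        ≤ C * (ρ s ^ α * (ρ s * W)) * (104 * |ρ s - ρ t| / ρ s ^ 2) := by
          rw [hτ] at k1
          gcongr
      _ = 104 * C * W * (|ρ s - ρ t| * ρ s ^ α) / ρ s := by field_simp
      _ ≤ 104 * C * W * (ρ s * |s - t| ^ α) / ρ s := by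
          gcongr 104 * C * W * ?_ / ρ s
          exact k7.trans (mul_le_mul_of_nonneg_left k8 hs0.le)
      _ = _ := by field_simp
  have third : W * |s - t| ^ α ≤ 4 * B * (x * |φ s - φ t|) ^ α := by
    rw [hW, ← Real.mul_rpow (by positivity) (abs_nonneg _)]
    refine (Real.rpow_le_rpow (by positivity) ?_ hα.le).trans
      (const_mul_rpow_le hα1 (by linarith) (by positivity))
    calc ρ s * ω s * |s - t| = ρ s * (ω s * |s - t|) := by ring
      _ ≤ 4 * x * (B * |φ s - φ t|) := by gcongr
      _ = _ := by ring
  have e : g s * kernel (ρ s) x - g t * kernel (ρ t) x =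
      (g s - g t) * kernel (ρ t) x + g s * (kernel (ρ s) x - kernel (ρ t) x) := by ring
  rw [e]
  refine (abs_add_le _ _).trans ?_
  rw [abs_mul, abs_mul]
  have := mul_le_mul_of_nonneg_left third hC
  linarith

/-- The function `g(t) kernel (ρ t) x` on the ray through the point `t` of the curve is Hölder
continuous with respect to the angle. Rays through points with incomparable radii are compared by
means of an intermediate ray on which the function vanishes at the given radius `x`. -/
theorem angular_part (h : CurveData B α T ρ u ω φ F) (hu : ∀ t ∈ T, 0 ≤ u t)
    {C : ℝ} (hC : 0 ≤ C) {g : ℝ → ℝ}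
    (hg1 : ∀ t ∈ T, |g t| ≤ C * (ρ t ^ α * curveScale α ρ ω t))
    (hg2 : ∀ s ∈ T, ∀ t ∈ T, ρ s ≤ 2 * ρ t → ρ t ≤ 2 * ρ s →
      |g s - g t| ≤ C * (curveScale α ρ ω s * |s - t| ^ α)) {s t x : ℝ} (hs : s ∈ T) (ht : t ∈ T)
    (hx : 0 ≤ x) :
    |g s * kernel (ρ s) x - g t * kernel (ρ t) x| ≤ 896 * B * C * (x * |φ s - φ t|) ^ α := by
  have hB := h.one_le
  have hα := h.alpha_pos
  have hsm := h.strictMonoOn_radius hu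
  have hφ := h.strictMonoOn_angle.monotoneOn
  have key : ∀ s ∈ T, ∀ t ∈ T, 2 * ρ s < ρ t →
      |g s * kernel (ρ s) x| ≤ 448 * B * C * (x * |φ s - φ t|) ^ α ∧
      |g t * kernel (ρ t) x| ≤ 448 * B * C * (x * |φ s - φ t|) ^ α := by
    intro s hs t ht hlt
    have hs0 := h.pos s hs
    have ht0 := h.pos t ht
    have hst : s < t := by
      by_contra hcon
      have := hsm.monotoneOn ht hs (not_lt.1 hcon)
      linarith
    have hsub : Icc s t ⊆ T := h.ordConnected.out hs ht
    have hcont : ContinuousOn ρ (Icc s t) := fun z hz =>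
      (h.hasDerivAt z (hsub hz)).continuousAt.continuousWithinAt
    have hle : ∀ a b, s ≤ a → a ≤ b → b ≤ t → a ∈ T → b ∈ T →
        448 * B * C * (x * |φ a - φ b|) ^ α ≤ 448 * B * C * (x * |φ s - φ t|) ^ α := by
      intro a b h1 h2 h3 ha hb
      have e1 := hφ hs ha h1
      have e2 := hφ ha hb h2
      have e3 := hφ hb ht h3
      have : |φ a - φ b| ≤ |φ s - φ t| := by
        rw [abs_of_nonpos (by linarith), abs_of_nonpos (by linarith)]
        linarith
      gcongr
    constructor
    · obtain ⟨z, hz, hρz⟩ := intermediate_value_Icc hst.le hcont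
        (show 2 * ρ s ∈ Icc (ρ s) (ρ t) from ⟨by linarith, hlt.le⟩)
      have hzT := hsub hz
      rcases le_total (ρ s) x with hsx | hsx
      · rw [kernel_eq_zero hs0 (Or.inr hsx), mul_zero, abs_zero]
        positivity
      have k := h.angular_part_of_comparable hu hC hg1 hg2 hs hzT (by linarith) (by linarith) hx
      rw [kernel_eq_zero (h.pos z hzT) (Or.inl (by linarith)), mul_zero, sub_zero] at k
      exact k.trans (hle s z le_rfl hz.1 hz.2 hs hzT)
    · obtain ⟨z, hz, hρz⟩ := intermediate_value_Icc hst.le hcont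
        (show ρ t / 2 ∈ Icc (ρ s) (ρ t) from ⟨by linarith, by linarith⟩)
      have hzT := hsub hz
      rcases le_total x (ρ t / 2) with htx | htx
      · rw [kernel_eq_zero ht0 (Or.inl htx), mul_zero, abs_zero]
        positivity
      have k := h.angular_part_of_comparable hu hC hg1 hg2 hzT ht (by linarith) (by linarith) hx
      rw [kernel_eq_zero (h.pos z hzT) (Or.inr (by linarith)), mul_zero, zero_sub, abs_neg] at k
      exact k.trans (hle z t hz.1 hz.2 le_rfl hzT ht)
  have hP : 0 ≤ 448 * B * C * (x * |φ s - φ t|) ^ α := by positivity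
  rcases lt_or_ge (2 * ρ s) (ρ t) with h1 | h1
  · have := key s hs t ht h1
    have h3 := abs_sub (g s * kernel (ρ s) x) (g t * kernel (ρ t) x)
    linarith [this.1, this.2]
  rcases lt_or_ge (2 * ρ t) (ρ s) with h2 | h2
  · have := key t ht s hs h2
    rw [abs_sub_comm (φ t)] at this
    have h3 := abs_sub (g s * kernel (ρ s) x) (g t * kernel (ρ t) x)
    linarith [this.1, this.2]
  · have := h.angular_part_of_comparable hu hC hg1 hg2 hs ht h2 h1 hx
    linarith

/-- Where the curve is not nearly radial, the remainder is of the required order for every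
Hölder continuous `p`. -/
theorem remainder_le_of_speed (h : CurveData B α T ρ u ω φ F) (hu : ∀ t ∈ T, 0 ≤ u t)
    {D L : ℝ} (hD : 1 ≤ D) (hω : ∀ t ∈ T, 1 ≤ D * (ρ t * ω t)) {p : ℝ → ℝ}
    (hp : ∀ r r', |p r - p r'| ≤ L * |r - r'| ^ α) (hp0 : p 0 = 0) (hL : 0 ≤ L) :
    (∀ t ∈ T, |remainder ρ F p t| ≤ (4 * B + 2 * L) * D * (ρ t ^ α * curveScale α ρ ω t)) ∧
    ∀ s ∈ T, ∀ t ∈ T, ρ s ≤ 2 * ρ t → ρ t ≤ 2 * ρ s →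
      |remainder ρ F p s - remainder ρ F p t| ≤
        (4 * B + 2 * L) * D * (curveScale α ρ ω s * |s - t| ^ α) := by
  have hB := h.one_le
  have hα := h.alpha_pos
  have hα1 := h.alpha_le
  have hpc := continuous_of_holder hα hp
  have hτ : ∀ t ∈ T, ρ t ≤ D * curveScale α ρ ω t := fun t ht => by
    have h0 := h.pos t ht
    have h1 := h.speed_pos t ht
    have h2 : 1 ≤ D * (ρ t * ω t) ^ α := by
      refine le_trans ?_ (const_mul_rpow_le hα1 hD (by positivity))
      exact Real.one_le_rpow (hω t ht) hα.le
    unfold curveScale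
    nlinarith
  have hpabs : ∀ r, 0 ≤ r → |p r| ≤ L * r ^ α := fun r hr => by
    have := hp r 0
    rwa [hp0, sub_zero, sub_zero, abs_of_nonneg hr] at this
  constructor
  · intro t ht
    have h0 := h.pos t ht
    have h1 := h.value_le t ht
    have h2 := intervalIntegral.norm_integral_le_of_norm_le_const (a := 0) (b := ρ t)
      (f := p) (C := L * ρ t ^ α) (fun r hr => by
        rw [uIoc_of_le h0.le] at hr
        rw [Real.norm_eq_abs]
        refine (hpabs r hr.1.le).trans ?_
        have := Real.rpow_le_rpow hr.1.le hr.2 hα.le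
        gcongr)
    rw [Real.norm_eq_abs, sub_zero, abs_of_pos h0] at h2
    have h3 := abs_sub (F t) (∫ r in 0..ρ t, p r)
    have h4 := hτ t ht
    have h5 : 0 ≤ ρ t ^ α := by positivity
    calc |remainder ρ F p t| ≤ (B + L) * (ρ t ^ α * ρ t) := by
          unfold remainder
          linarith
      _ ≤ (B + L) * (ρ t ^ α * (D * curveScale α ρ ω t)) := by gcongr
      _ = (B + L) * (D * (ρ t ^ α * curveScale α ρ ω t)) := by ring
      _ ≤ (4 * B + 2 * L) * (D * (ρ t ^ α * curveScale α ρ ω t)) := by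
          have := h.scale_pos ht
          gcongr <;> linarith
      _ = _ := by ring
  · intro s hs t ht hst hts
    have hs0 := h.pos s hs
    have ht0 := h.pos t ht
    have k1 := h.value_sub_le_of_comparable hu hs ht (by linarith) (by linarith)
    have k5 := h.abs_radius_sub_le hs ht
    have hδ : |ρ s - ρ t| ≤ ρ s := by rw [abs_le]; constructor <;> linarith
    have k7 := mul_rpow_le_mul_rpow hα1 (abs_nonneg (ρ s - ρ t)) hδ
    have k8 : |ρ s - ρ t| ^ α ≤ |s - t| ^ α := Real.rpow_le_rpow (abs_nonneg _) k5 hα.le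
    have hn : 0 ≤ |s - t| ^ α := by positivity
    have hτs := h.scale_pos hs
    have k9 : ρ s ^ α * |ρ s - ρ t| ≤ D * (curveScale α ρ ω s * |s - t| ^ α) := by
      calc ρ s ^ α * |ρ s - ρ t| = |ρ s - ρ t| * ρ s ^ α := by ring
        _ ≤ ρ s * |ρ s - ρ t| ^ α := k7
        _ ≤ (D * curveScale α ρ ω s) * |s - t| ^ α := by
            have := hτ s hs
            gcongr
        _ = _ := by ring
    have k10 : |∫ r in ρ t..ρ s, p r| ≤ 2 * L * (ρ s ^ α * |ρ s - ρ t|) := by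
      have := intervalIntegral.norm_integral_le_of_norm_le_const (a := ρ t) (b := ρ s)
        (f := p) (C := L * (2 * ρ s ^ α)) (fun r hr => by
          rw [Real.norm_eq_abs]
          have hr0 : 0 ≤ r ∧ r ≤ 2 * ρ s := by
            rcases mem_uIcc.1 (uIoc_subset_uIcc hr) with hh | hh <;>
            constructor <;> linarith [hh.1, hh.2]
          refine (hpabs r hr0.1).trans (mul_le_mul_of_nonneg_left ?_ hL)
          exact (Real.rpow_le_rpow hr0.1 hr0.2 hα.le).trans
            (const_mul_rpow_le hα1 one_le_two hs0.le))
      rw [Real.norm_eq_abs] at this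
      linarith
    have e : remainder ρ F p s - remainder ρ F p t = (F s - F t) - ∫ r in ρ t..ρ s, p r := by
      unfold remainder
      rw [← intervalIntegral.integral_interval_sub_left (hpc.intervalIntegrable 0 (ρ s))
        (hpc.intervalIntegrable 0 (ρ t))]
      ring
    rw [e]
    have k11 := abs_sub (F s - F t) (∫ r in ρ t..ρ s, p r)
    set Q := curveScale α ρ ω s * |s - t| ^ α
    have hQ : 0 ≤ Q := by positivity
    have k12 : (2 * B + 2 * L) * (ρ s ^ α * |ρ s - ρ t|) ≤ (2 * B + 2 * L) * (D * Q) := by gcongr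
    have k13 : B * Q ≤ B * (D * Q) := by
      gcongr
      nlinarith
    linarith

end CurveData

/-! ### The construction along one half of the curve -/

/-- The Hölder constant of the radial and angular parts along one half of the curve. -/
noncomputable def branchConst (B : ℝ) : ℝ :=
  1792 * B * ((4 * B + 2 * (37 * (9648 * B) ^ 8)) * B ^ 2)

theorem branchConst_pos {B : ℝ} (hB : 1 ≤ B) : 0 < branchConst B := by
  unfold branchConst
  positivity

/-- Along `T`, the function `F` is the primitive of the function `p` of the radius plus a
function of the angle. The function `p` vanishes unless the curve becomes nearly radial, and is
supported at radii beyond the point where this happens. -/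
structure IsRadialPart (C α m : ℝ) (T : Set ℝ) (ρ u φ F p : ℝ → ℝ) : Prop where
  holder : ∀ r r', |p r - p r'| ≤ C * |r - r'| ^ α
  eq_zero : ∀ r ≤ m / 2, p r = 0
  onset : ∀ r, p r ≠ 0 → (∀ t ∈ T, 1 / 2 < u t) ∨ ∃ t₁ ∈ T, u t₁ = 1 / 2 ∧ ρ t₁ < r
  angular : ∀ s ∈ T, ∀ t ∈ T, ∀ x, 0 ≤ x →
    |remainder ρ F p s * kernel (ρ s) x - remainder ρ F p t * kernel (ρ t) x| ≤
      C * (x * |φ s - φ t|) ^ α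
  angular_radius : ∀ t ∈ T, ∀ x y,
    |remainder ρ F p t * kernel (ρ t) x - remainder ρ F p t * kernel (ρ t) y| ≤ C * |x - y| ^ α

namespace CurveData

variable {B α : ℝ} {T : Set ℝ} {ρ u ω φ F : ℝ → ℝ}

theorem angular_part_holder_radius (h : CurveData B α T ρ u ω φ F) {C : ℝ} (hC : 0 ≤ C)
    {g : ℝ → ℝ} {t : ℝ} (ht : t ∈ T) (hg : |g t| ≤ C * (ρ t ^ α * curveScale α ρ ω t)) (x y : ℝ) :
    |g t * kernel (ρ t) x - g t * kernel (ρ t) y| ≤ 24 * B * C * |x - y| ^ α := by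
  have hρ := h.pos t ht
  have hτ := h.scale_le ht
  have hB := h.one_le
  rw [← mul_sub, abs_mul]
  calc |g t| * |kernel (ρ t) x - kernel (ρ t) y|
      ≤ C * (ρ t ^ α * (B * ρ t)) * |kernel (ρ t) x - kernel (ρ t) y| := by
        refine mul_le_mul_of_nonneg_right (hg.trans ?_) (abs_nonneg _)
        gcongr
    _ = C * B * (ρ t * ρ t ^ α * |kernel (ρ t) x - kernel (ρ t) y|) := by ring
    _ ≤ C * B * (24 * |x - y| ^ α) := by
        have := kernel_holder h.alpha_pos h.alpha_le hρ x y
        gcongr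
    _ = _ := by ring

/-- Hölder continuity with respect to the angle passes from two adjacent pieces of the curve to
their union. -/
theorem angular_holder_union (h : CurveData B α T ρ u ω φ F) {C : ℝ} (hC : 0 ≤ C)
    {q : ℝ → ℝ → ℝ} {t₂ : ℝ} (ht₂ : t₂ ∈ T)
    (h1 : ∀ s ∈ T, ∀ t ∈ T, s ≤ t₂ → t ≤ t₂ → ∀ x, 0 ≤ x →
      |q s x - q t x| ≤ C * (x * |φ s - φ t|) ^ α)
    (h2 : ∀ s ∈ T, ∀ t ∈ T, t₂ ≤ s → t₂ ≤ t → ∀ x, 0 ≤ x →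
      |q s x - q t x| ≤ C * (x * |φ s - φ t|) ^ α) :
    ∀ s ∈ T, ∀ t ∈ T, ∀ x, 0 ≤ x → |q s x - q t x| ≤ 2 * C * (x * |φ s - φ t|) ^ α := by
  have hφ := h.strictMonoOn_angle.monotoneOn
  have hα := h.alpha_pos
  have cross : ∀ s ∈ T, ∀ t ∈ T, s ≤ t₂ → t₂ ≤ t → ∀ x, 0 ≤ x →
      |q s x - q t x| ≤ 2 * C * (x * |φ s - φ t|) ^ α := by
    intro s hs t ht hs2 ht2 x hx
    have k1 := h1 s hs t₂ ht₂ hs2 le_rfl x hx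
    have k2 := h2 t₂ ht₂ t ht le_rfl ht2 x hx
    have e1 := hφ hs ht₂ hs2
    have e2 := hφ ht₂ ht ht2
    have a1 : |φ s - φ t₂| ≤ |φ s - φ t| := by
      rw [abs_of_nonpos (by linarith), abs_of_nonpos (by linarith)]; linarith
    have a2 : |φ t₂ - φ t| ≤ |φ s - φ t| := by
      rw [abs_of_nonpos (by linarith), abs_of_nonpos (by linarith)]; linarith
    have b1 : C * (x * |φ s - φ t₂|) ^ α ≤ C * (x * |φ s - φ t|) ^ α := by gcongr
    have b2 : C * (x * |φ t₂ - φ t|) ^ α ≤ C * (x * |φ s - φ t|) ^ α := by gcongr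
    have := abs_sub_le (q s x) (q t₂ x) (q t x)
    linarith
  intro s hs t ht x hx
  have hP : 0 ≤ C * (x * |φ s - φ t|) ^ α := by positivity
  rcases le_total s t₂ with hs2 | hs2 <;> rcases le_total t t₂ with ht2 | ht2
  · linarith [h1 s hs t ht hs2 ht2 x hx]
  · exact cross s hs t ht hs2 ht2 x hx
  · rw [abs_sub_comm, abs_sub_comm (φ s)]
    exact cross t ht s hs ht2 hs2 x hx
  · linarith [h2 s hs t ht hs2 ht2 x hx]

/-- The half of the curve along which the radius increases admits a radial part. -/
theorem exists_branch (h : CurveData B α T ρ u ω φ F) (hu : ∀ t ∈ T, 0 ≤ u t) {m : ℝ} (hm : 0 < m)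
    (hmρ : ∀ t ∈ T, m ≤ ρ t) (hinf : ∀ η > 0, ∃ t ∈ T, ρ t < m + η) :
    ∃ p : ℝ → ℝ, IsRadialPart (branchConst B) α m T ρ u φ F p := by
  have hB := h.one_le
  have hα := h.alpha_pos
  have hα1 := h.alpha_le
  have hsm := h.strictMonoOn_radius hu
  set K := 37 * (9648 * B) ^ 8 with hK
  have hK0 : 0 < K := by positivity
  set K₂ := (4 * B + 2 * K) * B ^ 2 with hK₂
  have hBsq : 1 ≤ B ^ 2 := one_le_pow₀ hB
  have hKK₂ : K ≤ K₂ := by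
    rw [hK₂]
    nlinarith
  have hK₂0 : 0 < K₂ := by positivity
  have hbc : branchConst B = 1792 * B * K₂ := rfl
  have hK₂b : K₂ ≤ branchConst B := by rw [hbc]; nlinarith
  have hBK : 0 < B * K₂ := by positivity
  -- The curve without its radial part.
  have trivialCase : (∀ t ∈ T, 1 ≤ B ^ 2 * (ρ t * ω t)) →
      ∃ p : ℝ → ℝ, IsRadialPart (branchConst B) α m T ρ u φ F p := fun hω => by
    obtain ⟨k1, k2⟩ := h.remainder_le_of_speed hu (p := fun _ => 0) (L := K) hBsq hω
      (fun r r' => by simp only [sub_self, abs_zero]; positivity) rfl hK0.le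
    refine ⟨fun _ => 0, fun r r' => ?_, fun _ _ => rfl, fun r hr => absurd rfl hr,
      fun s hs t ht x hx => ?_, fun t ht x y => ?_⟩
    · simp only [sub_self, abs_zero]
      have := hK₂0.trans_le hK₂b
      positivity
    · refine (h.angular_part hu hK₂0.le k1 k2 hs ht hx).trans ?_
      rw [hbc]
      gcongr ?_ * _
      linarith
    · refine (h.angular_part_holder_radius hK₂0.le ht (k1 t ht) x y).trans ?_
      rw [hbc]
      gcongr ?_ * _
      linarith
  by_cases hall : ∀ t ∈ T, 1 / 2 < u t
  · -- The curve is nearly radial from the start, which is an end of `T`.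
    obtain ⟨t', ht', hρt'⟩ := hinf m hm
    have hω' := h.speed_pos t' ht'
    set η := m * ((m * ω t') ^ α / B) with hη
    have hη0 : 0 < η := by positivity
    have hτη : ∀ t ∈ T, ρ t ≤ 2 * m → η ≤ curveScale α ρ ω t := by
      intro t ht htm
      have hωt := h.speed_pos t ht
      have k1 := h.speed_le_of_comparable hu ht' ht (by linarith [hmρ t ht])
        (by linarith [hmρ t' ht'])
      have k2 : (m * ω t') ^ α ≤ B * (ρ t * ω t) ^ α := by
        refine (Real.rpow_le_rpow (by positivity) ?_ hα.le).trans
          (const_mul_rpow_le hα1 hB (mul_pos (h.pos t ht) hωt).le)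
        calc m * ω t' ≤ ρ t * (B * ω t) := by
              have := hmρ t ht
              have := h.pos t ht
              gcongr
          _ = _ := by ring
      unfold curveScale
      have k3 : (m * ω t') ^ α / B ≤ (ρ t * ω t) ^ α := by rwa [div_le_iff₀' (by linarith)]
      rw [hη]
      have := hmρ t ht
      have := h.pos t ht
      gcongr
    obtain ⟨t₀, ht₀, hρt₀⟩ := hinf (min m η) (lt_min hm hη0)
    have h2m : ρ t₀ ≤ 2 * m := by linarith [min_le_left m η]
    obtain ⟨p, hp1, hp2, hp3⟩ := h.exists_radial_part (fun t ht => (hall t ht).le) hm hmρ ht₀ h2m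
      (fun t ht => by linarith [hτη t₀ ht₀ h2m, hmρ t ht, min_le_right m η])
    obtain ⟨k1, k2⟩ := hp3 (remainder ρ F p) fun t => rfl
    refine ⟨p, fun r r' => (hp1 r r').trans ?_, hp2, fun r _ => Or.inl hall,
      fun s hs t ht x hx => ?_, fun t ht x y => ?_⟩
    · rw [← hK]
      gcongr
      linarith
    · refine (h.angular_part hu hK0.le k1 k2 hs ht hx).trans ?_
      rw [hbc]
      have : B * K ≤ B * K₂ := by gcongr
      gcongr ?_ * _
      linarith
    · refine (h.angular_part_holder_radius hK0.le ht (k1 t ht) x y).trans ?_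
      rw [hbc]
      have : B * K ≤ B * K₂ := by gcongr
      gcongr ?_ * _
      linarith
  push Not at hall
  obtain ⟨t', ht', hut'⟩ := hall
  have hslow : ∀ t ∈ T, u t ≤ 1 / 2 → 1 ≤ B ^ 2 * (ρ t * ω t) := by
    intro t ht hut
    have h1 := h.le_speed t ht (by rw [abs_of_nonneg (hu t ht)]; exact hut)
    have h2 := mul_pos (h.pos t ht) (h.speed_pos t ht)
    nlinarith
  by_cases hex : ∃ t ∈ T, 1 / 2 < u t
  swap
  · push Not at hex
    exact trivialCase fun t ht => hslow t ht (hex t ht)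
  obtain ⟨t'', ht'', hut''⟩ := hex
  have hlt : t' < t'' := by
    by_contra hcon
    have := h.strictMono.monotoneOn ht'' ht' (not_lt.1 hcon)
    linarith
  obtain ⟨t₁, ht₁, hut₁⟩ := intermediate_value_Icc hlt.le
    (h.continuousOn.mono (h.ordConnected.out ht' ht'')) ⟨hut', hut''.le⟩
  have ht₁ : t₁ ∈ T := h.ordConnected.out ht' ht'' ht₁
  have hρ₁ := h.pos t₁ ht₁
  have hω₁ : 1 ≤ B * (ρ t₁ * ω t₁) :=
    h.le_speed t₁ ht₁ (by rw [hut₁]; norm_num [abs_of_pos])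
  have heasy : ∀ t ∈ T, ρ t ≤ 2 * ρ t₁ → 1 ≤ B ^ 2 * (ρ t * ω t) := by
    intro t ht hρt
    rcases le_total t t₁ with hle | hle
    · exact hslow t ht (hut₁ ▸ h.strictMono.monotoneOn ht ht₁ hle)
    · have h1 := hsm.monotoneOn ht₁ ht hle
      have h2 := h.speed_le_of_comparable hu ht₁ ht (by linarith) (by linarith)
      have h3 := h.speed_pos t ht
      have h4 := h.speed_pos t₁ ht₁
      have h5 := h.pos t ht
      calc 1 ≤ B * (ρ t₁ * ω t₁) := hω₁
        _ ≤ B * (ρ t * (B * ω t)) := by gcongr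
        _ = _ := by ring
  by_cases hex2 : ∃ t ∈ T, 2 * ρ t₁ < ρ t
  swap
  · push Not at hex2
    exact trivialCase fun t ht => heasy t ht (hex2 t ht)
  -- The radial part starts at the radius `ρ t₁`, and is in full effect from `2 ρ t₁ = ρ t₂` on.
  obtain ⟨t₃, ht₃, hρt₃⟩ := hex2
  have h13 : t₁ < t₃ := by
    by_contra hcon
    have := hsm.monotoneOn ht₃ ht₁ (not_lt.1 hcon)
    linarith
  obtain ⟨t₂, ht₂', hρt₂⟩ := intermediate_value_Icc h13.le
    (fun z hz => (h.hasDerivAt z (h.ordConnected.out ht₁ ht₃ hz)).continuousAt.continuousWithinAt)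
    (show 2 * ρ t₁ ∈ Icc (ρ t₁) (ρ t₃) from ⟨by linarith, hρt₃.le⟩)
  have ht₂ : t₂ ∈ T := h.ordConnected.out ht₁ ht₃ ht₂'
  have hS : CurveData B α (T ∩ Ici t₂) ρ u ω φ F :=
    h.mono inter_subset_left (h.ordConnected.inter ordConnected_Ici)
  have hS' : CurveData B α (T ∩ Iic t₂) ρ u ω φ F :=
    h.mono inter_subset_left (h.ordConnected.inter ordConnected_Iic)
  have huS : ∀ t ∈ T ∩ Ici t₂, 0 ≤ u t := fun t ht => hu t ht.1
  have huS' : ∀ t ∈ T ∩ Iic t₂, 0 ≤ u t := fun t ht => hu t ht.1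
  have haρ : ∀ t ∈ T ∩ Ici t₂, 2 * ρ t₁ ≤ ρ t := fun t ht =>
    hρt₂ ▸ hsm.monotoneOn ht₂ ht.1 ht.2
  obtain ⟨p, hp1, hp2, hp3⟩ := hS.exists_radial_part (a := 2 * ρ t₁) (t₀ := t₂)
    (fun t ht => hut₁ ▸ h.strictMono.monotoneOn ht₁ ht.1 (ht₂'.1.trans ht.2)) (by linarith) haρ
    ⟨ht₂, le_refl t₂⟩ (by linarith) (fun t ht => by
      linarith [haρ t ht, h.scale_pos ht₂])
  obtain ⟨k1, k2⟩ := hp3 (remainder ρ F p) fun t => rfl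
  rw [mul_div_cancel_left₀ _ (two_ne_zero' ℝ)] at hp2
  obtain ⟨k3, k4⟩ := hS'.remainder_le_of_speed huS' hBsq
    (fun t ht => heasy t ht.1 (hρt₂ ▸ hsm.monotoneOn ht.1 ht₂ ht.2)) hp1 (hp2 0 hρ₁.le) hK0.le
  rw [← hK] at k1 k2 k3 k4 hp1
  refine ⟨p, fun r r' => (hp1 r r').trans ?_, fun r hr => hp2 r (by linarith [hmρ t₁ ht₁]),
    fun r hr => Or.inr ⟨t₁, ht₁, hut₁, ?_⟩, ?_, fun t ht x y => ?_⟩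
  · gcongr
    linarith
  · by_contra hcon
    exact hr (hp2 r (not_lt.1 hcon))
  · have := h.angular_holder_union (C := 896 * B * K₂) (by positivity)
      (q := fun t x => remainder ρ F p t * kernel (ρ t) x) ht₂
      (fun s hs t ht hs2 ht2 x hx =>
        hS'.angular_part huS' hK₂0.le k3 k4 ⟨hs, hs2⟩ ⟨ht, ht2⟩ hx)
      (fun s hs t ht hs2 ht2 x hx => by
        refine (hS.angular_part huS hK0.le k1 k2 ⟨hs, hs2⟩ ⟨ht, ht2⟩ hx).trans ?_
        gcongr)
    intro s hs t ht x hx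
    refine (this s hs t ht x hx).trans (le_of_eq ?_)
    rw [hbc]
    ring
  · have hfin : ∀ C, C ≤ K₂ → 24 * B * C * |x - y| ^ α ≤ branchConst B * |x - y| ^ α := by
      intro C hC
      rw [hbc]
      have : B * C ≤ B * K₂ := by gcongr
      gcongr ?_ * _
      linarith
    rcases le_total t t₂ with ht2 | ht2
    · exact (hS'.angular_part_holder_radius hK₂0.le ⟨ht, ht2⟩ (k3 t ⟨ht, ht2⟩) x y).trans
        (hfin _ le_rfl)
    · exact (hS.angular_part_holder_radius hK0.le ⟨ht, ht2⟩ (k1 t ⟨ht, ht2⟩) x y).trans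
        (hfin _ hKK₂)

end CurveData

/-! ### Gluing the two halves of the curve -/

/-- A family of functions `P t` on the rays through the points of the curve, Hölder continuous in
the radius and in the angle, whose integrals up to the curve are the values of `F`. -/
structure IsRayFamily (C α m : ℝ) (T : Set ℝ) (ρ φ F : ℝ → ℝ) (P : ℝ → ℝ → ℝ) : Prop where
  radial : ∀ t ∈ T, ∀ x y, |P t x - P t y| ≤ C * |x - y| ^ α
  angular : ∀ s ∈ T, ∀ t ∈ T, ∀ x, 0 ≤ x → |P s x - P t x| ≤ C * (x * |φ s - φ t|) ^ α
  eq_zero : ∀ t ∈ T, ∀ x ≤ m / 2, P t x = 0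
  integral : ∀ t ∈ T, ∫ x in 0..ρ t, P t x = F t

theorem ordConnected_neg {J : Set ℝ} (hJ : J.OrdConnected) : {t : ℝ | -t ∈ J}.OrdConnected :=
  ⟨fun _ hx _ hy _ hz => hJ.out hy hx ⟨neg_le_neg hz.2, neg_le_neg hz.1⟩⟩

/-- A continuous cutoff function of the angle. -/
noncomputable def cutoff (y : ℝ) : ℝ := max 0 (min 1 y)

theorem cutoff_nonneg (y : ℝ) : 0 ≤ cutoff y := le_max_left _ _

theorem cutoff_le_one (y : ℝ) : cutoff y ≤ 1 := max_le zero_le_one (min_le_left _ _)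

theorem cutoff_of_nonpos {y : ℝ} (hy : y ≤ 0) : cutoff y = 0 := by
  unfold cutoff
  rw [min_eq_right (by linarith), max_eq_left hy]

theorem cutoff_of_one_le {y : ℝ} (hy : 1 ≤ y) : cutoff y = 1 := by
  unfold cutoff
  rw [min_eq_left hy, max_eq_right zero_le_one]

theorem abs_cutoff_sub_le {α : ℝ} (hα : 0 < α) (hα1 : α ≤ 1) (x y : ℝ) :
    |cutoff x - cutoff y| ≤ |x - y| ^ α := by
  have h1 : |cutoff x - cutoff y| ≤ |x - y| := by
    refine (abs_max_sub_max_le_max _ _ _ _).trans ?_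
    rw [sub_self, abs_zero]
    refine max_le (abs_nonneg _) ((abs_min_sub_min_le_max _ _ _ _).trans ?_)
    rw [sub_self, abs_zero]
    exact max_le (abs_nonneg _) le_rfl
  rcases le_total |x - y| 1 with h | h
  · exact h1.trans (self_le_rpow hα1 (abs_nonneg _) h)
  · refine le_trans ?_ (Real.one_le_rpow h hα.le)
    rw [abs_le]
    constructor <;> linarith [cutoff_nonneg x, cutoff_nonneg y, cutoff_le_one x, cutoff_le_one y]

theorem cutoff_mul_integral {y R : ℝ} {p : ℝ → ℝ} (hR : 0 ≤ R) (h : ∀ r ≤ R, p r ≠ 0 → 1 ≤ y) :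
    cutoff y * ∫ r in 0..R, p r = ∫ r in 0..R, p r := by
  by_cases hex : ∃ r ≤ R, p r ≠ 0
  · obtain ⟨r, hr, hpr⟩ := hex
    rw [cutoff_of_one_le (h r hr hpr), one_mul]
  · push Not at hex
    rw [intervalIntegral.integral_congr (g := fun _ => 0)]
    · simp
    · intro s hs
      rw [uIcc_of_le hR] at hs
      exact hex s hs.2

theorem integral_add_const_mul_kernel {p : ℝ → ℝ} (hp : Continuous p) {R : ℝ} (hR : 0 < R)
    (c : ℝ) : ∫ x in 0..R, (p x + c * kernel R x) = (∫ x in 0..R, p x) + c := by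
  have hk : IntervalIntegrable (fun x => c * kernel R x) MeasureTheory.volume 0 R :=
    ((continuous_kernel R).intervalIntegrable _ _).const_mul c
  rw [intervalIntegral.integral_add (hp.intervalIntegrable _ _) hk,
    intervalIntegral.integral_const_mul, integral_kernel hR, mul_one]

namespace IsRayFamily

variable {C α m : ℝ} {T : Set ℝ} {ρ φ F : ℝ → ℝ} {P : ℝ → ℝ → ℝ}

theorem reflect
    (h : IsRayFamily C α m {t | -t ∈ T} (fun t => ρ (-t)) (fun t => -φ (-t)) (fun t => F (-t)) P) :
    IsRayFamily C α m T ρ φ F fun t => P (-t) where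
  radial t ht := h.radial (-t) (by simpa using ht)
  angular s hs t ht x hx := by
    have := h.angular (-s) (by simpa using hs) (-t) (by simpa using ht) x hx
    simp only [neg_neg] at this
    rwa [← neg_sub', abs_neg] at this
  eq_zero t ht := h.eq_zero (-t) (by simpa using ht)
  integral t ht := by simpa using h.integral (-t) (by simpa using ht)

end IsRayFamily

namespace CurveData

variable {B α : ℝ} {T : Set ℝ} {ρ u ω φ F : ℝ → ℝ}

theorem reflect (h : CurveData B α T ρ u ω φ F) :
    CurveData B α {t | -t ∈ T} (fun t => ρ (-t)) (fun t => -u (-t)) (fun t => ω (-t))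
      (fun t => -φ (-t)) (fun t => F (-t)) where
  one_le := h.one_le
  alpha_pos := h.alpha_pos
  alpha_le := h.alpha_le
  ordConnected := ordConnected_neg h.ordConnected
  pos t ht := h.pos _ ht
  hasDerivAt t ht := by
    have := (h.hasDerivAt _ ht).comp t (hasDerivAt_neg t)
    simpa [Function.comp_def] using this
  abs_le_one t ht := by rw [abs_neg]; exact h.abs_le_one _ ht
  strictMono s hs t ht hst := neg_lt_neg (h.strictMono ht hs (neg_lt_neg hst))
  continuousOn := (h.continuousOn.comp continuous_neg.continuousOn fun _ ht => ht).neg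
  hasDerivAt_angle t ht := by
    have := ((h.hasDerivAt_angle _ ht).comp t (hasDerivAt_neg t)).fun_neg
    simpa [Function.comp_def] using this
  speed_pos t ht := h.speed_pos _ ht
  speed_le t ht := h.speed_le _ ht
  le_speed t ht hu := h.le_speed _ ht (by rwa [abs_neg] at hu)
  turning s hs t ht hst := by
    have := h.turning _ ht _ hs (neg_le_neg hst)
    linarith
  speed_comparable J hJ hJ' r hr hρ s hs t ht :=
    h.speed_comparable {t | -t ∈ J} (fun x hx => by simpa using hJ hx) (ordConnected_neg hJ') r hr
      (fun x hx => by simpa using hρ _ hx) _ (by simpa using hs) _ (by simpa using ht)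
  value_le t ht := h.value_le _ ht
  slope_le J hJ hJ' r hr hρ s hs t ht hst := by
    have := h.slope_le {t | -t ∈ J} (fun x hx => by simpa using hJ hx) (ordConnected_neg hJ') r hr
      (fun x hx => by simpa using hρ _ hx) _ (by simpa using hs) _ (by simpa using ht) hst
    simp only [dividedDiff, dividedError, curveScale, ← neg_sub', abs_neg] at this ⊢
    exact this
  slope_compare J hJ hJ' r hr hρ d t₁ h1 t₂ h2 t₃ h3 t₄ h4 h12 h34 hd2 hd3 hd4 := by
    have := h.slope_compare {t | -t ∈ J} (fun x hx => by simpa using hJ hx) (ordConnected_neg hJ')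
      r hr (fun x hx => by simpa using hρ _ hx) d _ (by simpa using h1) _ (by simpa using h2)
      _ (by simpa using h3) _ (by simpa using h4) h12 h34 (by rwa [← neg_sub', abs_neg])
      (by rwa [← neg_sub', abs_neg]) (by rwa [← neg_sub', abs_neg])
    simp only [dividedDiff, dividedError, curveScale, ← neg_sub', abs_neg] at this ⊢
    exact this

/-- If the minimum of the radius is not attained, the curve has just one half. -/
theorem exists_rayFamily_of_monotone (h : CurveData B α T ρ u ω φ F) (hu : ∀ t ∈ T, 0 ≤ u t)
    {m : ℝ} (hm : 0 < m) (hmρ : ∀ t ∈ T, m ≤ ρ t) (hinf : ∀ η > 0, ∃ t ∈ T, ρ t < m + η) :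
    ∃ P, IsRayFamily (6 * B * branchConst B) α m T ρ φ F P := by
  obtain ⟨p, hp⟩ := h.exists_branch hu hm hmρ hinf
  have hB := h.one_le
  have hC : 0 < branchConst B := by unfold branchConst; positivity
  have hBC : 2 * branchConst B ≤ 6 * B * branchConst B := by gcongr; linarith
  refine ⟨fun t x => p x + remainder ρ F p t * kernel (ρ t) x, fun t ht x y => ?_,
    fun s hs t ht x hx => ?_, fun t ht x hx => ?_, fun t ht => ?_⟩
  · have h1 := hp.holder x y
    have h2 := hp.angular_radius t ht x y
    have h3 := abs_add_le (p x - p y)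
      (remainder ρ F p t * kernel (ρ t) x - remainder ρ F p t * kernel (ρ t) y)
    rw [add_sub_add_comm]
    refine h3.trans ((add_le_add h1 h2).trans ?_)
    rw [← two_mul, ← mul_assoc]
    gcongr
  · rw [add_sub_add_left_eq_sub]
    refine (hp.angular s hs t ht x hx).trans ?_
    gcongr
    linarith
  · rw [hp.eq_zero x hx, kernel_eq_zero (h.pos t ht) (Or.inl (by linarith [hmρ t ht])), mul_zero,
      add_zero]
  · rw [integral_add_const_mul_kernel (continuous_of_holder h.alpha_pos hp.holder) (h.pos t ht)]
    unfold remainder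
    ring

/-- If the curve starts at its point of minimal radius, it turns by a definite angle before the
radial part sets in. -/
theorem exists_branch_of_start (h : CurveData B α T ρ u ω φ F) (hu : ∀ t ∈ T, 0 ≤ u t) {t₀ : ℝ}
    (ht₀ : t₀ ∈ T) (hut₀ : u t₀ = 0) (hφt₀ : φ t₀ = 0) (hle : ∀ t ∈ T, t₀ ≤ t) :
    ∃ p, IsRadialPart (branchConst B) α (ρ t₀) T ρ u φ F p ∧
      ∀ t ∈ T, ∀ r ≤ ρ t, p r ≠ 0 → 1 ≤ 2 * B * φ t := by
  have hsm := h.strictMonoOn_radius hu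
  have hB := h.one_le
  obtain ⟨p, hp⟩ := h.exists_branch hu (h.pos t₀ ht₀)
    (fun t ht => hsm.monotoneOn ht₀ ht (hle t ht)) fun η hη => ⟨t₀, ht₀, by linarith⟩
  refine ⟨p, hp, fun t ht r hr hpr => ?_⟩
  rcases hp.onset r hpr with h1 | ⟨t₁, ht₁, hut₁, hρt₁⟩
  · linarith [h1 t₀ ht₀]
  · have h1 := h.turning t₀ ht₀ t₁ ht₁ (hle t₁ ht₁)
    have h2 : t₁ ≤ t := (hsm.le_iff_le ht₁ ht).1 (by linarith)
    have h3 := h.strictMonoOn_angle.monotoneOn ht₁ ht h2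
    rw [hut₁, hut₀, hφt₀] at h1
    nlinarith

/-- The case in which the minimum of the radius is attained. The radial parts of the two halves
are separated by means of cutoff functions of the angle. -/
theorem exists_rayFamily_of_min (h : CurveData B α T ρ u ω φ F) {t₀ : ℝ} (ht₀ : t₀ ∈ T)
    (hut₀ : u t₀ = 0) (hφt₀ : φ t₀ = 0) :
    ∃ P, IsRayFamily (6 * B * branchConst B) α (ρ t₀) T ρ φ F P := by
  have hB := h.one_le
  have hα := h.alpha_pos
  have hα1 := h.alpha_le
  have hC : 0 < branchConst B := by unfold branchConst; positivity
  have hφ := h.strictMonoOn_angle.monotoneOn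
  have hR : CurveData B α (T ∩ Ici t₀) ρ u ω φ F :=
    h.mono inter_subset_left (h.ordConnected.inter ordConnected_Ici)
  have hL := (h.mono (inter_subset_left (t := Iic t₀))
    (h.ordConnected.inter ordConnected_Iic)).reflect
  have huR : ∀ t ∈ T ∩ Ici t₀, 0 ≤ u t := fun t ht =>
    hut₀ ▸ h.strictMono.monotoneOn ht₀ ht.1 ht.2
  have huL : ∀ t ∈ {t | -t ∈ T ∩ Iic t₀}, 0 ≤ -u (-t) := fun t ht =>
    neg_nonneg.2 (hut₀ ▸ h.strictMono.monotoneOn ht.1 ht₀ ht.2)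
  obtain ⟨p, hp, hpφ⟩ := hR.exists_branch_of_start huR ⟨ht₀, le_refl t₀⟩ hut₀ hφt₀ fun t ht => ht.2
  obtain ⟨q, hq, hqφ⟩ := hL.exists_branch_of_start huL (t₀ := -t₀) (by simpa using ht₀)
    (by simpa using hut₀) (by simpa using hφt₀) fun t ht => by
      have : -t ≤ t₀ := ht.2
      linarith
  simp only [neg_neg] at hq
  have hneg : ∀ {t}, t ∈ T → t ≤ t₀ → -t ∈ {t | -t ∈ T ∩ Iic t₀} := fun ht ht' => by
    simpa using And.intro ht ht'
  have hmR : ∀ t ∈ T, t₀ ≤ t → ρ t₀ ≤ ρ t := fun t ht ht' =>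
    (hR.strictMonoOn_radius huR).monotoneOn ⟨ht₀, le_refl t₀⟩ ⟨ht, ht'⟩ ht'
  have hmL : ∀ t ∈ T, t ≤ t₀ → ρ t₀ ≤ ρ t := fun t ht ht' => by
    have := (hL.strictMonoOn_radius huL).monotoneOn (hneg ht₀ le_rfl) (hneg ht ht')
      (neg_le_neg ht')
    simpa using this
  have hm : ∀ t ∈ T, ρ t₀ ≤ ρ t := fun t ht => (le_total t₀ t).elim (hmR t ht) (hmL t ht)
  have hpR : ∀ t ∈ T, t₀ ≤ t → ∀ r ≤ ρ t, p r ≠ 0 → 1 ≤ 2 * B * φ t := fun t ht ht' =>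
    hpφ t ⟨ht, ht'⟩
  have hqL : ∀ t ∈ T, t ≤ t₀ → ∀ r ≤ ρ t, q r ≠ 0 → 1 ≤ 2 * B * (-φ t) := fun t ht ht' r hr => by
    have := hqφ (-t) (hneg ht ht') r (by simpa using hr)
    simpa using this
  have hzero : ∀ {f : ℝ → ℝ}, (∀ r ≤ ρ t₀, f r ≠ 0 → 1 ≤ 2 * B * 0) →
      ∫ r in 0..ρ t₀, f r = 0 := fun {f} hf => by
    rw [← cutoff_mul_integral (h.pos t₀ ht₀).le hf, mul_zero, cutoff_of_nonpos le_rfl, zero_mul]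
  have hrem : remainder ρ F p t₀ = remainder ρ F q t₀ := by
    unfold remainder
    rw [hzero (hφt₀ ▸ hpR t₀ ht₀ le_rfl), hzero (by simpa [hφt₀] using hqL t₀ ht₀ le_rfl)]
  set g : ℝ → ℝ := fun t => if t₀ ≤ t then remainder ρ F p t else remainder ρ F q t with hg
  have hgR : ∀ t, t₀ ≤ t → g t = remainder ρ F p t := fun t ht => by simp only [hg, if_pos ht]
  have hgL : ∀ t, t ≤ t₀ → g t = remainder ρ F q t := fun t ht => by
    rcases ht.eq_or_lt with rfl | ht
    · rw [hgR t le_rfl, hrem]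
    · simp only [hg, if_neg (not_le.2 ht)]
  have hgang := h.angular_holder_union hC.le (q := fun t x => g t * kernel (ρ t) x) ht₀
    (fun s hs t ht hs' ht' x hx => by
      have := hq.angular (-s) (hneg hs hs') (-t) (hneg ht ht') x hx
      have e : ∀ t, remainder (fun t => ρ (-t)) (fun t => F (-t)) q (-t) = remainder ρ F q t :=
        fun t => by simp [remainder]
      rw [e, e] at this
      simp only [neg_neg] at this
      rw [← neg_sub', abs_neg] at this
      simpa only [hgL s hs', hgL t ht'] using this)
    (fun s hs t ht hs' ht' x hx => by
      simpa only [hgR s hs', hgR t ht'] using hp.angular s ⟨hs, hs'⟩ t ⟨ht, ht'⟩ x hx)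
  have hgrad : ∀ t ∈ T, ∀ x y,
      |g t * kernel (ρ t) x - g t * kernel (ρ t) y| ≤ branchConst B * |x - y| ^ α := by
    intro t ht x y
    rcases le_total t₀ t with ht' | ht'
    · rw [hgR t ht']
      exact hp.angular_radius t ⟨ht, ht'⟩ x y
    · rw [hgL t ht']
      have := hq.angular_radius (-t) (hneg ht ht') x y
      simpa [remainder] using this
  have hpc := continuous_of_holder hα hp.holder
  have hqc := continuous_of_holder hα hq.holder
  have hρ₀ := h.pos t₀ ht₀
  have hcut : ∀ {f : ℝ → ℝ}, (∀ r r', |f r - f r'| ≤ branchConst B * |r - r'| ^ α) → f 0 = 0 →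
      ∀ θ θ' x, 0 ≤ x → |cutoff (2 * B * θ) * f x - cutoff (2 * B * θ') * f x| ≤
        2 * B * branchConst B * (x * |θ - θ'|) ^ α := by
    intro f hf hf0 θ θ' x hx
    have h1 := abs_cutoff_sub_le hα hα1 (2 * B * θ) (2 * B * θ')
    rw [← mul_sub, abs_mul, abs_of_pos (by linarith : 0 < 2 * B)] at h1
    have h2 := h1.trans (const_mul_rpow_le hα1 (by linarith) (abs_nonneg (θ - θ')))
    have h3 := hf x 0
    rw [hf0, sub_zero, sub_zero, abs_of_nonneg hx] at h3
    rw [← sub_mul, abs_mul, Real.mul_rpow hx (abs_nonneg _)]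
    calc _ ≤ (2 * B * |θ - θ'| ^ α) * (branchConst B * x ^ α) := by gcongr
      _ = _ := by ring
  have hcutr : ∀ {f : ℝ → ℝ}, (∀ r r', |f r - f r'| ≤ branchConst B * |r - r'| ^ α) →
      ∀ θ x y, |cutoff θ * f x - cutoff θ * f y| ≤ branchConst B * |x - y| ^ α := by
    intro f hf θ x y
    rw [← mul_sub, abs_mul, abs_of_nonneg (cutoff_nonneg θ)]
    exact (mul_le_of_le_one_left (abs_nonneg _) (cutoff_le_one θ)).trans (hf x y)
  refine ⟨fun t x => (cutoff (2 * B * φ t) * p x + cutoff (2 * B * (-φ t)) * q x) +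
    g t * kernel (ρ t) x, fun t ht x y => ?_, fun s hs t ht x hx => ?_, fun t ht x hx => ?_,
    fun t ht => ?_⟩
  · have h1 := hcutr hp.holder (2 * B * φ t) x y
    have h2 := hcutr hq.holder (2 * B * (-φ t)) x y
    have h3 := hgrad t ht x y
    rw [add_sub_add_comm, add_sub_add_comm]
    have h4 := abs_add_le (cutoff (2 * B * φ t) * p x - cutoff (2 * B * φ t) * p y +
      (cutoff (2 * B * (-φ t)) * q x - cutoff (2 * B * (-φ t)) * q y))
      (g t * kernel (ρ t) x - g t * kernel (ρ t) y)
    have h5 := abs_add_le (cutoff (2 * B * φ t) * p x - cutoff (2 * B * φ t) * p y)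
      (cutoff (2 * B * (-φ t)) * q x - cutoff (2 * B * (-φ t)) * q y)
    have h6 : 0 ≤ branchConst B * |x - y| ^ α := by positivity
    have h7 : 1 * (branchConst B * |x - y| ^ α) ≤ B * (branchConst B * |x - y| ^ α) := by gcongr
    linarith
  · have h1 := hcut hp.holder (hp.eq_zero 0 (by linarith)) (φ s) (φ t) x hx
    have h2 := hcut hq.holder (hq.eq_zero 0 (by linarith)) (-φ s) (-φ t) x hx
    rw [← neg_sub', abs_neg] at h2
    have h3 := hgang s hs t ht x hx
    rw [add_sub_add_comm, add_sub_add_comm]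
    have h4 := abs_add_le (cutoff (2 * B * φ s) * p x - cutoff (2 * B * φ t) * p x +
      (cutoff (2 * B * (-φ s)) * q x - cutoff (2 * B * (-φ t)) * q x))
      (g s * kernel (ρ s) x - g t * kernel (ρ t) x)
    have h5 := abs_add_le (cutoff (2 * B * φ s) * p x - cutoff (2 * B * φ t) * p x)
      (cutoff (2 * B * (-φ s)) * q x - cutoff (2 * B * (-φ t)) * q x)
    have h6 : 0 ≤ branchConst B * (x * |φ s - φ t|) ^ α := by positivity
    have h7 : 1 * (branchConst B * (x * |φ s - φ t|) ^ α) ≤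
      B * (branchConst B * (x * |φ s - φ t|) ^ α) := by gcongr
    linarith
  · have hk : kernel (ρ t) x = 0 := kernel_eq_zero (h.pos t ht) (Or.inl (by linarith [hm t ht]))
    simp only [hp.eq_zero x hx, hq.eq_zero x hx, hk, mul_zero, add_zero]
  · have hi1 := hpc.intervalIntegrable (μ := MeasureTheory.volume) 0 (ρ t)
    have hi2 := hqc.intervalIntegrable (μ := MeasureTheory.volume) 0 (ρ t)
    have hc : Continuous fun x =>
        cutoff (2 * B * φ t) * p x + cutoff (2 * B * (-φ t)) * q x := by fun_prop
    rw [integral_add_const_mul_kernel hc (h.pos t ht),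
      intervalIntegral.integral_add (hi1.const_mul _) (hi2.const_mul _),
      intervalIntegral.integral_const_mul, intervalIntegral.integral_const_mul]
    rcases le_total t₀ t with ht' | ht'
    · have h1 : 0 ≤ φ t := hφt₀ ▸ hφ ht₀ ht ht'
      rw [cutoff_of_nonpos (by nlinarith : 2 * B * (-φ t) ≤ 0), hgR t ht',
        cutoff_mul_integral (h.pos t ht).le (hpR t ht ht')]
      unfold remainder
      ring
    · have h1 : φ t ≤ 0 := hφt₀ ▸ hφ ht ht₀ ht'
      rw [cutoff_of_nonpos (by nlinarith : 2 * B * φ t ≤ 0), hgL t ht',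
        cutoff_mul_integral (h.pos t ht).le (hqL t ht ht')]
      unfold remainder
      ring

end CurveData

/-! ### From rays to the plane -/

/-- The point with polar coordinates `r` and `θ`. -/
noncomputable def polar (r θ : ℝ) : ℂ := (r : ℂ) * Complex.exp ((θ : ℂ) * Complex.I)

theorem norm_polar (r θ : ℝ) : ‖polar r θ‖ = |r| := by
  unfold polar
  rw [norm_mul, Complex.norm_exp_ofReal_mul_I, mul_one, Complex.norm_real, Real.norm_eq_abs]

theorem sq_norm_polar_sub (r s θ η : ℝ) :
    ‖polar r θ - polar s η‖ ^ 2 = (r - s) ^ 2 + 4 * (r * s) * Real.sin ((θ - η) / 2) ^ 2 := by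
  have hre : ∀ r θ : ℝ, (polar r θ).re = r * Real.cos θ ∧ (polar r θ).im = r * Real.sin θ :=
    fun r θ => by
      unfold polar
      rw [Complex.re_ofReal_mul, Complex.im_ofReal_mul, Complex.exp_ofReal_mul_I_re,
        Complex.exp_ofReal_mul_I_im]
      exact ⟨rfl, rfl⟩
  have h1 : Real.sin ((θ - η) / 2) ^ 2 = (1 - Real.cos (θ - η)) / 2 := by
    have := Real.cos_sq ((θ - η) / 2)
    have h2 := Real.sin_sq_add_cos_sq ((θ - η) / 2)
    rw [mul_div_cancel₀ _ (two_ne_zero' ℝ)] at this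
    linarith
  rw [h1, Complex.sq_norm, Complex.normSq_apply, Complex.sub_re, Complex.sub_im, (hre r θ).1,
    (hre r θ).2, (hre s η).1, (hre s η).2, Real.cos_sub]
  have e1 := Real.sin_sq_add_cos_sq θ
  have e2 := Real.sin_sq_add_cos_sq η
  linear_combination r ^ 2 * e1 + s ^ 2 * e2

theorem abs_le_five_mul_abs_sin {x : ℝ} (hx : |x| ≤ 3 * Real.pi / 4) :
    |x| ≤ 5 * |Real.sin x| := by
  have hpi := Real.pi_pos
  have hpi4 := Real.pi_le_four
  have key : ∀ y, 0 ≤ y → y ≤ 3 * Real.pi / 4 → y ≤ 5 * Real.sin y := by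
    intro y hy hy'
    have hlow : ∀ z, 0 ≤ z → z ≤ Real.pi / 2 → z ≤ 2 * Real.sin z := fun z hz hz' => by
      have := Real.mul_le_sin hz hz'
      have h2 : 1 / 2 ≤ 2 / Real.pi := by
        rw [div_le_div_iff₀ (by norm_num) hpi]; linarith
      nlinarith
    rcases le_total y (Real.pi / 2) with h | h
    · linarith [hlow y hy h]
    · have h1 := Real.mul_le_sin (x := Real.pi - y) (by linarith) (by linarith)
      rw [Real.sin_pi_sub] at h1
      have h2 : 1 / 2 ≤ 2 / Real.pi * (Real.pi - y) := by
        rw [div_mul_eq_mul_div, div_le_div_iff₀ (by norm_num) hpi]; linarith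
      have h3 := Real.pi_lt_d2
      linarith
  rcases le_total 0 x with h | h
  · rw [abs_of_nonneg h] at hx ⊢
    exact (key x h hx).trans (by gcongr; exact le_abs_self _)
  · rw [abs_of_nonpos h] at hx ⊢
    refine (key (-x) (by linarith) hx).trans ?_
    rw [Real.sin_neg]
    gcongr
    exact neg_le_abs _

theorem abs_sub_le_norm_polar_sub {r s : ℝ} (hr : 0 ≤ r) (hs : 0 ≤ s) (θ η : ℝ) :
    |r - s| ≤ ‖polar r θ - polar s η‖ := by
  have := abs_norm_sub_norm_le (polar r θ) (polar s η)
  rwa [norm_polar, norm_polar, abs_of_nonneg hr, abs_of_nonneg hs] at this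

theorem mul_angle_le_norm_polar_sub {r s θ η : ℝ} (hr : 0 ≤ r) (hrs : r ≤ s)
    (hθ : |θ| ≤ 3 * Real.pi / 4) (hη : |η| ≤ 3 * Real.pi / 4) :
    r * |θ - η| ≤ 5 * ‖polar r θ - polar s η‖ := by
  have h1 : |(θ - η) / 2| ≤ 3 * Real.pi / 4 := by
    have := abs_sub θ η
    rw [abs_div, abs_two]
    linarith
  have h2 := abs_le_five_mul_abs_sin h1
  rw [abs_div, abs_two] at h2
  have h3 := sq_norm_polar_sub r s θ η
  refine abs_le_of_sq_le_sq' ?_ (by positivity) |>.2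
  have h4 : |θ - η| ^ 2 ≤ (10 * |Real.sin ((θ - η) / 2)|) ^ 2 := by
    gcongr
    linarith
  rw [mul_pow, mul_pow, sq_abs (Real.sin _)] at *
  have h5 : r ^ 2 * Real.sin ((θ - η) / 2) ^ 2 ≤ r * s * Real.sin ((θ - η) / 2) ^ 2 := by
    gcongr
    nlinarith
  rw [h3]
  have h6 : r ^ 2 * |θ - η| ^ 2 ≤ r ^ 2 * (10 ^ 2 * Real.sin ((θ - η) / 2) ^ 2) := by gcongr
  nlinarith [sq_nonneg (r - s)]

/-- A compatible family of functions on the rays extends to a Hölder continuous function on the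
plane that vanishes near the origin. -/
theorem IsRayFamily.exists_extension {C α m : ℝ} {T : Set ℝ} {ρ φ F : ℝ → ℝ} {P : ℝ → ℝ → ℝ}
    (h : IsRayFamily C α m T ρ φ F P) (hα : 0 < α) (hα1 : α ≤ 1) (hC : 0 ≤ C) (hm : 0 < m)
    (hφ : ∀ t ∈ T, |φ t| ≤ 3 * Real.pi / 4) :
    ∃ p : ℂ → ℝ, (∀ z w, |p z - p w| ≤ 6 * C * ‖z - w‖ ^ α) ∧ (∀ z, ‖z‖ ≤ m / 2 → p z = 0) ∧
      ∀ t ∈ T, ∀ r, 0 ≤ r → p (polar r (φ t)) = P t r := by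
  have hray : ∀ s ∈ T, ∀ t ∈ T, ∀ x y, 0 ≤ x → x ≤ y →
      |P s x - P t y| ≤ 6 * C * ‖polar x (φ s) - polar y (φ t)‖ ^ α := by
    intro s hs t ht x y hx hxy
    set N := ‖polar x (φ s) - polar y (φ t)‖
    have hN : 0 ≤ N := norm_nonneg _
    have h1 := h.angular s hs t ht x hx
    have h2 := h.radial t ht x y
    have h3 : (x * |φ s - φ t|) ^ α ≤ 5 * N ^ α :=
      (Real.rpow_le_rpow (by positivity)
        (mul_angle_le_norm_polar_sub hx hxy (hφ s hs) (hφ t ht)) hα.le).trans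
        (const_mul_rpow_le hα1 (by norm_num) hN)
    have h4 : |x - y| ^ α ≤ N ^ α := Real.rpow_le_rpow (abs_nonneg _)
      (abs_sub_le_norm_polar_sub hx (hx.trans hxy) _ _) hα.le
    have h5 := mul_le_mul_of_nonneg_left h3 hC
    have h6 := mul_le_mul_of_nonneg_left h4 hC
    have h7 := abs_sub_le (P s x) (P t x) (P t y)
    linarith
  have hzero : ∀ t ∈ T, ∀ x, 0 ≤ x → ∀ z : ℂ, ‖z‖ ≤ m / 2 →
      |P t x| ≤ 6 * C * ‖polar x (φ t) - z‖ ^ α := by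
    intro t ht x hx z hz
    rcases le_total x (m / 2) with hxm | hxm
    · rw [h.eq_zero t ht x hxm, abs_zero]
      positivity
    · have h1 := h.radial t ht x (m / 2)
      rw [h.eq_zero t ht _ le_rfl, sub_zero, abs_of_nonneg (sub_nonneg.2 hxm)] at h1
      have h2 : x - m / 2 ≤ ‖polar x (φ t) - z‖ := by
        have := norm_sub_norm_le (polar x (φ t)) z
        rw [norm_polar, abs_of_nonneg hx] at this
        linarith
      have h3 := Real.rpow_le_rpow (sub_nonneg.2 hxm) h2 hα.le
      have h4 := mul_le_mul_of_nonneg_left h3 hC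
      have h5 : 0 ≤ C * ‖polar x (φ t) - z‖ ^ α := by positivity
      linarith
  let ι := {i : ℝ × ℝ // i.1 ∈ T ∧ 0 ≤ i.2} ⊕ {z : ℂ // ‖z‖ ≤ m / 2}
  let y : ι → ℝ := Sum.elim (fun i => P i.1.1 i.1.2) fun _ => 0
  let pt : ι → ℂ := Sum.elim (fun i => polar i.1.2 (φ i.1.1)) fun z => z.1
  have htri : ∀ z w v : ℂ, 6 * C * ‖z - v‖ ^ α ≤ 6 * C * ‖w - v‖ ^ α + 6 * C * ‖z - w‖ ^ α := by
    intro z w v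
    rw [← mul_add]
    refine mul_le_mul_of_nonneg_left ?_ (by linarith)
    refine (Real.rpow_le_rpow (norm_nonneg _) ?_ hα.le).trans
      (rpow_add_le_add_rpow hα hα1 (norm_nonneg _) (norm_nonneg _))
    rw [add_comm]
    exact norm_sub_le_norm_sub_add_norm_sub z w v
  have hy : ∀ i j, |y i - y j| ≤ 6 * C * ‖pt i - pt j‖ ^ α := by
    rintro (⟨⟨s, x⟩, hs, hx⟩ | ⟨z, hz⟩) (⟨⟨t, x'⟩, ht, hx'⟩ | ⟨w, hw⟩)
    · simp only [y, pt, Sum.elim_inl]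
      rcases le_total x x' with hxx | hxx
      · exact hray s hs t ht x x' hx hxx
      · rw [abs_sub_comm, norm_sub_rev]
        exact hray t ht s hs x' x hx' hxx
    · simp only [y, pt, Sum.elim_inl, Sum.elim_inr, sub_zero]
      exact hzero s hs x hx w hw
    · simp only [y, pt, Sum.elim_inl, Sum.elim_inr, zero_sub, abs_neg]
      rw [norm_sub_rev]
      exact hzero t ht x' hx' z hz
    · simp only [y, Sum.elim_inr, sub_self, abs_zero]
      positivity
  have : Nonempty ι := ⟨Sum.inr ⟨0, by rw [norm_zero]; linarith⟩⟩
  obtain ⟨p, hp1, hp2⟩ := exists_between_of_compatible y (fun _ => 0)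
    (fun i z => 6 * C * ‖z - pt i‖ ^ α) (fun i j z => by
      have h1 := (le_abs_self _).trans (hy i j)
      have h2 := htri (pt i) z (pt j)
      rw [norm_sub_rev (pt i) z] at h2
      linarith) (fun z w => 6 * C * ‖z - w‖ ^ α) fun i z w => htri z w (pt i)
  have hval : ∀ i, p (pt i) = y i := fun i => by
    have := hp2 i (pt i)
    rw [sub_self, norm_zero, Real.zero_rpow hα.ne', mul_zero, add_zero] at this
    exact sub_eq_zero.1 (abs_nonpos_iff.1 this)
  refine ⟨p, fun z w => ?_, fun z hz => hval (Sum.inr ⟨z, hz⟩),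
    fun t ht r hr => hval (Sum.inl ⟨(t, r), ht, hr⟩)⟩
  have h1 := hp1 z w
  have h2 := hp1 w z
  rw [norm_sub_rev] at h2
  rw [abs_le]
  constructor <;> linarith

/-! ### The generalized cotangent near the origin -/

theorem lipschitz_of_riccati {G : ℝ → ℝ} {ε : ℝ} (hε : |ε| ≤ 1)
    (hG : ∀ x ∈ Ioc (0 : ℝ) 1, |G x - 1| ≤ x ^ 2)
    (hG' : ∀ x ∈ Ioc (0 : ℝ) 1, HasDerivAt G (G x * (1 - G x) / x + ε * x) x) :
    ∀ x ∈ Ioc (0 : ℝ) 1, ∀ y ∈ Ioc (0 : ℝ) 1, |G x - G y| ≤ 3 * |x - y| := by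
  intro x hx y hy
  refine (convex_Ioc (0 : ℝ) 1).norm_image_sub_le_of_norm_hasDerivWithin_le
    (fun z hz => (hG' z hz).hasDerivWithinAt) (fun z hz => ?_) hy hx
  have h1 := hG z hz
  have h2 : |G z| ≤ 2 := by
    have := abs_add_le (G z - 1) 1
    rw [sub_add_cancel, abs_one] at this
    nlinarith [hz.1, hz.2]
  rw [Real.norm_eq_abs]
  refine (abs_add_le _ _).trans ?_
  rw [abs_div, abs_mul, abs_mul, abs_sub_comm 1, abs_of_pos hz.1]
  have h3 : |G z| * |G z - 1| / z ≤ 2 * z := by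
    rw [div_le_iff₀ hz.1]
    calc |G z| * |G z - 1| ≤ 2 * z ^ 2 := by gcongr
      _ = 2 * z * z := by ring
  have h4 : |ε| * z ≤ 1 * z := mul_le_mul_of_nonneg_right hε hz.1.le
  linarith [hz.2]

theorem mul_cot_bounds : (∀ x ∈ Ioc (0 : ℝ) 1, |x * (Real.cos x / Real.sin x) - 1| ≤ x ^ 2) ∧
    ∀ x ∈ Ioc (0 : ℝ) 1, ∀ y ∈ Ioc (0 : ℝ) 1,
      |x * (Real.cos x / Real.sin x) - y * (Real.cos y / Real.sin y)| ≤ 3 * |x - y| := by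
  have hsin : ∀ x ∈ Ioc (0 : ℝ) 1, 0 < Real.sin x := fun x hx =>
    Real.sin_pos_of_pos_of_lt_pi hx.1 (by linarith [hx.2, Real.pi_gt_three])
  have h1 : ∀ x ∈ Ioc (0 : ℝ) 1, |x * (Real.cos x / Real.sin x) - 1| ≤ x ^ 2 := fun x hx => by
    have hs := hsin x hx
    have hc : 0 < Real.cos x := Real.cos_pos_of_mem_Ioo
      ⟨by linarith [hx.1, Real.pi_gt_three], by linarith [hx.2, Real.pi_gt_three]⟩
    have ht := Real.lt_tan hx.1 (by linarith [hx.2, Real.pi_gt_three])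
    rw [Real.tan_eq_sin_div_cos, lt_div_iff₀ hc] at ht
    have h2 := Real.sin_le hx.1.le
    have h3 := Real.one_sub_sq_div_two_le_cos (x := x)
    have h4 : x * (Real.cos x / Real.sin x) ≤ 1 := by
      rw [← mul_div_assoc, div_le_one hs]; exact ht.le
    have h5 : Real.cos x ≤ x * (Real.cos x / Real.sin x) := by
      rw [← mul_div_assoc, le_div_iff₀ hs]
      nlinarith
    rw [abs_le]
    constructor <;> nlinarith
  refine ⟨h1, lipschitz_of_riccati (ε := -1) (by norm_num) h1 fun x hx => ?_⟩
  have hs := (hsin x hx).ne'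
  have hx0 := hx.1.ne'
  refine ((hasDerivAt_id x).mul
    ((Real.hasDerivAt_cos x).div (Real.hasDerivAt_sin x) hs)).congr_deriv
    ?_
  have := Real.sin_sq_add_cos_sq x
  simp only [id, Pi.div_apply]
  field_simp
  linear_combination 0 * this

theorem mul_coth_bounds : (∀ x ∈ Ioc (0 : ℝ) 1, |x * (Real.cosh x / Real.sinh x) - 1| ≤ x ^ 2) ∧
    ∀ x ∈ Ioc (0 : ℝ) 1, ∀ y ∈ Ioc (0 : ℝ) 1,
      |x * (Real.cosh x / Real.sinh x) - y * (Real.cosh y / Real.sinh y)| ≤ 3 * |x - y| := by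
  have hsin : ∀ x ∈ Ioc (0 : ℝ) 1, 0 < Real.sinh x := fun x hx => Real.sinh_pos_iff.2 hx.1
  have hmono : MonotoneOn (fun x => x * Real.cosh x - Real.sinh x) (Ici 0) := by
    refine monotoneOn_of_hasDerivWithinAt_nonneg (convex_Ici 0) (by fun_prop)
      (f' := fun x => x * Real.sinh x) (fun x _ => ?_) fun x hx => ?_
    · have := (((hasDerivAt_id x).mul (Real.hasDerivAt_cosh x)).sub
        (Real.hasDerivAt_sinh x)).hasDerivWithinAt (s := interior (Ici 0))
      refine this.congr_deriv ?_
      simp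
    · rw [interior_Ici] at hx
      exact mul_nonneg (le_of_lt hx) (Real.sinh_nonneg_iff.2 (le_of_lt hx))
  have h1 : ∀ x ∈ Ioc (0 : ℝ) 1, |x * (Real.cosh x / Real.sinh x) - 1| ≤ x ^ 2 := fun x hx => by
    have hs := hsin x hx
    have h2 := hmono (mem_Ici.2 le_rfl) (mem_Ici.2 hx.1.le) hx.1.le
    simp only [zero_mul, Real.sinh_zero, sub_zero] at h2
    have h3 := Real.self_le_sinh_iff.2 hx.1.le
    have h4 := Real.cosh_le_exp_half_sq x
    have hx2 : x ^ 2 ≤ 1 := pow_le_one₀ hx.1.le hx.2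
    have h5 := Real.abs_exp_sub_one_sub_id_le (x := x ^ 2 / 2)
      (by rw [abs_of_nonneg (by positivity)]; linarith)
    have h6 := (le_abs_self _).trans h5
    have h7 : 1 ≤ x * (Real.cosh x / Real.sinh x) := by
      rw [← mul_div_assoc, le_div_iff₀ hs]; linarith
    have h8 : x * (Real.cosh x / Real.sinh x) ≤ Real.cosh x := by
      rw [← mul_div_assoc, div_le_iff₀ hs]
      nlinarith [Real.cosh_pos x]
    rw [abs_le]
    constructor <;> nlinarith [sq_nonneg x]
  refine ⟨h1, lipschitz_of_riccati (ε := 1) (by norm_num) h1 fun x hx => ?_⟩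
  have hs := (hsin x hx).ne'
  have hx0 := hx.1.ne'
  refine ((hasDerivAt_id x).mul
    ((Real.hasDerivAt_cosh x).div (Real.hasDerivAt_sinh x) hs)).congr_deriv ?_
  simp only [id, Pi.div_apply]
  field_simp
  ring

theorem mul_cotK_bounds {K : ℝ} (hK : |K| ≤ 1) :
    (∀ r ∈ Ioc (0 : ℝ) 1, |r * cotK K r| ≤ 2) ∧
    ∀ r ∈ Ioc (0 : ℝ) 1, ∀ s ∈ Ioc (0 : ℝ) 1, |r * cotK K r - s * cotK K s| ≤ 3 * |r - s| := by
  have scale : ∀ {k : ℝ} {G : ℝ → ℝ}, 0 < k → k ≤ 1 → (∀ x ∈ Ioc (0 : ℝ) 1, |G x - 1| ≤ x ^ 2) →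
      (∀ x ∈ Ioc (0 : ℝ) 1, ∀ y ∈ Ioc (0 : ℝ) 1, |G x - G y| ≤ 3 * |x - y|) →
      (∀ r, r * cotK K r = G (k * r)) → (∀ r ∈ Ioc (0 : ℝ) 1, |r * cotK K r| ≤ 2) ∧
      ∀ r ∈ Ioc (0 : ℝ) 1, ∀ s ∈ Ioc (0 : ℝ) 1, |r * cotK K r - s * cotK K s| ≤ 3 * |r - s| := by
    intro k G hk hk1 h1 h2 hG
    have hmem : ∀ r ∈ Ioc (0 : ℝ) 1, k * r ∈ Ioc (0 : ℝ) 1 := fun r hr =>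
      ⟨mul_pos hk hr.1, mul_le_one₀ hk1 hr.1.le hr.2⟩
    refine ⟨fun r hr => ?_, fun r hr s hs => ?_⟩
    · have h3 := h1 _ (hmem r hr)
      have h4 : (k * r) ^ 2 ≤ 1 := pow_le_one₀ (hmem r hr).1.le (hmem r hr).2
      have := abs_add_le (G (k * r) - 1) 1
      rw [sub_add_cancel, abs_one] at this
      rw [hG]
      linarith
    · rw [hG, hG]
      refine (h2 _ (hmem r hr) _ (hmem s hs)).trans ?_
      rw [← mul_sub, abs_mul, abs_of_pos hk]
      exact mul_le_mul_of_nonneg_left (mul_le_of_le_one_left (abs_nonneg _) hk1) (by norm_num)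
  rw [abs_le] at hK
  rcases lt_trichotomy K 0 with h | h | h
  · refine scale (Real.sqrt_pos.2 (neg_pos.2 h)) (Real.sqrt_le_one.2 (by linarith))
      mul_coth_bounds.1 mul_coth_bounds.2 fun r => ?_
    simp only [cotK, if_pos h]
    ring
  · have : ∀ r ∈ Ioc (0 : ℝ) 1, r * cotK K r = 1 := fun r hr => by
      have := hr.1.ne'
      simp only [cotK, h, lt_irrefl, if_false, if_true]
      field_simp
    refine ⟨fun r hr => ?_, fun r hr s hs => ?_⟩
    · rw [this r hr]; norm_num
    · rw [this r hr, this s hs, sub_self, abs_zero]; positivity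
  · refine scale (Real.sqrt_pos.2 h) (Real.sqrt_le_one.2 hK.2)
      mul_cot_bounds.1 mul_cot_bounds.2 fun r => ?_
    simp only [cotK, if_neg h.not_gt, if_neg h.ne']
    ring

/-! ### Radial primitives of Hölder continuous functions on the disc -/

theorem continuous_of_holder_plane {α L : ℝ} (hα : 0 < α) {p : ℂ → ℝ}
    (hp : ∀ z w, |p z - p w| ≤ L * ‖z - w‖ ^ α) : Continuous p := by
  rw [continuous_iff_continuousAt]
  intro x
  rw [ContinuousAt, tendsto_iff_dist_tendsto_zero]
  have h : Tendsto (fun s : ℂ => L * ‖s - x‖ ^ α) (𝓝 x) (𝓝 0) := by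
    have : ContinuousAt (fun s : ℂ => L * ‖s - x‖ ^ α) x :=
      continuousAt_const.mul (ContinuousAt.rpow_const (by fun_prop) (Or.inr hα.le))
    have h2 := this.tendsto
    simpa [Real.zero_rpow hα.ne'] using h2
  exact squeeze_zero (fun _ => dist_nonneg) (fun s => by rw [Real.dist_eq]; exact hp s x) h

/-- The mean of `p` on the segment from the origin to `z`. -/
noncomputable def radialMean (p : ℂ → ℝ) (z : ℂ) : ℝ := ∫ s in (0 : ℝ)..1, p ((s : ℂ) * z)

/-- The integral of `p` along the segment from the origin to `z`. -/
noncomputable def radialPrimitive (p : ℂ → ℝ) (z : ℂ) : ℝ := ‖z‖ * radialMean p z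

section
variable {α L : ℝ} {p : ℂ → ℝ}

theorem radialMean_holder (hα : 0 < α) (hp : ∀ z w, |p z - p w| ≤ L * ‖z - w‖ ^ α) (hL : 0 ≤ L)
    (z w : ℂ) : |radialMean p z - radialMean p w| ≤ L * ‖z - w‖ ^ α := by
  have hc := continuous_of_holder_plane hα hp
  unfold radialMean
  rw [← intervalIntegral.integral_sub
    (Continuous.intervalIntegrable (by fun_prop) _ _)
    (Continuous.intervalIntegrable (by fun_prop) _ _)]
  have := intervalIntegral.norm_integral_le_of_norm_le_const (a := 0) (b := 1)
    (f := fun s : ℝ => p ((s : ℂ) * z) - p ((s : ℂ) * w)) (C := L * ‖z - w‖ ^ α) (fun s hs => by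
      rw [uIoc_of_le zero_le_one] at hs
      rw [Real.norm_eq_abs]
      refine (hp _ _).trans (mul_le_mul_of_nonneg_left
        (Real.rpow_le_rpow (norm_nonneg _) ?_ hα.le) hL)
      rw [← mul_sub, norm_mul, Complex.norm_real, Real.norm_eq_abs, abs_of_pos hs.1]
      exact mul_le_of_le_one_left (norm_nonneg _) hs.2)
  simpa using this

theorem radialMean_eq_zero {ε : ℝ} (hp0 : ∀ z, ‖z‖ ≤ ε → p z = 0) {z : ℂ} (hz : ‖z‖ ≤ ε) :
    radialMean p z = 0 := by
  unfold radialMean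
  rw [intervalIntegral.integral_congr (g := fun _ => 0)]
  · simp
  · intro s hs
    rw [uIcc_of_le zero_le_one] at hs
    refine hp0 _ (le_trans ?_ hz)
    rw [norm_mul, Complex.norm_real, Real.norm_eq_abs, abs_of_nonneg hs.1]
    exact mul_le_of_le_one_left (norm_nonneg _) hs.2

theorem radialPrimitive_polar {r : ℝ} (hr : 0 ≤ r) (θ : ℝ) :
    radialPrimitive p (polar r θ) = ∫ x in 0..r, p (polar x θ) := by
  have := intervalIntegral.smul_integral_comp_mul_left (a := 0) (b := 1)
    (fun x => p (polar x θ)) r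
  rw [mul_zero, mul_one, smul_eq_mul] at this
  rw [← this]
  unfold radialPrimitive radialMean
  rw [norm_polar, abs_of_nonneg hr]
  congr 2 with s
  unfold polar
  push_cast
  ring_nf

theorem continuous_polar (θ : ℝ) : Continuous fun r => polar r θ := by
  unfold polar
  fun_prop

theorem contDiffOn_radialPrimitive (hp : Continuous p) (R θ : ℝ) :
    ContDiffOn ℝ 1 (fun r => radialPrimitive p (polar r θ)) (Ioo 0 R) := by
  have hc : Continuous fun r => p (polar r θ) := hp.comp (continuous_polar θ)
  have h1 : ContDiff ℝ 1 fun r => ∫ x in 0..r, p (polar x θ) := by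
    rw [contDiff_one_iff_deriv]
    refine ⟨fun r => (hc.integral_hasStrictDerivAt 0 r).hasDerivAt.differentiableAt, ?_⟩
    have : (deriv fun r => ∫ x in 0..r, p (polar x θ)) = fun r => p (polar r θ) :=
      funext fun r => hc.deriv_integral _ 0 r
    rw [this]
    exact hc
  exact h1.contDiffOn.congr fun r hr => radialPrimitive_polar hr.1.le θ

theorem radialDeriv_radialPrimitive (hp : Continuous p) {ε : ℝ} (hε : 0 < ε)
    (hp0 : ∀ z, ‖z‖ ≤ ε → p z = 0) (z : ℂ) : radialDeriv (radialPrimitive p) z = p z := by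
  have hc : Continuous fun r => p (polar r z.arg) := hp.comp (continuous_polar _)
  unfold radialDeriv
  change deriv (fun s => radialPrimitive p (polar s z.arg)) ‖z‖ = p z
  rcases eq_or_ne z 0 with rfl | hz
  · have : (fun s => radialPrimitive p (polar s (0 : ℂ).arg)) =ᶠ[𝓝 ‖(0 : ℂ)‖] fun _ => 0 := by
      rw [norm_zero]
      filter_upwards [Metric.ball_mem_nhds (0 : ℝ) hε] with s hs
      rw [mem_ball_zero_iff, Real.norm_eq_abs] at hs
      unfold radialPrimitive
      rw [radialMean_eq_zero hp0 (by rw [norm_polar]; exact hs.le), mul_zero]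
    rw [this.deriv_eq, deriv_const, hp0 0 (by rw [norm_zero]; exact hε.le)]
  · have h0 : 0 < ‖z‖ := norm_pos_iff.2 hz
    have : (fun s => radialPrimitive p (polar s z.arg)) =ᶠ[𝓝 ‖z‖]
        fun s => ∫ x in 0..s, p (polar x z.arg) := by
      filter_upwards [lt_mem_nhds h0] with s hs
      exact radialPrimitive_polar hs.le _
    rw [this.deriv_eq, hc.deriv_integral _ 0 _]
    congr 1
    exact Complex.norm_mul_exp_arg_mul_I z

theorem abs_radialMean_le (hα : 0 < α) (hp : ∀ z w, |p z - p w| ≤ L * ‖z - w‖ ^ α) (hL : 0 ≤ L)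
    {ε : ℝ} (hε : 0 < ε) (hp0 : ∀ z, ‖z‖ ≤ ε → p z = 0) {z : ℂ} (hz : ‖z‖ ≤ 1) :
    |radialMean p z| ≤ L := by
  have h1 := radialMean_holder hα hp hL z 0
  rw [radialMean_eq_zero hp0 (z := 0) (by rw [norm_zero]; exact hε.le), sub_zero, sub_zero] at h1
  exact h1.trans (mul_le_of_le_one_right hL (Real.rpow_le_one (norm_nonneg _) hz hα.le))

/-- The radial primitive `f` of `p` satisfies `f / r ∈ C ^ α`, so that all terms of
`f ^ 2 + 2 f cot r + ∂_r f` are Hölder continuous. -/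
theorem riccatiDefect_holder (hα : 0 < α) (hα1 : α ≤ 1)
    (hp : ∀ z w, |p z - p w| ≤ L * ‖z - w‖ ^ α) (hL : 0 ≤ L)
    {ε : ℝ} (hε : 0 < ε) (hp0 : ∀ z, ‖z‖ ≤ ε → p z = 0) {K : ℝ} (hK : |K| ≤ 1) {z w : ℂ}
    (hz : ‖z‖ ≤ 1) (hw : ‖w‖ ≤ 1) :
    |riccatiDefect K (radialPrimitive p) z - riccatiDefect K (radialPrimitive p) w| ≤
      (4 * L ^ 2 + 11 * L) * ‖z - w‖ ^ α := by
  obtain ⟨hcot1, hcot2⟩ := mul_cotK_bounds hK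
  have hc := continuous_of_holder_plane hα hp
  set N := ‖z - w‖ ^ α with hN
  have hN0 : 0 ≤ N := by positivity
  have hU := radialMean_holder hα hp hL z w
  have hUz := abs_radialMean_le hα hp hL hε hp0 hz
  have hUw := abs_radialMean_le hα hp hL hε hp0 hw
  have hU0 : radialMean p 0 = 0 := radialMean_eq_zero hp0 (by rw [norm_zero]; exact hε.le)
  have hnn : |‖z‖ - ‖w‖| ≤ N := by
    have h1 : |‖z‖ - ‖w‖| ≤ 1 := by
      rw [abs_le]; constructor <;> linarith [norm_nonneg z, norm_nonneg w]
    exact (self_le_rpow hα1 (abs_nonneg _) h1).trans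
      (Real.rpow_le_rpow (abs_nonneg _) (abs_norm_sub_norm_le z w) hα.le)
  have hf : |radialPrimitive p z - radialPrimitive p w| ≤ 2 * (L * N) := by
    unfold radialPrimitive
    have e : ‖z‖ * radialMean p z - ‖w‖ * radialMean p w =
        (‖z‖ - ‖w‖) * radialMean p z + ‖w‖ * (radialMean p z - radialMean p w) := by ring
    rw [e]
    refine (abs_add_le _ _).trans ?_
    rw [abs_mul, abs_mul, abs_norm]
    have h1 : |‖z‖ - ‖w‖| * |radialMean p z| ≤ N * L := by gcongr
    have h2 : ‖w‖ * |radialMean p z - radialMean p w| ≤ 1 * (L * N) := by gcongr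
    linarith
  have habs : ∀ {z : ℂ}, ‖z‖ ≤ 1 → |radialMean p z| ≤ L → |radialPrimitive p z| ≤ L :=
    fun {z} hz hU => by
      unfold radialPrimitive
      rw [abs_mul, abs_norm]
      exact (mul_le_of_le_one_left (abs_nonneg _) hz).trans hU
  have hsq : |radialPrimitive p z ^ 2 - radialPrimitive p w ^ 2| ≤ 4 * L ^ 2 * N := by
    rw [sq_sub_sq, abs_mul]
    have h1 := abs_add_le (radialPrimitive p z) (radialPrimitive p w)
    have h2 : |radialPrimitive p z + radialPrimitive p w| ≤ 2 * L := by
      linarith [habs hz hUz, habs hw hUw]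
    calc _ ≤ (2 * L) * (2 * (L * N)) := by gcongr
      _ = _ := by ring
  have hcot : |radialMean p z * (‖z‖ * cotK K ‖z‖) - radialMean p w * (‖w‖ * cotK K ‖w‖)| ≤
      5 * (L * N) := by
    have hLN : 0 ≤ L * N := by positivity
    rcases eq_or_ne z 0 with rfl | hz0
    · rw [hU0, zero_mul, zero_sub, abs_neg]
      rw [hU0, zero_sub, abs_neg] at hU
      rcases eq_or_ne w 0 with rfl | hw0
      · rw [hU0, zero_mul, abs_zero]; linarith
      · have := hcot1 _ ⟨norm_pos_iff.2 hw0, hw⟩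
        rw [abs_mul]
        calc _ ≤ (L * N) * 2 := by gcongr
          _ ≤ _ := by linarith
    rcases eq_or_ne w 0 with rfl | hw0
    · rw [hU0, zero_mul, sub_zero]
      rw [hU0, sub_zero] at hU
      have := hcot1 _ ⟨norm_pos_iff.2 hz0, hz⟩
      rw [abs_mul]
      calc _ ≤ (L * N) * 2 := by gcongr
        _ ≤ _ := by linarith
    have h1 := hcot1 _ ⟨norm_pos_iff.2 hz0, hz⟩
    have h2 := hcot2 _ ⟨norm_pos_iff.2 hz0, hz⟩ _ ⟨norm_pos_iff.2 hw0, hw⟩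
    have e : radialMean p z * (‖z‖ * cotK K ‖z‖) - radialMean p w * (‖w‖ * cotK K ‖w‖) =
        (radialMean p z - radialMean p w) * (‖z‖ * cotK K ‖z‖) +
          radialMean p w * (‖z‖ * cotK K ‖z‖ - ‖w‖ * cotK K ‖w‖) := by ring
    rw [e]
    refine (abs_add_le _ _).trans ?_
    rw [abs_mul (radialMean p z - radialMean p w), abs_mul (radialMean p w)]
    have h3 : |radialMean p z - radialMean p w| * |‖z‖ * cotK K ‖z‖| ≤ (L * N) * 2 := by gcongr
    have h4 : |radialMean p w| * |‖z‖ * cotK K ‖z‖ - ‖w‖ * cotK K ‖w‖| ≤ L * (3 * N) := by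
      gcongr
      linarith
    linarith
  unfold riccatiDefect
  rw [radialDeriv_radialPrimitive hc hε hp0, radialDeriv_radialPrimitive hc hε hp0]
  have e : radialPrimitive p z ^ 2 + 2 * radialPrimitive p z * cotK K ‖z‖ + p z -
      (radialPrimitive p w ^ 2 + 2 * radialPrimitive p w * cotK K ‖w‖ + p w) =
      (radialPrimitive p z ^ 2 - radialPrimitive p w ^ 2) +
      2 * (radialMean p z * (‖z‖ * cotK K ‖z‖) - radialMean p w * (‖w‖ * cotK K ‖w‖)) +
      (p z - p w) := by
    unfold radialPrimitive
    ring
  rw [e]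
  have h1 := abs_add_le (radialPrimitive p z ^ 2 - radialPrimitive p w ^ 2 +
      2 * (radialMean p z * (‖z‖ * cotK K ‖z‖) - radialMean p w * (‖w‖ * cotK K ‖w‖))) (p z - p w)
  have h2 := abs_add_le (radialPrimitive p z ^ 2 - radialPrimitive p w ^ 2)
      (2 * (radialMean p z * (‖z‖ * cotK K ‖z‖) - radialMean p w * (‖w‖ * cotK K ‖w‖)))
  rw [abs_mul 2, abs_two] at h2
  have h3 := hp z w
  linarith

end

/-! ### The curve determined by the radius function -/

theorem sinK_bounds {K : ℝ} (hK : |K| ≤ 1) {r : ℝ} (hr : 0 < r) (hr1 : r ≤ 1) :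
    r / 2 ≤ sinK K r ∧ sinK K r ≤ 2 * r := by
  obtain ⟨hK1, hK2⟩ := abs_le.1 hK
  unfold sinK
  split_ifs with h1 h2
  · have hk : 0 < √(-K) := Real.sqrt_pos.2 (by linarith)
    have hk1 : √(-K) ≤ 1 := Real.sqrt_le_one.2 (by linarith)
    have hx : 0 < √(-K) * r := mul_pos hk hr
    have hx1 : √(-K) * r ≤ 1 := mul_le_one₀ hk1 hr.le hr1
    rw [le_div_iff₀ hk, div_le_iff₀ hk]
    constructor
    · have := Real.self_le_sinh_iff.2 hx.le
      linarith
    · have e1 := Real.abs_exp_sub_one_le (x := √(-K) * r) (by rwa [abs_of_pos hx])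
      have e2 := Real.abs_exp_sub_one_le (x := -(√(-K) * r)) (by rwa [abs_neg, abs_of_pos hx])
      rw [abs_of_pos hx] at e1
      rw [abs_neg, abs_of_pos hx] at e2
      rw [Real.sinh_eq]
      linarith [(abs_le.1 e1).2, (abs_le.1 e2).1]
  · constructor <;> linarith
  · have hK0 : 0 < K := lt_of_le_of_ne (not_lt.1 h1) (Ne.symm h2)
    have hk : 0 < √K := Real.sqrt_pos.2 hK0
    have hk1 : √K ≤ 1 := Real.sqrt_le_one.2 hK2
    have hx : 0 < √K * r := mul_pos hk hr
    have hx1 : √K * r ≤ 1 := mul_le_one₀ hk1 hr.le hr1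
    rw [le_div_iff₀ hk, div_le_iff₀ hk]
    constructor
    · have h3 := Real.mul_le_sin hx.le (by linarith [Real.pi_gt_three])
      have h4 : 1 / 2 ≤ 2 / Real.pi := by
        rw [div_le_div_iff₀ two_pos Real.pi_pos]
        linarith [Real.pi_le_four]
      have := mul_le_mul_of_nonneg_right h4 hx.le
      linarith
    · have := Real.sin_le hx.le
      linarith

theorem continuous_sinK (K : ℝ) : Continuous (sinK K) := by
  unfold sinK
  split_ifs <;> fun_prop

theorem tendsto_neg_nhdsWithin_Ioo (a b t₀ : ℝ) :
    Tendsto (fun t : ℝ => -t) (𝓝[Ioo (-b) (-a)] (-t₀)) (𝓝[Ioo a b] t₀) := by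
  refine tendsto_nhdsWithin_of_tendsto_nhds_of_eventually_within _ ?_ ?_
  · have : Tendsto (fun t : ℝ => -t) (𝓝 (-t₀)) (𝓝 t₀) := by
      simpa using (continuous_neg (G := ℝ)).tendsto (-t₀)
    exact this.mono_left nhdsWithin_le_nhds
  · filter_upwards [self_mem_nhdsWithin] with t ht
    exact ⟨by linarith [ht.2], by linarith [ht.1]⟩

theorem strictMonoOn_neg_reflect {a b : ℝ} {u : ℝ → ℝ} (hu : StrictMonoOn u (Ioo a b)) :
    StrictMonoOn (fun t => -u (-t)) (Ioo (-b) (-a)) := fun s hs t ht hst =>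
  neg_lt_neg (hu ⟨by linarith [ht.2], by linarith [ht.1]⟩ ⟨by linarith [hs.2], by linarith [hs.1]⟩
    (neg_lt_neg hst))

theorem hasDerivAt_reflect {ρ : ℝ → ℝ} {u t : ℝ} (h : HasDerivAt ρ u (-t)) :
    HasDerivAt (fun s => ρ (-s)) (-u) t := by
  have := h.scomp t (hasDerivAt_neg t)
  rw [neg_one_smul] at this
  exact this

/-- A convex function increases to the right of its (possibly only asymptotic) minimum. -/
theorem deriv_pos_of_argmin {a b t₀ m : ℝ} {ρ u : ℝ → ℝ} (ht₀ : a ≤ t₀)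
    (hρ : ∀ t ∈ Ioo a b, HasDerivAt ρ (u t) t) (hu : StrictMonoOn u (Ioo a b))
    (hlim : Tendsto ρ (𝓝[Ioo a b] t₀) (𝓝 m)) (hm : ∀ t ∈ Ioo a b, m ≤ ρ t) {t : ℝ}
    (ht : t ∈ Ioo a b) (h : t₀ < t) : 0 < u t := by
  by_contra hneg
  have hsub : Ioc t₀ t ⊆ Ioo a b := fun x hx => ⟨ht₀.trans_lt hx.1, hx.2.trans_lt ht.2⟩
  have hanti : StrictAntiOn ρ (Ioc t₀ t) := by
    refine strictAntiOn_of_hasDerivWithinAt_neg (convex_Ioc _ _)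
      (fun x hx => (hρ x (hsub hx)).continuousAt.continuousWithinAt)
      (fun x hx => (hρ x (hsub (interior_subset hx))).hasDerivWithinAt) fun x hx => ?_
    rw [interior_Ioc] at hx
    exact (hu (hsub ⟨hx.1, hx.2.le⟩) ht hx.2).trans_le (not_lt.1 hneg)
  set s := (t₀ + t) / 2 with hs
  have hs1 : s ∈ Ioc t₀ t := ⟨by linarith, by linarith⟩
  have hlim' : Tendsto ρ (𝓝[Ioo t₀ s] t₀) (𝓝 m) := hlim.mono_left
    (nhdsWithin_mono _ fun x hx => hsub ⟨hx.1, hx.2.le.trans hs1.2⟩)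
  have : (𝓝[Ioo t₀ s] t₀).NeBot := left_nhdsWithin_Ioo_neBot hs1.1
  have h1 : ρ s ≤ m := ge_of_tendsto hlim' (by
    filter_upwards [self_mem_nhdsWithin] with x hx
    exact (hanti ⟨hx.1, hx.2.le.trans hs1.2⟩ hs1 hx.2).le)
  have h2 : ρ t < ρ s := hanti hs1 ⟨h, le_rfl⟩ (by linarith)
  linarith [hm t ht]

/-- Where the radius increases, `A log (1 - ρ' ^ 2) + 2 log ρ` does not; hence the radius stays
away from `0` backwards in time. -/
theorem exists_pos_le_of_convexity {a b A : ℝ} {ρ u v : ℝ → ℝ} (hA : 0 < A)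
    (hρ : ∀ t ∈ Ioo a b, HasDerivAt ρ (u t) t) (hu : ∀ t ∈ Ioo a b, HasDerivAt u (v t) t)
    (hpos : ∀ t ∈ Ioo a b, 0 < ρ t) (hu0 : ∀ t ∈ Ioo a b, 0 < u t)
    (hu1 : ∀ t ∈ Ioo a b, |u t| < 1)
    (hconv : ∀ t ∈ Ioo a b, A⁻¹ ≤ ρ t * v t / (1 - u t ^ 2)) {t : ℝ} (ht : t ∈ Ioo a b) :
    ∃ δ > 0, ∀ s ∈ Ioo a t, δ ≤ ρ s := by
  have hsq : ∀ t ∈ Ioo a b, 0 < 1 - u t ^ 2 := fun t ht => by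
    have := (sq_lt_one_iff_abs_lt_one _).2 (hu1 t ht)
    linarith
  set g : ℝ → ℝ := fun t => A * Real.log (1 - u t ^ 2) + 2 * Real.log (ρ t) with hg
  have hgd : ∀ t ∈ Ioo a b, HasDerivAt g
      (A * (-(2 * u t * v t) / (1 - u t ^ 2)) + 2 * (u t / ρ t)) t := fun t ht => by
    have h1 : HasDerivAt (fun t => 1 - u t ^ 2) (-(2 * u t * v t)) t := by
      simpa using ((hu t ht).pow 2).const_sub 1
    exact ((h1.log (hsq t ht).ne').const_mul A).add (((hρ t ht).log (hpos t ht).ne').const_mul 2)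
  have hanti : AntitoneOn g (Ioo a b) := by
    refine antitoneOn_of_hasDerivWithinAt_nonpos (convex_Ioo _ _)
      (fun x hx => (hgd x hx).continuousAt.continuousWithinAt)
      (fun x hx => (hgd x (interior_subset hx)).hasDerivWithinAt) fun x hx => ?_
    have hx := interior_subset hx
    have h1 := hconv x hx
    have h2 := hpos x hx
    have h3 := hsq x hx
    have h4 : 1 ≤ A * (ρ x * v x / (1 - u x ^ 2)) := by
      have := mul_le_mul_of_nonneg_left h1 hA.le
      rwa [mul_inv_cancel₀ hA.ne'] at this
    have e : A * (-(2 * u x * v x) / (1 - u x ^ 2)) + 2 * (u x / ρ x) =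
        (2 * u x / ρ x) * (1 - A * (ρ x * v x / (1 - u x ^ 2))) := by
      field_simp
      ring
    rw [e]
    exact mul_nonpos_of_nonneg_of_nonpos (div_nonneg (by linarith [hu0 x hx]) h2.le) (by linarith)
  refine ⟨Real.exp (g t / 2), Real.exp_pos _, fun s hs => ?_⟩
  have hsI : s ∈ Ioo a b := ⟨hs.1, hs.2.trans ht.2⟩
  have h1 := hanti hsI ht hs.2.le
  have h2 : Real.log (1 - u s ^ 2) ≤ 0 :=
    Real.log_nonpos (hsq s hsI).le (by linarith [sq_nonneg (u s)])
  have h3 := mul_nonpos_of_nonneg_of_nonpos hA.le h2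
  rw [← Real.le_log_iff_exp_le (hpos s hsI)]
  simp only [hg] at h1 ⊢
  linarith

theorem inf_pos_of_left_endpoint {a b A m : ℝ} {ρ u v : ℝ → ℝ} (hA : 0 < A) (hab : a < b)
    (hρ : ∀ t ∈ Ioo a b, HasDerivAt ρ (u t) t) (hu : ∀ t ∈ Ioo a b, HasDerivAt u (v t) t)
    (hmono : StrictMonoOn u (Ioo a b)) (hpos : ∀ t ∈ Ioo a b, 0 < ρ t)
    (hu1 : ∀ t ∈ Ioo a b, |u t| < 1)
    (hconv : ∀ t ∈ Ioo a b, A⁻¹ ≤ ρ t * v t / (1 - u t ^ 2))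
    (hlim : Tendsto ρ (𝓝[Ioo a b] a) (𝓝 m)) (hm : ∀ t ∈ Ioo a b, m ≤ ρ t) : 0 < m := by
  have ht : (a + b) / 2 ∈ Ioo a b := ⟨by linarith, by linarith⟩
  obtain ⟨δ, hδ, h⟩ := exists_pos_le_of_convexity hA hρ hu hpos
    (fun t ht => deriv_pos_of_argmin le_rfl hρ hmono hlim hm ht ht.1) hu1 hconv ht
  have : (𝓝[Ioo a b] a).NeBot := left_nhdsWithin_Ioo_neBot hab
  refine hδ.trans_le (ge_of_tendsto hlim ?_)
  filter_upwards [self_mem_nhdsWithin, mem_nhdsWithin_of_mem_nhds (Iio_mem_nhds ht.1)] with s hs hs'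
  exact h s ⟨hs.1, hs'⟩

/-- A radius function with its base point and base curvature, as in the hypotheses of
`proposition5p2`. -/
structure IsDetectedCurve (A α a b t₀ K₀ : ℝ) (ρ : ℝ → ℝ) : Prop where
  pos_const : 0 < A
  alpha_pos : 0 < α
  alpha_le : α ≤ 1
  lt : a < b
  pos : ∀ t ∈ Ioo a b, 0 < ρ t
  le_one : ∀ t ∈ Ioo a b, ρ t ≤ 1
  contDiffOn : ContDiffOn ℝ 2 ρ (Ioo a b)
  abs_deriv_lt : ∀ t ∈ Ioo a b, |deriv ρ t| < 1
  argmin : IsArgmin (Ioo a b) ρ t₀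
  baseCurvature : IsBaseCurvature (Ioo a b) ρ t₀ K₀
  detected : FinitelyDetected A α (Ioo a b) ρ t₀ K₀

namespace IsDetectedCurve

variable {A α a b t₀ K₀ : ℝ} {ρ : ℝ → ℝ}

theorem mem_Icc (h : IsDetectedCurve A α a b t₀ K₀ ρ) : t₀ ∈ Icc a b := by
  have := h.argmin.1
  rwa [closure_Ioo h.lt.ne] at this

theorem hasDerivAt (h : IsDetectedCurve A α a b t₀ K₀ ρ) : ∀ t ∈ Ioo a b,
    HasDerivAt ρ (deriv ρ t) t := fun t ht =>
  ((h.contDiffOn.differentiableOn (by norm_num)).differentiableAt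
    (isOpen_Ioo.mem_nhds ht)).hasDerivAt

theorem hasDerivAt_deriv (h : IsDetectedCurve A α a b t₀ K₀ ρ) : ∀ t ∈ Ioo a b,
    HasDerivAt (deriv ρ) (deriv (deriv ρ) t) t := fun t ht => by
  have h1 : ContDiffOn ℝ (1 + 1) ρ (Ioo a b) := by
    rw [one_add_one_eq_two]
    exact h.contDiffOn
  have h2 := ((contDiffOn_succ_iff_deriv_of_isOpen isOpen_Ioo).1 h1).2.2
  exact ((h2.differentiableOn (by norm_num)).differentiableAt (isOpen_Ioo.mem_nhds ht)).hasDerivAt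

theorem one_sub_sq_pos (h : IsDetectedCurve A α a b t₀ K₀ ρ) {t : ℝ} (ht : t ∈ Ioo a b) :
    0 < 1 - deriv ρ t ^ 2 := by
  have := (sq_lt_one_iff_abs_lt_one _).2 (h.abs_deriv_lt t ht)
  linarith

theorem strictMonoOn_deriv (h : IsDetectedCurve A α a b t₀ K₀ ρ) :
    StrictMonoOn (deriv ρ) (Ioo a b) := by
  refine strictMonoOn_of_hasDerivWithinAt_pos (convex_Ioo _ _)
    (fun x hx => (h.hasDerivAt_deriv x hx).continuousAt.continuousWithinAt)
    (fun x hx => (h.hasDerivAt_deriv x (interior_subset hx)).hasDerivWithinAt) fun x hx => ?_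
  have hx := interior_subset hx
  have h1 := (inv_pos.2 h.pos_const).trans_le (h.detected.convexity x hx).1
  have h2 := (div_pos_iff_of_pos_right (h.one_sub_sq_pos hx)).1 h1
  exact (mul_pos_iff_of_pos_left (h.pos x hx)).1 h2

theorem one_le_const (h : IsDetectedCurve A α a b t₀ K₀ ρ) : 1 ≤ A := by
  have ht : (a + b) / 2 ∈ Ioo a b := ⟨by linarith [h.lt], by linarith [h.lt]⟩
  have h1 := (h.detected.convexity _ ht).1.trans (h.detected.convexity _ ht).2
  by_contra hlt
  have := (one_lt_inv₀ h.pos_const).2 (not_le.1 hlt)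
  linarith

theorem abs_curvature_le (h : IsDetectedCurve A α a b t₀ K₀ ρ) : |K₀| ≤ 1 := by
  have : (𝓝[Ioo a b] t₀).NeBot := mem_closure_iff_nhdsWithin_neBot.1 h.argmin.1
  refine le_of_tendsto h.baseCurvature.abs ?_
  filter_upwards [self_mem_nhdsWithin] with t ht
  exact h.detected.curvature t ht

theorem bddBelow (h : IsDetectedCurve A α a b t₀ K₀ ρ) : BddBelow (ρ '' Ioo a b) :=
  ⟨0, by rintro _ ⟨t, ht, rfl⟩; exact (h.pos t ht).le⟩

theorem inf_le (h : IsDetectedCurve A α a b t₀ K₀ ρ) : ∀ t ∈ Ioo a b,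
    sInf (ρ '' Ioo a b) ≤ ρ t := fun _ ht => csInf_le h.bddBelow (mem_image_of_mem _ ht)

theorem exists_lt_inf_add (h : IsDetectedCurve A α a b t₀ K₀ ρ) {η : ℝ} (hη : 0 < η) :
    ∃ t ∈ Ioo a b, ρ t < sInf (ρ '' Ioo a b) + η := by
  obtain ⟨_, ⟨t, ht, rfl⟩, hlt⟩ := exists_lt_of_csInf_lt ((nonempty_Ioo.2 h.lt).image ρ)
    (lt_add_of_pos_right (sInf (ρ '' Ioo a b)) hη)
  exact ⟨t, ht, hlt⟩

theorem deriv_pos (h : IsDetectedCurve A α a b t₀ K₀ ρ) {t : ℝ} (ht : t ∈ Ioo a b)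
    (hlt : t₀ < t) : 0 < deriv ρ t :=
  deriv_pos_of_argmin h.mem_Icc.1 h.hasDerivAt h.strictMonoOn_deriv h.argmin.2 h.inf_le ht hlt

theorem neg_mem_Ioo {a b t : ℝ} (ht : t ∈ Ioo (-b) (-a)) : -t ∈ Ioo a b :=
  ⟨by linarith [ht.2], by linarith [ht.1]⟩

theorem deriv_neg (h : IsDetectedCurve A α a b t₀ K₀ ρ) {t : ℝ} (ht : t ∈ Ioo a b)
    (hlt : t < t₀) : deriv ρ t < 0 := by
  have := deriv_pos_of_argmin (neg_le_neg h.mem_Icc.2)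
    (fun _ ht => hasDerivAt_reflect (h.hasDerivAt _ (neg_mem_Ioo ht)))
    (strictMonoOn_neg_reflect h.strictMonoOn_deriv)
    (h.argmin.2.comp (tendsto_neg_nhdsWithin_Ioo a b t₀))
    (fun t ht => h.inf_le (-t) (neg_mem_Ioo ht)) (t := -t)
    ⟨by linarith [ht.2], by linarith [ht.1]⟩ (neg_lt_neg hlt)
  rw [neg_neg] at this
  linarith

theorem apply_of_mem (h : IsDetectedCurve A α a b t₀ K₀ ρ) (ht₀ : t₀ ∈ Ioo a b) :
    ρ t₀ = sInf (ρ '' Ioo a b) := by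
  have := h.argmin.2
  rw [isOpen_Ioo.nhdsWithin_eq ht₀] at this
  exact tendsto_nhds_unique (h.hasDerivAt t₀ ht₀).continuousAt this

theorem deriv_of_mem (h : IsDetectedCurve A α a b t₀ K₀ ρ) (ht₀ : t₀ ∈ Ioo a b) :
    deriv ρ t₀ = 0 := by
  refine IsLocalMin.deriv_eq_zero ?_
  filter_upwards [isOpen_Ioo.mem_nhds ht₀] with t ht
  rw [h.apply_of_mem ht₀]
  exact h.inf_le t ht

theorem inf_pos (h : IsDetectedCurve A α a b t₀ K₀ ρ) : 0 < sInf (ρ '' Ioo a b) := by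
  have hconv := fun t ht => (h.detected.convexity t ht).1
  rcases eq_endpoints_or_mem_Ioo_of_mem_Icc h.mem_Icc with e | e | e
  · have := h.argmin.2
    rw [e] at this
    exact inf_pos_of_left_endpoint h.pos_const h.lt h.hasDerivAt h.hasDerivAt_deriv
      h.strictMonoOn_deriv h.pos h.abs_deriv_lt hconv this h.inf_le
  · have := h.argmin.2.comp (tendsto_neg_nhdsWithin_Ioo a b t₀)
    rw [e] at this
    refine inf_pos_of_left_endpoint (v := fun t => deriv (deriv ρ) (-t)) h.pos_const
      (neg_lt_neg h.lt)
      (fun t ht => hasDerivAt_reflect (h.hasDerivAt (-t) (neg_mem_Ioo ht)))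
      (fun t ht => ?_)
      (strictMonoOn_neg_reflect h.strictMonoOn_deriv) (fun t ht => h.pos _ (neg_mem_Ioo ht))
      (fun t ht => ?_) (fun t ht => ?_) this (fun t ht => h.inf_le (-t) (neg_mem_Ioo ht))
    · have := (hasDerivAt_reflect (h.hasDerivAt_deriv (-t) (neg_mem_Ioo ht))).neg
      rw [neg_neg] at this
      exact this
    · rw [abs_neg]; exact h.abs_deriv_lt _ (neg_mem_Ioo ht)
    · rw [neg_sq]; exact hconv _ (neg_mem_Ioo ht)
  · rw [← h.apply_of_mem e]
    exact h.pos _ e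

/-- The curve lies in every open ball that contains it in its closure: by convexity, the radius
has no interior maximum. -/
theorem lt_of_le (h : IsDetectedCurve A α a b t₀ K₀ ρ) {R : ℝ} (hR : ∀ t ∈ Ioo a b, ρ t ≤ R)
    {t : ℝ} (ht : t ∈ Ioo a b) : ρ t < R := by
  refine lt_of_le_of_ne (hR t ht) fun e => ?_
  have h0 : deriv ρ t = 0 := by
    refine IsLocalMax.deriv_eq_zero ?_
    filter_upwards [isOpen_Ioo.mem_nhds ht] with s hs
    rw [e]
    exact hR s hs
  have hsub : Ico t b ⊆ Ioo a b := fun x hx => ⟨ht.1.trans_le hx.1, hx.2⟩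
  have hmono : StrictMonoOn ρ (Ico t b) := by
    refine strictMonoOn_of_hasDerivWithinAt_pos (convex_Ico _ _)
      (fun x hx => (h.hasDerivAt x (hsub hx)).continuousAt.continuousWithinAt)
      (fun x hx => (h.hasDerivAt x (hsub (interior_subset hx))).hasDerivWithinAt) fun x hx => ?_
    rw [interior_Ico] at hx
    rw [← h0]
    exact h.strictMonoOn_deriv ht (hsub ⟨hx.1.le, hx.2⟩) hx.1
  have hs : (t + b) / 2 ∈ Ico t b := ⟨by linarith [ht.2], by linarith [ht.2]⟩
  have h1 := hmono ⟨le_rfl, ht.2⟩ hs (by linarith [ht.2])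
  have h2 := hR _ (hsub hs)
  linarith

end IsDetectedCurve

/-! ### The estimates for the curve and the angle `φ₀` -/

namespace IsDetectedCurve

variable {A α a b t₀ K₀ : ℝ} {ρ : ℝ → ℝ}

theorem sinK_mem (h : IsDetectedCurve A α a b t₀ K₀ ρ) {t : ℝ} (ht : t ∈ Ioo a b) :
    ρ t / 2 ≤ sinK K₀ (ρ t) ∧ sinK K₀ (ρ t) ≤ 2 * ρ t :=
  sinK_bounds h.abs_curvature_le (h.pos t ht) (h.le_one t ht)

theorem sinK_pos (h : IsDetectedCurve A α a b t₀ K₀ ρ) {t : ℝ} (ht : t ∈ Ioo a b) :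
    0 < sinK K₀ (ρ t) :=
  (half_pos (h.pos t ht)).trans_le (h.sinK_mem ht).1

theorem sqrt_le_one (t : ℝ) : √(1 - deriv ρ t ^ 2) ≤ 1 :=
  Real.sqrt_le_one.2 (by linarith [sq_nonneg (deriv ρ t)])

theorem sqrt_pos (h : IsDetectedCurve A α a b t₀ K₀ ρ) {t : ℝ} (ht : t ∈ Ioo a b) :
    0 < √(1 - deriv ρ t ^ 2) :=
  Real.sqrt_pos.2 (h.one_sub_sq_pos ht)

theorem continuousOn_speed (h : IsDetectedCurve A α a b t₀ K₀ ρ) :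
    ContinuousOn (fun t => √(1 - deriv ρ t ^ 2) / sinK K₀ (ρ t)) (Ioo a b) := by
  refine ContinuousOn.div ?_ ?_ fun t ht => (h.sinK_pos ht).ne'
  · have : ContinuousOn (deriv ρ) (Ioo a b) := fun t ht =>
      (h.hasDerivAt_deriv t ht).continuousAt.continuousWithinAt
    fun_prop
  · exact (continuous_sinK K₀).comp_continuousOn fun t ht =>
      (h.hasDerivAt t ht).continuousAt.continuousWithinAt

/-- The integral defining `φ₀` converges up to the endpoints of the interval, since the radius is
bounded away from `0`. -/
theorem intervalIntegrable_speed (h : IsDetectedCurve A α a b t₀ K₀ ρ) :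
    IntervalIntegrable (fun t => √(1 - deriv ρ t ^ 2) / sinK K₀ (ρ t))
      MeasureTheory.volume a b := by
  rw [intervalIntegrable_iff_integrableOn_Ioo_of_le h.lt.le]
  have hm := h.inf_pos
  refine MeasureTheory.IntegrableOn.of_bound (by simp)
    (h.continuousOn_speed.aestronglyMeasurable measurableSet_Ioo)
    (2 / sInf (ρ '' Ioo a b)) ?_
  refine MeasureTheory.ae_restrict_of_forall_mem measurableSet_Ioo fun t ht => ?_
  have h1 := (h.sinK_mem ht).1
  have h2 := h.inf_le t ht
  have h3 := h.sinK_pos ht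
  rw [Real.norm_eq_abs, abs_of_pos (div_pos (h.sqrt_pos ht) h3), div_le_div_iff₀ h3 hm]
  calc _ ≤ 1 * sInf (ρ '' Ioo a b) := by
        gcongr
        exact sqrt_le_one t
    _ ≤ _ := by linarith

theorem hasDerivAt_phi0 (h : IsDetectedCurve A α a b t₀ K₀ ρ) : ∀ t ∈ Ioo a b,
    HasDerivAt (phi0 ρ t₀ K₀) (√(1 - deriv ρ t ^ 2) / sinK K₀ (ρ t)) t := by
  intro t ht
  refine intervalIntegral.integral_hasDerivAt_right (h.intervalIntegrable_speed.mono_set ?_)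
    (h.continuousOn_speed.stronglyMeasurableAtFilter isOpen_Ioo t ht)
    (h.continuousOn_speed.continuousAt (isOpen_Ioo.mem_nhds ht))
  rw [uIcc_of_le h.lt.le]
  exact uIcc_subset_Icc h.mem_Icc ⟨ht.1.le, ht.2.le⟩

theorem speed_pos (h : IsDetectedCurve A α a b t₀ K₀ ρ) {t : ℝ} (ht : t ∈ Ioo a b) :
    0 < √(1 - deriv ρ t ^ 2) / sinK K₀ (ρ t) :=
  div_pos (h.sqrt_pos ht) (h.sinK_pos ht)

theorem xi_eq_dividedError (h : IsDetectedCurve A α a b t₀ K₀ ρ) {s : ℝ} (hs : s ∈ Ioo a b)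
    (t : ℝ) : xi α ρ t₀ K₀ s t =
      dividedError α ρ (fun t => √(1 - deriv ρ t ^ 2) / sinK K₀ (ρ t)) s t := by
  unfold xi dividedError curveScale
  have h1 := h.pos s hs
  have h2 := h.speed_pos hs
  rw [(h.hasDerivAt_phi0 s hs).deriv, abs_of_pos h2, Real.rpow_add h1, Real.rpow_one,
    Real.mul_rpow h1.le h2.le]
  ring

/-- The hypotheses of `proposition5p2`, restated without reference to the base curvature. The
constant is dictated by the variation of `φ₀'` on intervals where `ρ` varies by a factor `4`. -/
theorem curveData (h : IsDetectedCurve A α a b t₀ K₀ ρ) :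
    CurveData (A * 4 ^ A + 4) α (Ioo a b) ρ (deriv ρ)
      (fun t => √(1 - deriv ρ t ^ 2) / sinK K₀ (ρ t)) (phi0 ρ t₀ K₀) (f0 ρ K₀) := by
  have hA := h.one_le_const
  have h4 : (4 : ℝ) ≤ 4 ^ A := by
    have := Real.rpow_le_rpow_of_exponent_le (by norm_num : (1 : ℝ) ≤ 4) hA
    rwa [Real.rpow_one] at this
  have hB : 4 * A + 4 ≤ A * 4 ^ A + 4 := by nlinarith
  have hB' : A * 4 ^ A ≤ A * 4 ^ A + 4 := by linarith
  generalize A * 4 ^ A + 4 = B at hB hB'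
  clear h4
  have hα := h.alpha_pos
  have herr : ∀ s ∈ Ioo a b, ∀ t, 0 ≤
      dividedError α ρ (fun t => √(1 - deriv ρ t ^ 2) / sinK K₀ (ρ t)) s t := fun s hs t => by
    have h1 := h.pos s hs
    have h2 := h.speed_pos hs
    unfold dividedError curveScale
    positivity
  refine
    { one_le := by linarith
      alpha_pos := hα
      alpha_le := h.alpha_le
      ordConnected := ordConnected_Ioo
      pos := h.pos
      hasDerivAt := h.hasDerivAt
      abs_le_one := fun t ht => (h.abs_deriv_lt t ht).le
      strictMono := h.strictMonoOn_deriv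
      continuousOn := fun t ht => (h.hasDerivAt_deriv t ht).continuousAt.continuousWithinAt
      hasDerivAt_angle := h.hasDerivAt_phi0
      speed_pos := fun t ht => h.speed_pos ht
      speed_le := fun t ht => ?_
      le_speed := fun t ht hu => ?_
      turning := fun s hs t ht hst => ?_
      speed_comparable := fun J hJ hJc r hr hJr s hs t ht => ?_
      value_le := fun t ht => ?_
      slope_le := fun J hJ hJc r hr hJr s hs t ht hst => ?_
      slope_compare := ?_ }
  · have h1 := (h.sinK_mem ht).1
    have h2 := h.sinK_pos ht
    have h3 := h.pos t ht
    rw [← mul_div_assoc, div_le_iff₀ h2]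
    calc ρ t * √(1 - deriv ρ t ^ 2) ≤ ρ t * 1 := by
          gcongr
          exact sqrt_le_one t
      _ ≤ 2 * sinK K₀ (ρ t) := by linarith
      _ ≤ B * sinK K₀ (ρ t) := by
          gcongr
          linarith
  · have h1 := (h.sinK_mem ht).2
    have h2 := h.sinK_pos ht
    have h3 := h.pos t ht
    have h5 : deriv ρ t ^ 2 ≤ 1 / 4 := by nlinarith [(abs_le.1 hu).1, (abs_le.1 hu).2]
    have h6 : 1 / 2 ≤ √(1 - deriv ρ t ^ 2) := Real.le_sqrt_of_sq_le (by norm_num; linarith)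
    rw [← mul_div_assoc, ← mul_div_assoc, le_div_iff₀ h2, one_mul]
    calc sinK K₀ (ρ t) ≤ 4 * (ρ t * (1 / 2)) := by linarith
      _ ≤ B * (ρ t * √(1 - deriv ρ t ^ 2)) :=
        mul_le_mul (by linarith) (mul_le_mul_of_nonneg_left h6 h3.le) (by linarith) (by linarith)
  -- `ρ'' ≤ A (1 - ρ' ^ 2) / ρ ≤ 2 A φ₀'`
  · have hmono : MonotoneOn (fun t => B * phi0 ρ t₀ K₀ t - deriv ρ t) (Ioo a b) := by
      have hd : ∀ x ∈ Ioo a b, HasDerivAt (fun t => B * phi0 ρ t₀ K₀ t - deriv ρ t)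
          (B * (√(1 - deriv ρ x ^ 2) / sinK K₀ (ρ x)) - deriv (deriv ρ) x) x := fun x hx =>
        ((h.hasDerivAt_phi0 x hx).const_mul B).sub (h.hasDerivAt_deriv x hx)
      refine monotoneOn_of_hasDerivWithinAt_nonneg (convex_Ioo _ _)
        (fun x hx => (hd x hx).continuousAt.continuousWithinAt)
        (fun x hx => (hd x (interior_subset hx)).hasDerivWithinAt) fun x hx => ?_
      have hx := interior_subset hx
      have h1 := (h.sinK_mem hx).2
      have h2 := h.sinK_pos hx
      have h3 := h.pos x hx
      have h5 := h.one_sub_sq_pos hx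
      have h6 := (h.detected.convexity x hx).2
      have h7 := h.sqrt_pos hx
      have h8 := Real.sq_sqrt h5.le
      have h9 := sqrt_le_one (ρ := ρ) x
      set q := √(1 - deriv ρ x ^ 2)
      rw [div_le_iff₀ h5, ← h8] at h6
      have h10 : deriv (deriv ρ) x ≤ A * q / ρ x := by
        rw [le_div_iff₀ h3]
        have : A * q ^ 2 ≤ A * q := by
          gcongr
          nlinarith
        linarith
      have h11 : A * q / ρ x ≤ B * (q / sinK K₀ (ρ x)) := by
        rw [← mul_div_assoc, div_le_div_iff₀ h3 h2]
        calc A * q * sinK K₀ (ρ x) ≤ A * q * (2 * ρ x) := by gcongr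
          _ = (2 * A) * q * ρ x := by ring
          _ ≤ B * q * ρ x := by
            gcongr
            linarith
      exact sub_nonneg.2 (h10.trans h11)
    have := hmono hs ht hst
    simp only at this
    linarith
  · have h1 := h.detected.angle_variation J hJ hJc 4 (fun x hx y hy => by
      rw [div_le_iff₀ (h.pos y (hJ hy))]
      linarith [(hJr x hx).2, (hJr y hy).1]) s hs t ht
    rw [(h.hasDerivAt_phi0 s (hJ hs)).deriv, (h.hasDerivAt_phi0 t (hJ ht)).deriv,
      div_le_iff₀ (h.speed_pos (hJ ht))] at h1
    refine h1.trans ?_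
    exact mul_le_mul_of_nonneg_right hB' (h.speed_pos (hJ ht)).le
  · have h1 := h.detected.f0_bound {t} (singleton_subset_iff.2 ht) ordConnected_singleton (ρ t)
      (h.pos t ht) (fun s hs => by
        rw [mem_singleton_iff.1 hs]
        constructor <;> linarith [h.pos t ht]) t rfl
    rw [Real.rpow_add (h.pos t ht), Real.rpow_one] at h1
    have h2 := h.pos t ht
    refine h1.trans ?_
    gcongr
    linarith
  · have h1 := h.detected.slope_bound J hJ hJc r hr hJr s hs t ht hst
    rw [h.xi_eq_dividedError (hJ hs)] at h1
    refine h1.trans ?_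
    have := herr s (hJ hs) t
    gcongr
    linarith
  · intro J hJ hJc r hr hJr d t₁ h₁ t₂ h₂ t₃ h₃ t₄ h₄ h12 h34 hd2 hd3 hd4
    have hd0 : 0 ≤ d := (abs_nonneg _).trans hd2
    have h1 := h.detected.slope_compare J hJ hJc r hr hJr t₁ h₁ t₂ h₂ t₃ h₃ t₄ h₄ h12 h34
    rw [h.xi_eq_dividedError (hJ h₁), h.xi_eq_dividedError (hJ h₃)] at h1
    have hdiam : Metric.diam {t₁, t₂, t₃, t₄} ≤ 2 * d := by
      refine (Metric.diam_mono ?_ Metric.isBounded_closedBall).trans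
        (Metric.diam_closedBall (x := t₁) hd0)
      intro x hx
      rw [Metric.mem_closedBall, Real.dist_eq]
      rcases hx with rfl | rfl | rfl | rfl
      · rwa [sub_self, abs_zero]
      · exact hd2
      · exact hd3
      · exact hd4
    have h2 : Metric.diam {t₁, t₂, t₃, t₄} ^ α ≤ 2 * d ^ α :=
      (Real.rpow_le_rpow Metric.diam_nonneg hdiam hα.le).trans
        (const_mul_rpow_le h.alpha_le one_le_two hd0)
    have h3 := herr t₁ (hJ h₁) t₂
    have h5 := herr t₃ (hJ h₃) t₄
    have h6 : 0 ≤ d ^ α := Real.rpow_nonneg hd0 _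
    refine h1.trans ?_
    calc _ ≤ A * (2 * d ^ α + 2 * dividedError α ρ _ t₁ t₂ + 2 * dividedError α ρ _ t₃ t₄) := by
          gcongr <;> linarith
      _ = (2 * A) * (d ^ α + dividedError α ρ _ t₁ t₂ + dividedError α ρ _ t₃ t₄) := by ring
      _ ≤ _ := by
        gcongr
        linarith

theorem exists_rayFamily (h : IsDetectedCurve A α a b t₀ K₀ ρ) :
    ∃ P, IsRayFamily (6 * (A * 4 ^ A + 4) * branchConst (A * 4 ^ A + 4)) α (sInf (ρ '' Ioo a b))
      (Ioo a b) ρ (phi0 ρ t₀ K₀) (f0 ρ K₀) P := by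
  have hd := h.curveData
  rcases eq_endpoints_or_mem_Ioo_of_mem_Icc h.mem_Icc with e | e | e
  · exact hd.exists_rayFamily_of_monotone (fun t ht => (h.deriv_pos ht (by rw [e]; exact ht.1)).le)
      h.inf_pos h.inf_le fun η hη => h.exists_lt_inf_add hη
  -- At the right endpoint, the curve is traversed backwards.
  · obtain ⟨P, hP⟩ := hd.reflect.exists_rayFamily_of_monotone
      (fun t ht => by
        have := h.deriv_neg ht (by rw [e]; exact ht.2)
        linarith)
      h.inf_pos (fun t ht => h.inf_le _ ht) fun η hη => by
        obtain ⟨t, ht, hlt⟩ := h.exists_lt_inf_add hη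
        exact ⟨-t, by simpa using ht, by simpa using hlt⟩
    exact ⟨_, hP.reflect⟩
  · have := hd.exists_rayFamily_of_min e (h.deriv_of_mem e)
      (by unfold phi0; exact intervalIntegral.integral_same)
    rwa [h.apply_of_mem e] at this

end IsDetectedCurve

end RadialExt

open RadialExt
theorem proposition5p2 (A : ℝ) (hA : 0 < A) :
    ∃ C : ℝ, 0 < C ∧
      ∀ (α R a b t₀ K₀ : ℝ) (ρ : ℝ → ℝ),
        0 < α → α ≤ 1 → 0 < R → R ≤ Real.pi ^ 2 / 16 → a < b →
        (∀ t ∈ Ioo a b, 0 < ρ t ∧ ρ t ≤ R) →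
        ContDiffOn ℝ 2 ρ (Ioo a b) →
        (∀ t ∈ Ioo a b, |deriv ρ t| < 1) →
        IsArgmin (Ioo a b) ρ t₀ →
        IsBaseCurvature (Ioo a b) ρ t₀ K₀ →
        FinitelyDetected A α (Ioo a b) ρ t₀ K₀ →
        ∃ f : ℂ → ℝ,
          ContinuousOn f (Metric.ball 0 R) ∧
          (∀ θ : ℝ, ContDiffOn ℝ 1
            (fun r : ℝ => f ((r : ℂ) * Complex.exp ((θ : ℂ) * Complex.I))) (Ioo 0 R)) ∧
          (∀ t ∈ Ioo a b, gamma0 ρ t₀ K₀ t ∈ Metric.ball (0 : ℂ) R) ∧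
          (∀ t ∈ Ioo a b, f (gamma0 ρ t₀ K₀ t) = f0 ρ K₀ t) ∧
          (∀ z ∈ Metric.ball (0 : ℂ) (sInf (ρ '' Ioo a b) / 2), f z = 0) ∧
          (∀ z ∈ Metric.ball (0 : ℂ) R, |f z| ≤ C * ‖z‖) ∧
          (∀ z ∈ Metric.ball (0 : ℂ) R, ∀ w ∈ Metric.ball (0 : ℂ) R,
            |riccatiDefect K₀ f z - riccatiDefect K₀ f w| ≤ C * ‖z - w‖ ^ α) := by
  set M := 6 * (A * 4 ^ A + 4) * branchConst (A * 4 ^ A + 4) with hM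
  have hB : (1 : ℝ) ≤ A * 4 ^ A + 4 := by
    have : 0 < A * 4 ^ A := by positivity
    linarith
  have hM0 : 0 < M := by
    have := branchConst_pos hB
    positivity
  set L := 6 * M with hL
  have hL0 : 0 < L := by positivity
  have hLC : L ≤ 4 * L ^ 2 + 11 * L := by nlinarith
  refine ⟨4 * L ^ 2 + 11 * L, by positivity, ?_⟩
  intro α R a b t₀ K₀ ρ hα hα1 _ hR hab hρ hC2 hu hmin hK₀ hdet
  have hR1 : R < 1 := by
    refine hR.trans_lt ?_
    rw [div_lt_one (by norm_num)]
    nlinarith [Real.pi_pos, Real.pi_lt_four]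
  have h : IsDetectedCurve A α a b t₀ K₀ ρ :=
    { pos_const := hA, alpha_pos := hα, alpha_le := hα1, lt := hab
      pos := fun t ht => (hρ t ht).1
      le_one := fun t ht => (hρ t ht).2.trans hR1.le
      contDiffOn := hC2, abs_deriv_lt := hu, argmin := hmin, baseCurvature := hK₀
      detected := hdet }
  have hm := h.inf_pos
  obtain ⟨P, hP⟩ := h.exists_rayFamily
  obtain ⟨p, hp1, hp2, hp3⟩ := hP.exists_extension hα hα1 hM0.le hm hdet.angle_bound
  have hpc := continuous_of_holder_plane hα hp1
  have hball : ∀ z ∈ Metric.ball (0 : ℂ) R, ‖z‖ ≤ 1 := fun z hz =>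
    ((mem_ball_zero_iff.1 hz).trans hR1).le
  refine ⟨radialPrimitive p, ?_, fun θ => contDiffOn_radialPrimitive hpc R θ, fun t ht => ?_,
    fun t ht => ?_, fun z hz => ?_, fun z hz => ?_, fun z hz w hw =>
      riccatiDefect_holder hα hα1 hp1 hL0.le (half_pos hm) hp2 h.abs_curvature_le (hball z hz)
        (hball w hw)⟩
  · exact (continuous_norm.mul (continuous_of_holder_plane hα
      (radialMean_holder hα hp1 hL0.le))).continuousOn
  · rw [mem_ball_zero_iff]
    change ‖polar (ρ t) (phi0 ρ t₀ K₀ t)‖ < R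
    rw [norm_polar, abs_of_pos (h.pos t ht)]
    exact h.lt_of_le (fun t ht => (hρ t ht).2) ht
  · change radialPrimitive p (polar (ρ t) (phi0 ρ t₀ K₀ t)) = f0 ρ K₀ t
    rw [radialPrimitive_polar (h.pos t ht).le, ← hP.integral t ht]
    refine intervalIntegral.integral_congr fun r hr => ?_
    rw [uIcc_of_le (h.pos t ht).le] at hr
    exact hp3 t ht r hr.1
  · unfold radialPrimitive
    rw [radialMean_eq_zero hp2 (mem_ball_zero_iff.1 hz).le, mul_zero]
  · unfold radialPrimitive
    rw [abs_mul, abs_norm, mul_comm]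
    have := abs_radialMean_le hα hp1 hL0.le (half_pos hm) hp2 (hball z hz)
    gcongr
    linarith
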